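/- Let $d>2$, $\hbar>0$, and work on Euclidean phase space with the Weyl–Moyal product $f*g=f\exp\!\big(\tfrac{i\hbar}{2}(\overleftarrow{\partial_x}\overrightarrow{\partial_p}-\overleftarrow{\partial_p}\overrightarrow{\partial_x})\big)g$, $\mathrm{Tr} f=(2\pi\hbar)^{-d}\int d^dx\,d^dp\,f$, and $\theta(H*)=\frac1{2\pi i}\int_{c-i\infty}^{c+i\infty}\frac{d\lambda}{\lambda}\sum_k\frac{\lambda^k}{k!}(H*)^k$ ($c>0$). Let $\mathcal A_2[h]$ be the part quadratic in $h$ of $\mathrm{Tr}\,\theta((-p^2+h)*)$, $h(x,p)=\sum_\alpha h_\alpha(x)p^\alpha$. Its wave operator $W$, $\mathcal A_2[h]=\sum_{\alpha,\gamma}\int h_\alpha W_{\alpha\gamma}(\partial)h_\gamma$, has the generating function $P(q,q',\kappa)=\sum_{\alpha,\gamma}\frac{q'^\alpha q^\gamma}{\alpha!\gamma!}W_{\alpha\gamma}(\kappa)$, i.e. the value of the (symmetric) bilinear form of the quadratic Lagrangian on $e^{q'\cdot p-\kappa\cdot x}$ and $e^{q\cdot p+\kappa\cdot x}$. Write $\nu=\frac{d-3}2$,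 $\Box=\kappa^2$, $\rho^2=\Box q^2-(q\kappa)^2$, $\rho'^2=\Box q'^2-(q'\kappa)^2$, $\tau=\Box (qq')-(q\kappa)(q'\kappa)$, let $C^\nu_s$ be the Gegenbauer polynomials (for $d=3$, $\Gamma(\nu)C^\nu_s/\Gamma(s+\nu)$ means its limit $\nu\to0$), and let $z^{-a}J_a(z)$ denote the entire even function of $z$. Put $$\mathcal P^{(s)}=\Box^{\frac d2-2}\tfrac{\Gamma(\nu)}{\Gamma(s+\nu)}(\rho\rho')^sC^\nu_s\!\big(\tfrac{\tau}{\rho\rho'}\big),\qquad P^{(s)}_\mu=\Box^{\frac d2-2}\tfrac{\Gamma(\nu)}{\Gamma(s+\nu)}(\rho\rho')^{-\nu}J_{s+\nu}(m\rho)J_{s+\nu}(m\rho')C^\nu_s\!\big(\tfrac{\tau}{\rho\rho'}\big),\quad m=\tfrac{\mu}{\sqrt\Box}.$$ 1. For all $q,q'\in\mathbb R^d$ and $0\ne\kappa\in\mathbb R^d$, with $n=-\frac\hbar2\kappa$, $f=q+q'$, $z=\sqrt{-n^2f^2+(nf)^2}$, $$P(q,q',\kappa)=\kappa_d\,(n^2)^{\frac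 d2-2}z^{-\frac{d-3}2}J_{\frac{d-3}2}(z),\qquad \kappa_d=2^{-\frac{d+7}2}\pi^{\frac{1-d}2}\hbar^{-d}.$$ 2. For $m=\frac{\mu}{\sqrt\Box}=\frac{i\hbar}2$ and for $m=-\frac{i\hbar}2$, and $\kappa\neq0$, $$P(q,q',\kappa)=2^{\frac{d-3}2}\big(\tfrac\hbar2\big)^{d-4}\kappa_d\; m^{3-d}\sum_{s=0}^\infty(-1)^s\,\Gamma\!\big(s+\tfrac{d-1}2\big)P^{(s)}_\mu(q,q',\kappa).$$ 3. For every $s=0,1,2,\dots$, $\Box^{2-\frac d2}\mathcal P^{(s)}$ is a nonzero polynomial in $q,q',\partial$, of degree $s$ in $q$ and in $q'$ and $2s$ in $\partial$, symmetric in $q,q'$, $O(d)$-invariant, traceless and transverse ($\partial_q^2\mathcal P^{(s)}=0$, $\partial_q\cdot\partial\,\mathcal P^{(s)}=0$); so $\mathcal P^{(s)}$ is the wave operator of the conformal spin-$s$ action $\mathcal A_s[\varphi]=\int\varphi\,\mathcal P^{(s)}(\partial)\varphi$ on rank-$s$ tensor fields, and it is homogeneous of order $d-4+2s$ in $\partial$.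 4. There is exactly one family of polynomials $V_{\alpha\gamma}(\partial)$ with $W_{\alpha\gamma}=\Box^{\frac d2-2}V_{\alpha\gamma}$, and $V_{\alpha\gamma}$ is homogeneous of degree $|\alpha|+|\gamma|$. Let the $h_\alpha$ be Schwartz functions, and let $\varphi_s$ be the rank-$s$ part of $U_{s+\nu}(m\vec\rho)\,h$, where $U_a(z)=z^{-a}J_a(z)$, $m^2=-\frac{\hbar^2}4$, $\vec\rho^{\,2}=\Box\,\partial_p^2-(\partial_p\cdot\partial_x)^2$. Then $$\mathcal A_2[h]=\sum_{s=0}^\infty c_s\,\mathcal A_s[\varphi_s],\qquad c_s=2^{\frac{d-3}2}\big(\tfrac\hbar2\big)^{d-4}\kappa_d\,\Gamma\!\big(s+\tfrac{d-1}2\big)\big(\tfrac{\hbar^2}4\big)^s>0,$$ for every $h$ polynomial in $p$, and for every formal power series $h$ in $p$ separately in each order in $\partial$ (the terms with $|\alpha|+|\gamma|=N$ have order $d-4+N$, and those with $N$ odd vanish). For odd $d$, $\Box^{\frac d2-2}$ stands here for any antisymmetric operator whose square is $\Box^{d-4}$ (the Fourier multiplier with a measurable odd symbol $r$, where $r(k)^2=(-4\pi^2|k|^2)^{d-4}$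 for almost every $k$), and then $\mathcal A_2[h]=0$: the quadratic action is a boundary term. -/

import Mathlib

open scoped FourierTransform SchwartzMap Laplacian

noncomputable section

namespace ConfHS

/-! ### Phase space, Moyal product, and the perturbative expansion of `Tr θ(H*)` -/

/-- Euclidean `d`-dimensional space (used for `x`, for momenta `p`, and for `q`, `q'`). -/
abbrev E (d : ℕ) := EuclideanSpace ℝ (Fin d)

/-- Symbols: complex functions `f (x, p)` on phase space. -/
abbrev Symb (d : ℕ) := E d × E d → ℂ

variable {d : ℕ}

/-- The coordinate directions of phase space: `(i, false)` is `∂/∂xⁱ`, `(i, true)` is `∂/∂pᵢ`. -/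
def phaseVec (a : Fin d × Bool) : E d × E d :=
  if a.2 then (0, EuclideanSpace.single a.1 1) else (EuclideanSpace.single a.1 1, 0)

/-- The sign in `∇ = ∂/∂x (left) ∂/∂p (right) - ∂/∂p (left) ∂/∂x (right)`. -/
def nablaSign (a : Fin d × Bool) : ℂ := if a.2 then -1 else 1

/-- The `r`-th term `(1/r!) f (iħ/2 ∇)ʳ g` of the Moyal product. -/
def starTerm (ħ : ℝ) (r : ℕ) (f g : Symb d) (z : E d × E d) : ℂ :=
  (1 / (r.factorial : ℂ)) * (Complex.I * (ħ : ℂ) / 2) ^ r *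
    ∑ w : Fin r → Fin d × Bool,
      (∏ i, nablaSign (w i)) * iteratedFDeriv ℝ r f z (fun i => phaseVec (w i)) *
        iteratedFDeriv ℝ r g z (fun i => phaseVec ((w i).1, !(w i).2))

/-- The Weyl-Moyal product `f * g = f exp (iħ/2 ∇) g`. -/
def star (ħ : ℝ) (f g : Symb d) : Symb d := fun z => ∑' r, starTerm ħ r f g z

/-- The symbol `H = -p²`. -/
def vacuum : Symb d := fun z => -((‖z.2‖ ^ 2 : ℝ) : ℂ)

/-- `(-p²) * ... * (-p²)`, the coefficient of `e₁⁰ e₂⁰` in the `k`-th Moyal power of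
`-p² + e₁ h₁ + e₂ h₂`. -/
def powZero (ħ : ℝ) : ℕ → Symb d
  | 0 => fun _ => 1
  | k + 1 => star ħ vacuum (powZero ħ k)

/-- The coefficient of `e` in the `k`-th Moyal power of `-p² + e h`. -/
def powOne (ħ : ℝ) (h : Symb d) : ℕ → Symb d
  | 0 => fun _ => 0
  | k + 1 => star ħ vacuum (powOne ħ h k) + star ħ h (powZero ħ k)

/-- The coefficient of `e₁ e₂` in the `k`-th Moyal power of `-p² + e₁ h₁ + e₂ h₂`.
The coefficient of `e²` in the `k`-th Moyal power of `-p² + e h` is `powTwo ħ h h k / 2`. -/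
def powTwo (ħ : ℝ) (h₁ h₂ : Symb d) : ℕ → Symb d
  | 0 => fun _ => 0
  | k + 1 => star ħ vacuum (powTwo ħ h₁ h₂ k) + star ħ h₁ (powOne ħ h₂ k) +
      star ħ h₂ (powOne ħ h₁ k)

/-- `L` is the value at `x` of the symmetric bilinear form of the quadratic term (in `h`) of the
Lagrangian of `Tr θ((-p² + h)*)`, where `Tr f = (2πħ)⁻ᵈ ∫ dx dp f`,
`exp (λ H*) = ∑ₖ λᵏ/k! (H*)ᵏ`, and `θ(H*) = (2πi)⁻¹ ∫ (dλ/λ) exp (λ H*)` along the vertical line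
`λ = c + iτ`, `c > 0`.
`K λ p` is the mixed second-order coefficient of `exp (λ H*)` at `(x, p)`; the quadratic form
`h ↦ A₂[h]` is the diagonal of the bilinear form with density `K / 2`. -/
def IsQuadraticLagrangian (ħ : ℝ) (h₁ h₂ : Symb d) (x : E d) (L : ℂ) : Prop :=
  ∃ K : ℂ → E d → ℂ,
    (∀ l : ℂ, 0 < l.re → ∀ p : E d,
      HasSum (fun k : ℕ => l ^ k / (k.factorial : ℂ) * powTwo ħ h₁ h₂ k (x, p)) (K l p)) ∧
    (∀ l : ℂ, 0 < l.re → MeasureTheory.Integrable (K l)) ∧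
    ∀ c : ℝ, 0 < c →
      (∀ T : ℝ, IntervalIntegrable
        (fun τ : ℝ => ((c : ℂ) + τ * Complex.I)⁻¹ * ∫ p, K ((c : ℂ) + τ * Complex.I) p)
        MeasureTheory.volume (-T) T) ∧
      Filter.Tendsto
        (fun T : ℝ => (1 / (2 * (Real.pi : ℂ))) * ∫ τ in (-T)..T,
          ((c : ℂ) + τ * Complex.I)⁻¹ *
            ((1 / 2) * (1 / (2 * (Real.pi : ℂ) * ħ) ^ d) * ∫ p, K ((c : ℂ) + τ * Complex.I) p))
        Filter.atTop (nhds L)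

/-- The symbol `exp (q·p + κ·x)`. -/
def planeWave (q κ : E d) : Symb d := fun z =>
  Complex.exp ((inner ℝ q z.2 + inner ℝ κ z.1 : ℝ) : ℂ)

/-- `P` is the value `P(q, q', κ)` of the generating function of the quadratic term of `Tr θ(H*)`
around `H = -p²`. If `A₂[h] = ∑ ∫ h^{m(k)} P_{m(k)|n(k')}(∂) h^{n(k')}`, then inserting
`exp (q'·p - κ·x)` in the left slot and `exp (q·p + κ·x)` in the right one gives
`P(q, q', κ) = ∑ q^{n(k')} q'^{m(k)} P_{m(k)|n(k')}(κ) / (k! k'!)`. -/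
def IsGenFun (ħ : ℝ) (q q' κ : E d) (P : ℂ) : Prop :=
  ∀ x : E d, IsQuadraticLagrangian ħ (planeWave q' (-κ)) (planeWave q κ) x P

/-! ### Bessel functions and Gegenbauer polynomials -/

/-- The Taylor coefficient of `wʳ = z²ʳ` in the entire function `z^{-ν} J_ν(z)`. -/
def besselCoeff (ν : ℝ) (r : ℕ) : ℝ :=
  (-1) ^ r * (1 / 2 : ℝ) ^ (ν + 2 * r) / ((r.factorial : ℝ) * Real.Gamma (ν + r + 1))

/-- `besselReg ν (z²) = z^{-ν} J_ν(z)`, as an entire function of `w = z²`. -/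
def besselReg (ν : ℝ) (w : ℂ) : ℂ := ∑' r : ℕ, (besselCoeff ν r : ℂ) * w ^ r

/-- The Bessel function of the first kind, `J_ν(z)`. -/
def besselJ (ν : ℝ) (z : ℂ) : ℂ :=
  (z / 2) ^ (ν : ℂ) *
    ∑' r : ℕ, (-1) ^ r / ((r.factorial : ℂ) * Real.Gamma (ν + r + 1)) * (z / 2) ^ (2 * r)

/-- The Gegenbauer polynomial `C_s^ν(t)`, `ν > 0`. -/
def gegenbauer (ν : ℝ) (s : ℕ) (t : ℝ) : ℝ :=
  ∑ k ∈ Finset.range (s / 2 + 1),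
    (-1) ^ k * Real.Gamma (s - k + ν) / (Real.Gamma ν * k.factorial * (s - 2 * k).factorial) *
      (2 * t) ^ (s - 2 * k)

/-- The coefficient of `(2t)^{s-2k}` in `Γ(ν)/Γ(s+ν) C_s^ν(t)`; it makes sense for `ν = 0` too
(this is needed for `d = 3`), where it is the limit `ν → 0`. -/
def gegCoeff (ν : ℝ) (s k : ℕ) : ℝ :=
  (-1) ^ k / ((∏ i ∈ Finset.range k, (s + ν - 1 - i)) * k.factorial * (s - 2 * k).factorial)

/-! ### Generating functions -/

/-- `κ_d = 2^{-(d+7)/2} π^{(1-d)/2} ħ^{-d}`. -/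
def kappa (d : ℕ) (ħ : ℝ) : ℝ :=
  2 ^ (-((d : ℝ) + 7) / 2) * Real.pi ^ ((1 - (d : ℝ)) / 2) * ħ ^ (-(d : ℝ))

/-- `κ_d (n²)^{d/2-2} z^{-(d-3)/2} J_{(d-3)/2}(z)` with `n = -(ħ/2) κ`, `f = q + q'` and
`z² = -n² f² + (n f)²`. -/
def genFun (ħ : ℝ) (q q' κ : E d) : ℂ :=
  let n : E d := (-(ħ / 2)) • κ
  let f : E d := q + q'
  ((kappa d ħ * (‖n‖ ^ 2) ^ ((d : ℝ) / 2 - 2) : ℝ) : ℂ) *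
    besselReg (((d : ℝ) - 3) / 2) ((-(‖n‖ ^ 2 * ‖f‖ ^ 2) + inner ℝ n f ^ 2 : ℝ) : ℂ)

/-- Polynomials in `q'` (left variables) and `q` (right variables) whose coefficients are
differential operators with constant coefficients, i.e. polynomials in `∂`. -/
abbrev GenPoly (d : ℕ) := MvPolynomial (Fin d ⊕ Fin d) (MvPolynomial (Fin d) ℂ)

def qv (i : Fin d) : GenPoly d := MvPolynomial.X (Sum.inr i)
def qv' (i : Fin d) : GenPoly d := MvPolynomial.X (Sum.inl i)
def dv (i : Fin d) : GenPoly d := MvPolynomial.C (MvPolynomial.X i)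

/-- `□`. -/
def boxPoly : GenPoly d := ∑ i, dv i * dv i
/-- `ρ² = □ q² - (q∂)²`. -/
def rhoSq : GenPoly d := boxPoly * (∑ i, qv i * qv i) - (∑ i, qv i * dv i) ^ 2
/-- `ρ'² = □ q'² - (q'∂)²`. -/
def rhoSq' : GenPoly d := boxPoly * (∑ i, qv' i * qv' i) - (∑ i, qv' i * dv i) ^ 2
/-- `τ = □ (qq') - (q∂)(q'∂)`. -/
def tauPoly : GenPoly d :=
  boxPoly * (∑ i, qv i * qv' i) - (∑ i, qv i * dv i) * (∑ i, qv' i * dv i)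

/-- `Γ(ν)/Γ(s+ν) (ρρ')^s C_s^ν(τ/(ρρ'))`, `ν = (d-3)/2`, as a polynomial: the generating function
of the conformal spin-`s` action up to the factor `□^{d/2-2}`. -/
def spinPoly (s : ℕ) : GenPoly d :=
  ∑ k ∈ Finset.range (s / 2 + 1),
    MvPolynomial.C (MvPolynomial.C ((gegCoeff (((d : ℝ) - 3) / 2) s k : ℝ) : ℂ)) *
      (2 * tauPoly) ^ (s - 2 * k) * (rhoSq * rhoSq') ^ k

/-- Evaluation of a generating polynomial at `q`, `q'`, `∂ = κ`. -/
def evalGen (G : GenPoly d) (q q' κ : E d) : ℂ :=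
  MvPolynomial.eval₂ (MvPolynomial.eval (fun i => (κ i : ℂ)))
    (Sum.elim (fun i => (q' i : ℂ)) (fun i => (q i : ℂ))) G

/-- The generating function of the conformal spin-`s` action,
`□^{d/2-2} Γ(ν)/Γ(s+ν) (ρρ')^s C_s^ν(τ/(ρρ'))`, `ν = (d-3)/2`. -/
def confGen (s : ℕ) (q q' κ : E d) : ℂ :=
  (((‖κ‖ ^ 2) ^ ((d : ℝ) / 2 - 2) : ℝ) : ℂ) * evalGen (spinPoly s) q q' κ

/-- The numerical value of `ρ²` at `∂ = κ`. -/
def rhoVal (q κ : E d) : ℝ := ‖κ‖ ^ 2 * ‖q‖ ^ 2 - inner ℝ q κ ^ 2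

/-- The numerical value of `τ` at `∂ = κ`. -/
def tauVal (q q' κ : E d) : ℝ := ‖κ‖ ^ 2 * inner ℝ q q' - inner ℝ q κ * inner ℝ q' κ

/-- The generating function of the deformed spin-`s` theory with `μ/√□ = m`:
`P^{(s)}_μ = □^{d/2-2} Γ(ν)/Γ(s+ν) (ρρ')^{-ν} J_{s+ν}(mρ) J_{s+ν}(mρ') C_s^ν(τ/(ρρ'))`,
`ν = (d-3)/2`, written without division by `ρρ'`
(`deformedGen_eq` below is the literal formula). -/
def deformedGen (m : ℂ) (s : ℕ) (q q' κ : E d) : ℂ :=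
  m ^ (2 * s + (d - 3)) *
    besselReg (s + ((d : ℝ) - 3) / 2) (m ^ 2 * rhoVal q κ) *
    besselReg (s + ((d : ℝ) - 3) / 2) (m ^ 2 * rhoVal q' κ) * confGen s q q' κ

/-! ### The closed formulas agree with the literal ones away from `ρ ρ' = 0` -/

theorem mul_ofReal_cpow {a : ℝ} (ha : 0 < a) {z : ℂ} (hz : z ≠ 0) (w : ℂ) :
    (z * a) ^ w = z ^ w * (a : ℂ) ^ w := by
  have ha' : (a : ℂ) ≠ 0 := by exact_mod_cast ha.ne'
  rw [Complex.cpow_def_of_ne_zero (mul_ne_zero hz ha'), Complex.cpow_def_of_ne_zero hz,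
    Complex.cpow_def_of_ne_zero ha', Complex.log_mul_ofReal a ha z hz, ← Complex.exp_add,
    Complex.ofReal_log ha.le]
  ring_nf

/-- `besselReg ν (z²) = z^{-ν} J_ν(z)`. -/
theorem besselReg_sq (ν : ℝ) {z : ℂ} (hz : z ≠ 0) :
    besselReg ν (z ^ 2) = z ^ (-(ν : ℂ)) * besselJ ν z := by
  have h2 : (z / 2) ^ (ν : ℂ) = z ^ (ν : ℂ) * (((1 / 2 : ℝ) ^ ν : ℝ) : ℂ) := by
    rw [Complex.ofReal_cpow (by norm_num), ← mul_ofReal_cpow (by norm_num) hz]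
    congr 1
    push_cast
    ring
  have h3 : z ^ (-(ν : ℂ)) * z ^ (ν : ℂ) = 1 := by
    rw [← Complex.cpow_add _ _ hz]; simp
  rw [besselJ, h2, ← mul_assoc, ← mul_assoc, h3, one_mul, besselReg, ← tsum_mul_left]
  refine tsum_congr fun r => ?_
  have h4 : (1 / 2 : ℝ) ^ (ν + 2 * r) = (1 / 2 : ℝ) ^ ν * (1 / 2) ^ (2 * r) := by
    rw [Real.rpow_add (by norm_num)]
    congr 1
    exact_mod_cast Real.rpow_natCast (1 / 2) (2 * r)
  rw [besselCoeff, h4]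
  push_cast
  rw [div_pow z, ← pow_mul, one_div_pow]
  ring

theorem gegCoeff_eq {ν : ℝ} (hν : 0 < ν) {s k : ℕ} (hk : 2 * k ≤ s) :
    gegCoeff ν s k = Real.Gamma ν / Real.Gamma (s + ν) *
      ((-1) ^ k * Real.Gamma (s - k + ν) /
        (Real.Gamma ν * k.factorial * (s - 2 * k).factorial)) := by
  have key : ∀ j : ℕ, j ≤ s → Real.Gamma (s + ν) =
      (∏ i ∈ Finset.range j, (s + ν - 1 - i)) * Real.Gamma (s - j + ν) := by
    intro j
    induction j with
    | zero => simp
    | succ j ih =>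
      intro hj
      have hj' : (j : ℝ) + 1 ≤ s := by exact_mod_cast hj
      rw [ih (by omega), Finset.prod_range_succ, mul_assoc]
      congr 1
      have h := Real.Gamma_add_one (s := (s : ℝ) + ν - 1 - j) (by linarith)
      push_cast
      rw [show (s : ℝ) - j + ν = s + ν - 1 - j + 1 by ring, h]
      congr 2
      ring
  have hks : (k : ℝ) ≤ s := by exact_mod_cast (by omega : k ≤ s)
  have h1 : Real.Gamma ν ≠ 0 := (Real.Gamma_pos_of_pos hν).ne'
  have h2 : Real.Gamma (s - k + ν) ≠ 0 := (Real.Gamma_pos_of_pos (by linarith)).ne'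
  have h3 : Real.Gamma (s + ν) ≠ 0 := (Real.Gamma_pos_of_pos (by positivity)).ne'
  have h4 := key k (by omega)
  have h5 : (∏ i ∈ Finset.range k, ((s : ℝ) + ν - 1 - i)) ≠ 0 := by
    intro h; rw [h, zero_mul] at h4; exact h3 h4
  rw [gegCoeff, h4]
  field_simp

theorem evalGen_spinPoly (s : ℕ) (q q' κ : E d) :
    evalGen (spinPoly s) q q' κ = ((∑ k ∈ Finset.range (s / 2 + 1),
      gegCoeff (((d : ℝ) - 3) / 2) s k * (2 * tauVal q q' κ) ^ (s - 2 * k) *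
        (rhoVal q κ * rhoVal q' κ) ^ k : ℝ) : ℂ) := by
  obtain ⟨φ, hφ⟩ : ∃ φ : GenPoly d →+* ℂ, φ = MvPolynomial.eval₂Hom
      (MvPolynomial.eval fun i => (κ i : ℂ))
      (Sum.elim (fun i => (q' i : ℂ)) fun i => (q i : ℂ)) := ⟨_, rfl⟩
  have hev : ∀ G, evalGen G q q' κ = φ G := fun G => by rw [hφ]; rfl
  have hq : ∀ i, φ (qv i) = (q i : ℂ) := fun i => by rw [hφ]; simp [qv]
  have hq' : ∀ i, φ (qv' i) = (q' i : ℂ) := fun i => by rw [hφ]; simp [qv']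
  have hd : ∀ i, φ (dv i) = (κ i : ℂ) := fun i => by rw [hφ]; simp [dv]
  have hc : ∀ c : ℂ, φ (MvPolynomial.C (MvPolynomial.C c)) = c := fun c => by rw [hφ]; simp
  have hbox : φ boxPoly = ((‖κ‖ ^ 2 : ℝ) : ℂ) := by
    rw [boxPoly, map_sum, EuclideanSpace.real_norm_sq_eq, Complex.ofReal_sum]
    exact Finset.sum_congr rfl fun i _ => by rw [map_mul, hd]; push_cast; ring
  have hinner : ∀ (f g : Fin d → GenPoly d) (x y : E d), (∀ i, φ (f i) = (x i : ℂ)) →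
      (∀ i, φ (g i) = (y i : ℂ)) → φ (∑ i, f i * g i) = ((inner ℝ x y : ℝ) : ℂ) := by
    intro f g x y hf hg
    rw [map_sum, PiLp.inner_apply, Complex.ofReal_sum]
    exact Finset.sum_congr rfl fun i _ => by
      rw [map_mul, hf, hg, real_inner_eq_re_inner]; simp; ring
  have hr : φ rhoSq = ((rhoVal q κ : ℝ) : ℂ) := by
    rw [rhoSq, map_sub, map_mul, map_pow, hbox, hinner _ _ q q hq hq, hinner _ _ q κ hq hd,
      rhoVal, real_inner_self_eq_norm_sq]
    push_cast
    ring
  have hr' : φ rhoSq' = ((rhoVal q' κ : ℝ) : ℂ) := by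
    rw [rhoSq', map_sub, map_mul, map_pow, hbox, hinner _ _ q' q' hq' hq', hinner _ _ q' κ hq' hd,
      rhoVal, real_inner_self_eq_norm_sq]
    push_cast
    ring
  have ht : φ tauPoly = ((tauVal q q' κ : ℝ) : ℂ) := by
    rw [tauPoly, map_sub, map_mul, map_mul, hbox, hinner _ _ q q' hq hq', hinner _ _ q κ hq hd,
      hinner _ _ q' κ hq' hd, tauVal]
    push_cast
    ring
  rw [hev, spinPoly, map_sum, Complex.ofReal_sum]
  refine Finset.sum_congr rfl fun k _ => ?_
  rw [map_mul, map_mul, map_pow, map_pow, map_mul, map_mul, hr, hr', ht, hc, map_ofNat]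
  push_cast
  ring

/-- The literal formula
`P^{(s)}_μ = □^{d/2-2} Γ(ν)/Γ(s+ν) (ρρ')^{-ν} J_{s+ν}(mρ) J_{s+ν}(mρ') C_s^ν(τ/(ρρ'))`. -/
theorem deformedGen_eq (hd : 3 < d) {m : ℂ} (hm : m ≠ 0) (s : ℕ) (q q' κ : E d) {ρ ρ' : ℝ}
    (hρ : 0 < ρ) (hρ' : 0 < ρ') (h : ρ ^ 2 = rhoVal q κ) (h' : ρ' ^ 2 = rhoVal q' κ) :
    deformedGen m s q q' κ =
      (((‖κ‖ ^ 2) ^ ((d : ℝ) / 2 - 2) *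
        (Real.Gamma (((d : ℝ) - 3) / 2) / Real.Gamma (s + ((d : ℝ) - 3) / 2)) *
        (ρ * ρ') ^ (-(((d : ℝ) - 3) / 2)) *
        gegenbauer (((d : ℝ) - 3) / 2) s (tauVal q q' κ / (ρ * ρ')) : ℝ) : ℂ) *
      besselJ (s + ((d : ℝ) - 3) / 2) (m * ρ) * besselJ (s + ((d : ℝ) - 3) / 2) (m * ρ') := by
  have hd' : (3 : ℝ) < d := by exact_mod_cast hd
  set ν : ℝ := ((d : ℝ) - 3) / 2 with hν
  have hν0 : 0 < ν := by rw [hν]; linarith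
  have hr : (ρ : ℂ) ≠ 0 := by exact_mod_cast hρ.ne'
  have hr' : (ρ' : ℂ) ≠ 0 := by exact_mod_cast hρ'.ne'
  have hgeg : evalGen (spinPoly s) q q' κ =
      ((Real.Gamma ν / Real.Gamma (s + ν) * (ρ * ρ') ^ s *
        gegenbauer ν s (tauVal q q' κ / (ρ * ρ')) : ℝ) : ℂ) := by
    rw [evalGen_spinPoly, ← h, ← h', ← hν]
    congr 1
    rw [gegenbauer, Finset.mul_sum]
    refine Finset.sum_congr rfl fun k hk => ?_
    have hk2 : 2 * k ≤ s := by
      have := Finset.mem_range.mp hk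
      omega
    rw [gegCoeff_eq hν0 hk2]
    have hp : (ρ * ρ') ^ s = (ρ * ρ') ^ (s - 2 * k) * (ρ ^ 2 * ρ' ^ 2) ^ k := by
      rw [← mul_pow ρ ρ' 2, ← pow_mul, ← pow_add]
      congr 1
      omega
    have hq : (2 * (tauVal q q' κ / (ρ * ρ'))) ^ (s - 2 * k) * (ρ * ρ') ^ (s - 2 * k) =
        (2 * tauVal q q' κ) ^ (s - 2 * k) := by
      rw [← mul_pow]
      congr 1
      field_simp
    rw [hp, ← hq]
    ring
  have hJ : ∀ x : ℝ, 0 < x → besselReg (s + ν) (m ^ 2 * ((x ^ 2 : ℝ) : ℂ)) =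
      m ^ (-((s + ν : ℝ) : ℂ)) * ((x ^ (-(s + ν)) : ℝ) : ℂ) * besselJ (s + ν) (m * x) := by
    intro x hx
    have hx' : (x : ℂ) ≠ 0 := by exact_mod_cast hx.ne'
    have e : m ^ 2 * ((x ^ 2 : ℝ) : ℂ) = (m * x) ^ 2 := by push_cast; ring
    rw [e, besselReg_sq _ (mul_ne_zero hm hx'), mul_ofReal_cpow hx hm, Complex.ofReal_cpow hx.le]
    push_cast
    rfl
  have hmm : m ^ (2 * s + (d - 3)) * m ^ (-((s + ν : ℝ) : ℂ)) * m ^ (-((s + ν : ℝ) : ℂ)) = 1 := by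
    rw [← Complex.cpow_natCast, ← Complex.cpow_add _ _ hm, ← Complex.cpow_add _ _ hm]
    have : ((2 * s + (d - 3) : ℕ) : ℂ) + -((s + ν : ℝ) : ℂ) + -((s + ν : ℝ) : ℂ) = 0 := by
      rw [hν]
      push_cast [Nat.cast_sub hd.le]
      ring
    rw [this, Complex.cpow_zero]
  have hrr : (ρ * ρ') ^ s * (ρ ^ (-(s + ν)) * ρ' ^ (-(s + ν))) = (ρ * ρ') ^ (-ν) := by
    rw [← Real.mul_rpow hρ.le hρ'.le, ← Real.rpow_natCast, ← Real.rpow_add (by positivity)]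
    congr 1
    ring
  rw [Complex.ofReal_add] at hmm
  rw [deformedGen, ← h, ← h', hJ ρ hρ, hJ ρ' hρ', confGen, hgeg, ← hrr]
  push_cast
  linear_combination (((‖κ‖ ^ 2) ^ ((d : ℝ) / 2 - 2) : ℝ) : ℂ) *
    ((Real.Gamma ν : ℂ) / (Real.Gamma (s + ν) : ℂ)) * ((ρ : ℂ) * ρ') ^ s *
    ((ρ ^ (-(s + ν)) : ℝ) : ℂ) * ((ρ' ^ (-(s + ν)) : ℝ) : ℂ) *
    (gegenbauer ν s (tauVal q q' κ / (ρ * ρ')) : ℂ) *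
    besselJ (s + ν) (m * ρ) * besselJ (s + ν) (m * ρ') * hmm

/-! ### Conformal higher-spin wave operators -/

/-- `G` is the generating polynomial of a conformal spin-`s` action `∫ φ P(∂) □^{d/2-2} φ` :
`P` is nonzero, acts on rank-`s` tensors, is of order `2s` in derivatives, is symmetric, traceless
and transverse, and is invariant under rotations and reflections. -/
structure IsConformalSpin (s : ℕ) (G : GenPoly d) : Prop where
  ne_zero : G ≠ 0
  rank_left : ∀ a ∈ G.support, ∑ i, a (Sum.inl i) = s
  rank_right : ∀ a ∈ G.support, ∑ i, a (Sum.inr i) = s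
  order : ∀ a, (G.coeff a).IsHomogeneous (2 * s)
  symm : MvPolynomial.rename Sum.swap G = G
  traceless : ∑ i, MvPolynomial.pderiv (Sum.inr i) (MvPolynomial.pderiv (Sum.inr i) G) = 0
  transverse : ∑ i, dv i * MvPolynomial.pderiv (Sum.inr i) G = 0
  invariant : ∀ (R : E d ≃ₗᵢ[ℝ] E d) (q q' κ : E d),
    evalGen G (R q) (R q') (R κ) = evalGen G q q' κ

/-! ### Actions on tensor fields -/

/-- `h(x, p) = ∑_α h_α(x) p^α`, a formal power series in `p` with Schwartz coefficients. -/
abbrev Fields (d : ℕ) := (Fin d →₀ ℕ) → 𝓢(E d, ℂ)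

/-- `∂_i`. -/
def opD (i : Fin d) : Module.End ℂ 𝓢(E d, ℂ) :=
  (LineDeriv.lineDerivOpCLM ℂ 𝓢(E d, ℂ) (EuclideanSpace.single i (1 : ℝ) : E d)).toLinearMap

/-- The differential operator `W(∂)`. -/
def diffOp (W : MvPolynomial (Fin d) ℂ) : Module.End ℂ 𝓢(E d, ℂ) :=
  ∑ a ∈ W.support, W.coeff a • ((List.finRange d).map fun i => opD i ^ a i).prod

/-- Wave operators `V_{α γ}(∂)`, indexed by pairs of multi-indices. -/
abbrev WaveOp (d : ℕ) := (Fin d →₀ ℕ) → (Fin d →₀ ℕ) → MvPolynomial (Fin d) ℂ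

def multiFactorial (α : Fin d →₀ ℕ) : ℕ := ∏ i, (α i).factorial

/-- `□^{d/2-2} V` is the wave operator of the quadratic term of `Tr θ(H*)` around `H = -p²`:
for every `κ ≠ 0`,
`P(q, q', κ) = (κ²)^{d/2-2} ∑_{α, γ} q'^α q^γ / (α! γ!) V_{α γ}(κ)`. -/
def IsWaveOperator (ħ : ℝ) (V : WaveOp d) : Prop :=
  ∀ q q' κ : E d, κ ≠ 0 → ∃ P : ℂ, IsGenFun ħ q q' κ P ∧
    HasSum (fun ab : (Fin d →₀ ℕ) × (Fin d →₀ ℕ) =>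
      (((‖κ‖ ^ 2) ^ ((d : ℝ) / 2 - 2) : ℝ) : ℂ) *
        (((∏ i, q' i ^ ab.1 i) * (∏ i, q i ^ ab.2 i) /
          (multiFactorial ab.1 * multiFactorial ab.2) : ℝ) : ℂ) *
        MvPolynomial.eval (fun i => (κ i : ℂ)) (V ab.1 ab.2)) P

/-- The wave operator `P_{α γ}(∂)` with generating function
`G = ∑_{α, γ} q'^α q^γ / (α! γ!) P_{α γ}`. -/
def components (G : GenPoly d) : WaveOp d := fun α γ =>
  (multiFactorial α * multiFactorial γ) • MvPolynomial.coeff (Finsupp.sumElim α γ) G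

/-- In even `d`: `(A, B) ↦ ∫ A □^{d/2-2} B`. -/
def localPairing (A B : 𝓢(E d, ℂ)) : ℂ :=
  ∫ x, A x * ((fun C : 𝓢(E d, ℂ) => Δ C)^[d / 2 - 2] B) x

/-- `(A, B) ↦ ∫ A R B` for the operator `R` with Fourier symbol `r`. -/
def fourierPairing (r : E d → ℂ) (A B : 𝓢(E d, ℂ)) : ℂ :=
  ∫ k, 𝓕 (fun x => A x) (-k) * r k * 𝓕 (fun x => B x) k

/-- `r` is the Fourier symbol of an antisymmetric operator `□^{d/2-2}`, `d` odd:
`r` is an odd function and `r²` is the symbol of `□^{d-4}`. -/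
def IsOddBoxRoot (r : E d → ℂ) : Prop :=
  Measurable r ∧ (∀ k, r (-k) = -r k) ∧
    ∀ᵐ k : E d, r k ^ 2 = (-(4 * (Real.pi : ℂ) ^ 2 * ((‖k‖ ^ 2 : ℝ) : ℂ))) ^ ((d : ℤ) - 4)

/-- `b` is the bilinear form `(A, B) ↦ ∫ A □^{d/2-2} B`; for odd `d` the nonlocal operator
`□^{d/2-2}` is any antisymmetric one. -/
def IsBoxPairing (b : 𝓢(E d, ℂ) → 𝓢(E d, ℂ) → ℂ) : Prop :=
  (Even d ∧ b = localPairing) ∨ (Odd d ∧ ∃ r, IsOddBoxRoot r ∧ b = fourierPairing r)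

/-- The multi-indices of degree `k`. -/
def multi (d k : ℕ) : Finset (Fin d →₀ ℕ) := (Finset.univ : Finset (Fin d)).finsuppAntidiag k

/-- The part of the action `∑_{α, γ} ∫ h_α □^{d/2-2} V_{α γ}(∂) h_γ` with `|α| + |γ| = N`. -/
def actionOrder (b : 𝓢(E d, ℂ) → 𝓢(E d, ℂ) → ℂ) (V : WaveOp d) (N : ℕ) (h : Fields d) : ℂ :=
  ∑ ab ∈ Finset.HasAntidiagonal.antidiagonal N, ∑ α ∈ multi d ab.1, ∑ γ ∈ multi d ab.2,
    b (h α) (diffOp (V α γ) (h γ))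

/-- The conformal spin-`s` action `∫ φ □^{d/2-2} P^{(s)}(∂) φ`, as a bilinear form in the rank-`s`
components of `φ` and `χ`. -/
def spinForm (b : 𝓢(E d, ℂ) → 𝓢(E d, ℂ) → ℂ) (s : ℕ) (φ χ : Fields d) : ℂ :=
  ∑ α ∈ multi d s, ∑ γ ∈ multi d s,
    b (φ α) (diffOp (components (spinPoly s) α γ) (χ γ))

/-- `∂/∂x^i` on fields. -/
def xD (i : Fin d) (h : Fields d) : Fields d := fun α => opD i (h α)

/-- `∂/∂p_i` on fields. -/
def pD (i : Fin d) (h : Fields d) : Fields d := fun α =>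
  (α i + 1) • h (α + Finsupp.single i 1)

/-- `ρ²` with `q` replaced by `∂/∂p`: `□ ∂_p² - (∂_p ∂_x)²`. -/
def rhoSqOp (h : Fields d) : Fields d :=
  (∑ i, ∑ j, xD i (xD i (pD j (pD j h)))) - ∑ i, ∑ j, xD i (pD i (xD j (pD j h)))

/-- The term with `2r` derivatives of the undressed spin-`s` field `φ_s`, the rank-`s` part of
`U_{s+(d-3)/2}(mρ) h`, where `U_ν(z) = z^{-ν} J_ν(z)`, `ρ² = □ ∂_p² - (∂_p ∂_x)²` and
`m² = -ħ²/4`. -/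
def undressOrder (ħ : ℝ) (s r : ℕ) (h : Fields d) : Fields d := fun α =>
  if α ∈ multi d s then
    ((besselCoeff (s + ((d : ℝ) - 3) / 2) r * (-(ħ ^ 2 / 4)) ^ r : ℝ) : ℂ) • (rhoSqOp^[r] h) α
  else 0

/-- The undressed spin-`s` field `φ_s`, for `h` a polynomial in `p`. -/
def undress (ħ : ℝ) (s : ℕ) (h : Fields d) : Fields d := fun α => ∑ᶠ r, undressOrder ħ s r h α

/-- `2^{(d-3)/2} (ħ/2)^{d-4} κ_d Γ(s + (d-1)/2)`. -/
def specCoeff (d : ℕ) (ħ : ℝ) (s : ℕ) : ℝ :=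
  2 ^ (((d : ℝ) - 3) / 2) * (ħ / 2) ^ ((d : ℝ) - 4) * kappa d ħ *
    Real.Gamma (s + ((d : ℝ) - 1) / 2)

end ConfHS

end

noncomputable section

namespace ConfHS

variable {d : ℕ}

/-! ### The finite form of Gegenbauer's addition theorem -/

/-! Plane waves diagonalize the problem. Moyal multiplication by `e^{q·p + κ·x}` multiplies by the
wave and shifts the other factor by an imaginary phase-space vector. Hence each ordering of the two
perturbations contributes to the `k`-th Moyal power an exponential times the divided difference of
`xᵏ` at the nodes `-p²`, `-p²`, `-(p ∓ iħκ)²` (`powTwo_planeWave`). Summed against `λᵏ/k!`, this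
becomes by the Hermite–Genocchi formula an integral over `s ∈ [0,1]` of a Gaussian in `p`
(`hasSum_divDiff₃`). The momentum integral is explicit, and the two orderings combine with weights
`s` and `1 - s` (`integral_heatKernel`). What is left is an inverse Laplace transform of `λ^{-β}
e^{F/λ} e^{λ A s(1-s)}` with `β = d/2 - 1` (`tendsto_inverseLaplace`), followed by beta integrals
over `s`. The resulting double power series depends on its two arguments only through their sum and
is a Bessel function (`integral_cexp_mul_borelKernel`, `isGenFun_genFun`).

The Bessel argument is `z² = -(ħ²/4) ρ²(q + q')`. Since `ρ²` is a quadratic form in `q` with polar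
form `τ`, `z²` is `m²(ρ² + ρ'² + 2τ)`, and Gegenbauer's addition theorem splits the function into
spins. In each degree the addition theorem is a polynomial identity whose coefficients form a
terminating very-well-poised hypergeometric sum, evaluated by telescoping (`sum_wellPoisedTerm`). It
therefore holds in every commutative ring over `ℝ` (`bessel_addition`). Over `ℂ`, with absolute
convergence, it gives the expansion in deformed spin theories (`hasSum_deformedGen`). Over
polynomials in `q`, `q'`, `∂` it decomposes the wave operator order by order (`loopGen_eq_sum`).

The spin-`s` polynomial depends on `q` only through `ρ²` and `τ`, whose gradients are transverse.
This gives transversality at once, and tracelessness becomes the two-term recursion of the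
Gegenbauer coefficients.

For the action, multiplying a generating polynomial by `q`, `q'` or `∂` corresponds to acting on the
fields with `∂/∂p` or `±∂/∂x` (`genForm_qv_mul`, `genForm_dv_mul`, `genForm_dv_mul_left`). The
powers of `ρ²` and `ρ'²` supplied by the addition theorem thereby turn into the undressing operators
on the two fields. For odd `d` the wave operator is symmetric and of even order while the pairing is
antisymmetric, so the action equals its own negative. -/

theorem cast_descFactorial_succ (n k : ℕ) :
    ((n.descFactorial (k + 1) : ℕ) : ℝ) = ((n : ℝ) - k) * n.descFactorial k := by
  rw [Nat.descFactorial_succ]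
  rcases le_or_gt k n with h | h
  · push_cast [Nat.cast_sub h]; ring
  · rw [Nat.descFactorial_eq_zero_iff_lt.mpr h]; simp

/-- The weight `Γ(N + 2k + 1) / ((N + 2k - 1) ⋯ (N + k))`, where `g n = Γ(N + 1 + n)`. -/
def wellPoisedWeight (N : ℝ) (g : ℕ → ℝ) : ℕ → ℝ
  | 0 => g 0
  | k + 1 => (N + 2 * k + 2) * g k

/-- The general term of the terminating very-well-poised `₄F₃(-1)` with parameters `N`, `1 + N/2`,
`-i`, `-j`, normalized so that the whole sum is `1`. The recursive weight keeps it regular at `N =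
0`, which occurs for `d = 3`. -/
def wellPoisedTerm (N : ℝ) (g : ℕ → ℝ) (i j k : ℕ) : ℝ :=
  wellPoisedWeight N g k * (-1) ^ k / k.factorial * i.descFactorial k * j.descFactorial k *
    g (i + j) / (g (i + k) * g (j + k))

/-- A telescoping certificate: the increment of the term in `i` is itself a difference in `k`, so
its partial sums are closed. The factor `i.descFactorial K` makes the boundary term vanish once `K >
i`. -/
theorem sum_wellPoisedTerm_sub {N : ℝ} {g : ℕ → ℝ} (hg : ∀ n, g (n + 1) = (N + 1 + n) * g n)
    (hpos : ∀ n, 0 < g n) (i j K : ℕ) :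
    ∑ k ∈ Finset.range (K + 1), (wellPoisedTerm N g (i + 1) j k - wellPoisedTerm N g i j k) =
      (-1) ^ K / K.factorial * g K * i.descFactorial K * j.descFactorial (K + 1) * g (i + j) /
        (g (i + K + 1) * g (j + K)) := by
  have hpos' : ∀ n : ℕ, N + 1 + n ≠ 0 := fun n h => by
    have := hg n
    rw [h, zero_mul] at this
    exact (hpos (n + 1)).ne' this
  have hne : ∀ n, g n ≠ 0 := fun n => (hpos n).ne'
  induction K with
  | zero =>
    simp only [zero_add, Finset.range_one, Finset.sum_singleton, wellPoisedTerm, wellPoisedWeight,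
      pow_zero, Nat.factorial_zero, Nat.descFactorial_zero, Nat.cast_one, add_zero,
      Nat.descFactorial_one]
    rw [show i + 1 + j = i + j + 1 by ring, hg i, hg (i + j)]
    have := hne i; have := hne j; have := hne (i + j); have := hpos' i
    field_simp
    push_cast
    ring
  | succ K ih =>
    rw [Finset.sum_range_succ, ih]
    simp only [wellPoisedTerm, wellPoisedWeight]
    rw [Nat.succ_descFactorial_succ, cast_descFactorial_succ j (K + 1), cast_descFactorial_succ j K,
      cast_descFactorial_succ i K,
      show i + 1 + j = i + j + 1 by ring, show i + 1 + (K + 1) = i + K + 1 + 1 by ring,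
      show i + (K + 1) + 1 = i + K + 1 + 1 by ring, show i + (K + 1) = i + K + 1 by ring,
      show j + (K + 1) = j + K + 1 by ring, hg (i + K + 1), hg (i + j), hg (j + K), hg K,
      Nat.factorial_succ]
    have := hne (i + K + 1); have := hne (j + K); have := hne (i + j); have := hpos' (i + K + 1)
    have := hpos' (j + K)
    have : (K.factorial : ℝ) ≠ 0 := by exact_mod_cast K.factorial_ne_zero
    have : (K : ℝ) + 1 ≠ 0 := by positivity
    push_cast at *
    field_simp
    ring

/-- By the telescoping certificate the sum does not depend on `i`, and for `i = 0` only `k = 0`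
survives. -/
theorem sum_wellPoisedTerm {N : ℝ} {g : ℕ → ℝ} (hg : ∀ n, g (n + 1) = (N + 1 + n) * g n)
    (hpos : ∀ n, 0 < g n) (i j : ℕ) :
    ∀ K, i ≤ K → ∑ k ∈ Finset.range (K + 1), wellPoisedTerm N g i j k = 1 := by
  induction i with
  | zero =>
    intro K _
    rw [Finset.sum_range_succ', Finset.sum_eq_zero]
    · have := (hpos 0).ne'; have := (hpos j).ne'
      simp [wellPoisedTerm, wellPoisedWeight, *]
    · intro k _
      simp [wellPoisedTerm]
  | succ i ih =>
    intro K hK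
    have h := sum_wellPoisedTerm_sub hg hpos i j K
    rw [Nat.descFactorial_eq_zero_iff_lt.mpr (by omega : i < K), Finset.sum_sub_distrib,
      ih K (by omega)] at h
    simp at h
    linarith

/-- With `s = n + 2k`, the factor `Γ(s+ν+1)` of the addition theorem cancels the denominators
`(s+ν-1)⋯(s+ν-k)` of the Gegenbauer coefficient. The case `k = 0` is separate because `Γ(s+ν)` has a
pole at `s = ν = 0`. -/
theorem gamma_mul_gegCoeff {ν : ℝ} (hν : 0 ≤ ν) (n k : ℕ) :
    Real.Gamma ((n + 2 * k : ℕ) + ν + 1) * gegCoeff ν (n + 2 * k) k =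
      wellPoisedWeight (n + ν) (fun m => Real.Gamma (n + ν + 1 + m)) k * (-1) ^ k /
        (k.factorial * n.factorial) := by
  rw [gegCoeff, Nat.add_sub_cancel]
  rcases k with _ | k
  · simp [wellPoisedWeight]
    ring
  · have key : ∀ j : ℕ, j ≤ k + 1 → Real.Gamma ((n + 2 * (k + 1) : ℕ) + ν) =
        (∏ i ∈ Finset.range j, (((n + 2 * (k + 1) : ℕ) : ℝ) + ν - 1 - i)) *
          Real.Gamma ((n + 2 * (k + 1) : ℕ) - j + ν) := by
      intro j
      induction j with
      | zero => simp
      | succ j ih =>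
        intro hj
        have hj' : (j : ℝ) + 1 ≤ k + 1 := by exact_mod_cast hj
        rw [ih (by omega), Finset.prod_range_succ, mul_assoc]
        congr 1
        have hn : (0 : ℝ) ≤ n := n.cast_nonneg
        have hk : (0 : ℝ) ≤ k := k.cast_nonneg
        have h := Real.Gamma_add_one (s := ((n + 2 * (k + 1) : ℕ) : ℝ) + ν - 1 - j)
          (by push_cast; linarith)
        push_cast at h ⊢
        rw [show (n : ℝ) + 2 * (k + 1) - j + ν = n + 2 * (k + 1) + ν - 1 - j + 1 by ring, h]
        congr 2
        ring
    have h1 := key (k + 1) le_rfl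
    have hpos : 0 < Real.Gamma ((n + 2 * (k + 1) : ℕ) + ν) :=
      Real.Gamma_pos_of_pos (by push_cast; positivity)
    have h2 : (∏ i ∈ Finset.range (k + 1), (((n + 2 * (k + 1) : ℕ) : ℝ) + ν - 1 - i)) ≠ 0 := by
      intro h; rw [h, zero_mul] at h1; exact hpos.ne' h1
    rw [Real.Gamma_add_one (by push_cast; positivity), h1, wellPoisedWeight]
    have h3 : (((n + 2 * (k + 1) : ℕ) : ℝ) - (k + 1 : ℕ) + ν) = n + ν + 1 + k := by
      push_cast; ring
    rw [h3]
    field_simp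
    push_cast
    ring

/-- The contribution of spin `n + 2k` to the monomial `(2t)ⁿ x^{a+k} y^{b+k}`, divided by the
multinomial coefficient expected on the other side, is one well-poised term with `N = n + ν`. -/
theorem bessel_addition_coeff {ν : ℝ} (hν : 0 ≤ ν) (n a b k : ℕ) :
    2 ^ ν * (-1) ^ (n + 2 * k) * Real.Gamma ((n + 2 * k : ℕ) + ν + 1) *
        besselCoeff ((n + 2 * k : ℕ) + ν) a * besselCoeff ((n + 2 * k : ℕ) + ν) b *
        gegCoeff ν (n + 2 * k) k =
      besselCoeff ν (n + ((a + k) + (b + k))) * (n + ((a + k) + (b + k))).factorial /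
        (n.factorial * ((a + k).factorial * (b + k).factorial)) *
        wellPoisedTerm (n + ν) (fun m => Real.Gamma (n + ν + 1 + m)) (a + k) (b + k) k := by
  have hG : ∀ m : ℕ, 0 < Real.Gamma (n + ν + 1 + m) := fun m =>
    Real.Gamma_pos_of_pos (by positivity)
  have h1 := gamma_mul_gegCoeff hν n k
  have h2 : (2 : ℝ) ^ ν * (1 / 2 : ℝ) ^ (((n + 2 * k : ℕ) : ℝ) + ν + 2 * a) *
      (1 / 2 : ℝ) ^ (((n + 2 * k : ℕ) : ℝ) + ν + 2 * b) =
      (1 / 2 : ℝ) ^ (ν + 2 * ((n + ((a + k) + (b + k)) : ℕ) : ℝ)) := by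
    have : (2 : ℝ) ^ ν = (1 / 2 : ℝ) ^ (-ν) := by
      rw [one_div, Real.inv_rpow (by norm_num), Real.rpow_neg (by norm_num), inv_inv]
    rw [this, ← Real.rpow_add (by norm_num), ← Real.rpow_add (by norm_num)]
    congr 1
    push_cast
    ring
  have hf : ∀ c : ℕ, ((c + k).descFactorial k : ℝ) = (c + k).factorial / c.factorial := by
    intro c
    have h := Nat.factorial_mul_descFactorial (n := c + k) (k := k) (by omega)
    rw [Nat.add_sub_cancel] at h
    have h0 : (c.factorial : ℝ) ≠ 0 := by exact_mod_cast c.factorial_ne_zero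
    rw [eq_div_iff h0, mul_comm]
    exact_mod_cast h
  have hne : ∀ c : ℕ, (c.factorial : ℝ) ≠ 0 := fun c => by exact_mod_cast c.factorial_ne_zero
  rw [mul_right_comm, mul_right_comm _ _ (gegCoeff ν (n + 2 * k) k),
    mul_assoc _ (Real.Gamma _) (gegCoeff ν (n + 2 * k) k), h1, wellPoisedTerm, hf, hf]
  simp only [besselCoeff]
  rw [← h2]
  have e1 : ((n + 2 * k : ℕ) : ℝ) + ν + a + 1 = n + ν + 1 + ((a + k + k : ℕ) : ℝ) := by
    push_cast; ring
  have e2 : ((n + 2 * k : ℕ) : ℝ) + ν + b + 1 = n + ν + 1 + ((b + k + k : ℕ) : ℝ) := by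
    push_cast; ring
  have e3 : ν + ((n + ((a + k) + (b + k)) : ℕ) : ℝ) + 1 =
      n + ν + 1 + ((a + k + (b + k) : ℕ) : ℝ) := by
    push_cast; ring
  rw [e1, e2, e3]
  have g1 := (hG (a + k + k)).ne'
  have g2 := (hG (b + k + k)).ne'
  have g3 := (hG (a + k + (b + k))).ne'
  have s1 : (-1 : ℝ) ^ (n + (a + k + (b + k))) = (-1) ^ n * (-1) ^ a * (-1) ^ b := by
    rw [show n + (a + k + (b + k)) = n + a + b + 2 * k by ring, pow_add _ _ (2 * k), pow_mul]
    norm_num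
    ring
  have s2 : (-1 : ℝ) ^ (n + 2 * k) = (-1) ^ n := by rw [pow_add, pow_mul]; norm_num
  rw [s1, s2]
  have := hne a; have := hne b; have := hne n; have := hne k; have := hne (a + k)
  have := hne (b + k); have := hne (n + (a + k + (b + k)))
  field_simp

/-- The coefficient of `(2t)ⁿ xⁱ yʲ` in the addition theorem. All spins `n + 2k` with `k ≤ min i j`
contribute to it, and their sum is the well-poised sum. -/
theorem sum_bessel_addition_coeff {ν : ℝ} (hν : 0 ≤ ν) (n i j : ℕ) :
    ∑ k ∈ Finset.range (min i j + 1),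
      2 ^ ν * (-1) ^ (n + 2 * k) * Real.Gamma ((n + 2 * k : ℕ) + ν + 1) *
        besselCoeff ((n + 2 * k : ℕ) + ν) (i - k) * besselCoeff ((n + 2 * k : ℕ) + ν) (j - k) *
        gegCoeff ν (n + 2 * k) k =
      besselCoeff ν (n + (i + j)) * (n + (i + j)).factorial /
        (n.factorial * (i.factorial * j.factorial)) := by
  have hpos : ∀ m : ℕ, 0 < Real.Gamma (n + ν + 1 + m) := fun m =>
    Real.Gamma_pos_of_pos (by positivity)
  have hg : ∀ m : ℕ, Real.Gamma (n + ν + 1 + (m + 1 : ℕ)) =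
      ((n + ν) + 1 + m) * Real.Gamma (n + ν + 1 + m) := fun m => by
    rw [← Real.Gamma_add_one (by positivity)]; push_cast; ring_nf
  have h := sum_wellPoisedTerm (g := fun m => Real.Gamma (n + ν + 1 + m)) hg hpos i j i le_rfl
  -- The terms with `j < k ≤ i` may be dropped, because `j.descFactorial k = 0`.
  rw [← Finset.sum_subset (s₁ := Finset.range (min i j + 1))] at h
  · refine Eq.trans ?_ ((congrArg _ h).trans (mul_one _))
    rw [Finset.mul_sum]
    refine Finset.sum_congr rfl fun k hk => ?_
    have hk' := Finset.mem_range.mp hk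
    obtain ⟨a, rfl⟩ : ∃ a, i = a + k := ⟨i - k, by omega⟩
    obtain ⟨b, rfl⟩ : ∃ b, j = b + k := ⟨j - k, by omega⟩
    rw [Nat.add_sub_cancel, Nat.add_sub_cancel, bessel_addition_coeff hν]
  · intro k hk
    have := Finset.mem_range.mp hk
    exact Finset.mem_range.mpr (by omega)
  · intro k hk hk2
    have h1 := Finset.mem_range.mp hk
    have h2 : ¬ k < min i j + 1 := fun h => hk2 (Finset.mem_range.mpr h)
    rw [wellPoisedTerm, (Nat.descFactorial_eq_zero_iff_lt (n := j)).mpr (by omega)]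
    simp

/-- The ring `S` is kept general because the addition theorem is needed twice: for complex numbers,
and for polynomials in `q`, `q'` with differential operators as coefficients. -/
theorem add_add_pow_eq_sum {S : Type*} [CommRing S] (φ : ℝ →+* S) (x y z : S) (J : ℕ) :
    (x + y + z) ^ J = ∑ p ∈ Finset.HasAntidiagonal.antidiagonal J, ∑ q ∈ Finset.HasAntidiagonal.antidiagonal p.2,
      φ (J.factorial / (p.1.factorial * (q.1.factorial * q.2.factorial))) *
        (z ^ p.1 * (x ^ q.1 * y ^ q.2)) := by
  rw [add_comm, (Commute.all z (x + y)).add_pow']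
  refine Finset.sum_congr rfl fun p hp => ?_
  rw [(Commute.all x y).add_pow', Finset.mul_sum, Finset.smul_sum]
  refine Finset.sum_congr rfl fun q hq => ?_
  have hp' := Finset.HasAntidiagonal.mem_antidiagonal.mp hp
  have hq' := Finset.HasAntidiagonal.mem_antidiagonal.mp hq
  have hc : ∀ a b : ℕ, (((a + b).choose a : ℕ) : ℝ) =
      (a + b).factorial / (a.factorial * b.factorial) := fun a b => by
    rw [Nat.cast_add_choose]
  have hne : (p.2.factorial : ℝ) ≠ 0 := by exact_mod_cast p.2.factorial_ne_zero
  have : ((J.factorial : ℝ) / (p.1.factorial * (q.1.factorial * q.2.factorial))) =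
      (((J.choose p.1 * p.2.choose q.1 : ℕ)) : ℝ) := by
    have h1 := hc p.1 p.2
    have h2 := hc q.1 q.2
    rw [hp'] at h1
    rw [hq'] at h2
    push_cast
    rw [h1, h2]
    field_simp
  rw [this, map_natCast]
  simp only [nsmul_eq_mul]
  push_cast
  ring

/-- The part of degree `J` of Gegenbauer's addition theorem for `z^{-ν} J_ν(z)`,
`z² = x + y + 2t`. -/
theorem bessel_addition {S : Type*} [CommRing S] (φ : ℝ →+* S) {ν : ℝ} (hν : 0 ≤ ν) (x y t : S)
    (J : ℕ) :
    φ (besselCoeff ν J) * (x + y + 2 * t) ^ J =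
      ∑ p ∈ Finset.HasAntidiagonal.antidiagonal J, ∑ q ∈ Finset.HasAntidiagonal.antidiagonal p.2,
        φ (2 ^ ν * (-1) ^ p.1 * Real.Gamma (p.1 + ν + 1) * besselCoeff (p.1 + ν) q.1 *
          besselCoeff (p.1 + ν) q.2) * (x ^ q.1 * y ^ q.2) *
        ∑ k ∈ Finset.range (p.1 / 2 + 1),
          φ (gegCoeff ν p.1 k) * (2 * t) ^ (p.1 - 2 * k) * (x * y) ^ k := by
  rw [add_add_pow_eq_sum φ, Finset.mul_sum]
  simp only [Finset.mul_sum]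
  have hL : ∀ p ∈ Finset.HasAntidiagonal.antidiagonal J, ∀ q ∈ Finset.HasAntidiagonal.antidiagonal p.2,
      φ (besselCoeff ν J) * (φ (J.factorial / (p.1.factorial * (q.1.factorial * q.2.factorial))) *
        ((2 * t) ^ p.1 * (x ^ q.1 * y ^ q.2))) =
      ∑ k ∈ Finset.range (min q.1 q.2 + 1),
        φ (2 ^ ν * (-1) ^ (p.1 + 2 * k) * Real.Gamma ((p.1 + 2 * k : ℕ) + ν + 1) *
          besselCoeff ((p.1 + 2 * k : ℕ) + ν) (q.1 - k) *
          besselCoeff ((p.1 + 2 * k : ℕ) + ν) (q.2 - k) * gegCoeff ν (p.1 + 2 * k) k) *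
        ((2 * t) ^ p.1 * (x ^ q.1 * y ^ q.2)) := by
    intro p hp q hq
    have hp' := Finset.HasAntidiagonal.mem_antidiagonal.mp hp
    have hq' := Finset.HasAntidiagonal.mem_antidiagonal.mp hq
    rw [← Finset.sum_mul, ← map_sum, sum_bessel_addition_coeff hν, ← mul_assoc, ← map_mul, hq', hp',
      mul_div_assoc]
  rw [Finset.sum_congr rfl fun p hp => Finset.sum_congr rfl (hL p hp)]
  simp only [Finset.sum_sigma']
  -- Both sides now run over the same data: exponents `(n, i, j)` with `k ≤ min i j` on the left,
  -- spin `s = n + 2k` with Bessel indices `i - k`, `j - k` on the right.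
  refine Finset.sum_nbij'
    (fun u => ⟨(u.1.1 + 2 * u.2.2, u.1.2 - 2 * u.2.2),
      ⟨(u.2.1.1 - u.2.2, u.2.1.2 - u.2.2), u.2.2⟩⟩)
    (fun u => ⟨(u.1.1 - 2 * u.2.2, u.1.2 + 2 * u.2.2),
      ⟨(u.2.1.1 + u.2.2, u.2.1.2 + u.2.2), u.2.2⟩⟩)
    ?_ ?_ ?_ ?_ ?_
  · rintro ⟨⟨n, r⟩, ⟨⟨i, j⟩, k⟩⟩ h
    simp only [Finset.mem_sigma, Finset.HasAntidiagonal.mem_antidiagonal, Finset.mem_range] at h ⊢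
    omega
  · rintro ⟨⟨n, r⟩, ⟨⟨i, j⟩, k⟩⟩ h
    simp only [Finset.mem_sigma, Finset.HasAntidiagonal.mem_antidiagonal, Finset.mem_range] at h ⊢
    omega
  · rintro ⟨⟨n, r⟩, ⟨⟨i, j⟩, k⟩⟩ h
    simp only [Finset.mem_sigma, Finset.HasAntidiagonal.mem_antidiagonal, Finset.mem_range] at h ⊢
    have e1 : r - 2 * k + 2 * k = r := by omega
    have e2 : i - k + k = i := by omega
    have e3 : j - k + k = j := by omega
    simp [e1, e2, e3]
  · rintro ⟨⟨n, r⟩, ⟨⟨i, j⟩, k⟩⟩ h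
    simp only [Finset.mem_sigma, Finset.HasAntidiagonal.mem_antidiagonal, Finset.mem_range] at h ⊢
    have e1 : n - 2 * k + 2 * k = n := by omega
    simp [e1]
  · rintro ⟨⟨n, r⟩, ⟨⟨i, j⟩, k⟩⟩ h
    simp only [Finset.mem_sigma, Finset.HasAntidiagonal.mem_antidiagonal, Finset.mem_range] at h ⊢
    obtain ⟨a, rfl⟩ : ∃ a, i = a + k := ⟨i - k, by omega⟩
    obtain ⟨b, rfl⟩ : ∃ b, j = b + k := ⟨j - k, by omega⟩
    simp only [Nat.add_sub_cancel, map_mul]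
    ring

/-! ### The conformal spin-`s` wave operators -/

/-- Real constants in `GenPoly d`. -/
def genConst : ℝ →+* GenPoly d :=
  (MvPolynomial.C.comp MvPolynomial.C).comp Complex.ofRealHom

theorem genConst_apply (c : ℝ) :
    (genConst c : GenPoly d) = MvPolynomial.C (MvPolynomial.C (c : ℂ)) := rfl

theorem spinPoly_eq (s : ℕ) : (spinPoly s : GenPoly d) =
    ∑ k ∈ Finset.range (s / 2 + 1), genConst (gegCoeff (((d : ℝ) - 3) / 2) s k) *
      ((2 * tauPoly) ^ (s - 2 * k) * (rhoSq * rhoSq') ^ k) := by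
  simp only [spinPoly, genConst_apply, mul_assoc]

/-- The Gegenbauer differential equation read on coefficients, for `s = n + 2k + 2`. It is what
makes the Laplacian of `spinPoly` cancel term by term. -/
theorem gegCoeff_succ {ν : ℝ} (hν : 0 ≤ ν) {n k : ℕ} :
    gegCoeff ν (n + 2 * k + 2) (k + 1) * ((k + 1) * (n + k + 1 + ν)) =
      -(gegCoeff ν (n + 2 * k + 2) k * ((n + 2) * (n + 1))) := by
  have h0 : (∏ i ∈ Finset.range k, (((n + 2 * k + 2 : ℕ) : ℝ) + ν - 1 - i)) ≠ 0 := by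
    refine Finset.prod_ne_zero_iff.mpr fun i hi => ?_
    have : (i : ℝ) + 1 ≤ k := by exact_mod_cast Finset.mem_range.mp hi
    have hn : (0 : ℝ) ≤ n := n.cast_nonneg
    have hk : (0 : ℝ) ≤ k := k.cast_nonneg
    push_cast
    intro h
    linarith
  have h1 : (n : ℝ) + k + 1 + ν ≠ 0 := by positivity
  have h2 : ((n + 2 * k + 2 : ℕ) : ℝ) + ν - 1 - k = n + k + 1 + ν := by push_cast; ring
  rw [gegCoeff, gegCoeff, Finset.prod_range_succ, h2,
    show n + 2 * k + 2 - 2 * (k + 1) = n by omega, show n + 2 * k + 2 - 2 * k = n + 2 by omega,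
    Nat.factorial_succ, Nat.factorial_succ (n + 1), Nat.factorial_succ n]
  have h3 : (n.factorial : ℝ) ≠ 0 := by exact_mod_cast n.factorial_ne_zero
  have h4 : (k.factorial : ℝ) ≠ 0 := by exact_mod_cast k.factorial_ne_zero
  push_cast
  field_simp
  ring

theorem sum_mul_sum_sub (f g a b : Fin d → GenPoly d) (x y u v : GenPoly d) :
    ∑ i, (x * f i - a i * u) * (y * g i - b i * v) =
      x * y * ∑ i, f i * g i - x * v * ∑ i, f i * b i - y * u * ∑ i, a i * g i +
        u * v * ∑ i, a i * b i := by
  simp only [Finset.mul_sum]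
  rw [← Finset.sum_sub_distrib, ← Finset.sum_sub_distrib, ← Finset.sum_add_distrib]
  exact Finset.sum_congr rfl fun _ _ => by ring

/-- Half the gradient of `rhoSq` in `q`. -/
def rhoGrad (i : Fin d) : GenPoly d := boxPoly * qv i - dv i * ∑ j, qv j * dv j

/-- The gradient of `tauPoly` in `q`. -/
def tauGrad (i : Fin d) : GenPoly d := boxPoly * qv' i - dv i * ∑ j, qv' j * dv j

theorem sum_qv_dv_comm (f g : Fin d → GenPoly d) : ∑ i, f i * g i = ∑ i, g i * f i :=
  Finset.sum_congr rfl fun _ _ => mul_comm _ _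

/-- Formally `tauGrad` and `rhoGrad` are `□` times the projections of `q'` and `q` orthogonal to
`∂`. Their scalar products are therefore `□` times `ρ'²`, `τ`, `ρ²`, and their products with `∂`
vanish. -/
theorem sum_tauGrad_mul_self : ∑ i, tauGrad i * tauGrad i = (boxPoly * rhoSq' : GenPoly d) := by
  simp only [tauGrad]
  rw [sum_mul_sum_sub, sum_qv_dv_comm dv qv', rhoSq', ← boxPoly]
  ring

theorem sum_tauGrad_mul_rhoGrad :
    ∑ i, tauGrad i * rhoGrad i = (boxPoly * tauPoly : GenPoly d) := by
  simp only [tauGrad, rhoGrad]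
  rw [sum_mul_sum_sub, sum_qv_dv_comm dv qv, tauPoly, ← boxPoly, sum_qv_dv_comm qv' qv]
  ring

theorem sum_rhoGrad_mul_self : ∑ i, rhoGrad i * rhoGrad i = (boxPoly * rhoSq : GenPoly d) := by
  simp only [rhoGrad]
  rw [sum_mul_sum_sub, sum_qv_dv_comm dv qv, rhoSq, ← boxPoly]
  ring

theorem sum_dv_mul_tauGrad : ∑ i, dv i * tauGrad i = (0 : GenPoly d) := by
  have : ∀ i : Fin d, dv i * tauGrad i =
      boxPoly * (qv' i * dv i) - (∑ j, qv' j * dv j) * (dv i * dv i) := fun i => by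
    rw [tauGrad]; ring
  rw [Finset.sum_congr rfl fun i _ => this i, Finset.sum_sub_distrib, ← Finset.mul_sum,
    ← Finset.mul_sum, ← boxPoly]
  ring

theorem sum_dv_mul_rhoGrad : ∑ i, dv i * rhoGrad i = (0 : GenPoly d) := by
  have : ∀ i : Fin d, dv i * rhoGrad i =
      boxPoly * (qv i * dv i) - (∑ j, qv j * dv j) * (dv i * dv i) := fun i => by
    rw [rhoGrad]; ring
  rw [Finset.sum_congr rfl fun i _ => this i, Finset.sum_sub_distrib, ← Finset.mul_sum,
    ← Finset.mul_sum, ← boxPoly]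
  ring

/-! ### Derivatives in `q`: tracelessness and transversality. -/

section pderiv

open MvPolynomial (pderiv)

theorem pderiv_dv (i j : Fin d) : pderiv (Sum.inr i) (dv j : GenPoly d) = 0 := by
  simp [dv]

theorem pderiv_qv' (i j : Fin d) : pderiv (Sum.inr i) (qv' j : GenPoly d) = 0 := by
  rw [qv', MvPolynomial.pderiv_X_of_ne (by simp)]

theorem pderiv_qv (i j : Fin d) :
    pderiv (Sum.inr i) (qv j : GenPoly d) = if j = i then 1 else 0 := by
  split_ifs with h
  · rw [qv, h, MvPolynomial.pderiv_X_self]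
  · rw [qv, MvPolynomial.pderiv_X_of_ne (by simpa using h)]

theorem pderiv_boxPoly (i : Fin d) : pderiv (Sum.inr i) (boxPoly : GenPoly d) = 0 := by
  simp [boxPoly, Derivation.leibniz, pderiv_dv]

theorem pderiv_sum_qv'_dv (i : Fin d) :
    pderiv (Sum.inr i) (∑ j, qv' j * dv j : GenPoly d) = 0 := by
  simp [Derivation.leibniz, pderiv_dv, pderiv_qv']

theorem pderiv_sum_qv_dv (i : Fin d) :
    pderiv (Sum.inr i) (∑ j, qv j * dv j : GenPoly d) = dv i := by
  simp [Derivation.leibniz, pderiv_dv, pderiv_qv]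

theorem pderiv_sum_qv_qv' (i : Fin d) :
    pderiv (Sum.inr i) (∑ j, qv j * qv' j : GenPoly d) = qv' i := by
  simp [Derivation.leibniz, pderiv_qv', pderiv_qv]

theorem pderiv_sum_qv_qv (i : Fin d) :
    pderiv (Sum.inr i) (∑ j, qv j * qv j : GenPoly d) = 2 * qv i := by
  simp [Derivation.leibniz, pderiv_qv]
  simp [two_mul, Finset.sum_add_distrib]

theorem pderiv_rhoSq' (i : Fin d) : pderiv (Sum.inr i) (rhoSq' : GenPoly d) = 0 := by
  simp [rhoSq', Derivation.leibniz, Derivation.leibniz_pow, pderiv_boxPoly, pderiv_dv, pderiv_qv']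

theorem pderiv_rhoSq (i : Fin d) : pderiv (Sum.inr i) (rhoSq : GenPoly d) = 2 * rhoGrad i := by
  simp only [rhoSq, map_sub, Derivation.leibniz, Derivation.leibniz_pow, pderiv_boxPoly,
    pderiv_sum_qv_dv, pderiv_sum_qv_qv, rhoGrad, smul_eq_mul, nsmul_eq_mul]
  push_cast
  ring

theorem pderiv_tauPoly (i : Fin d) : pderiv (Sum.inr i) (tauPoly : GenPoly d) = tauGrad i := by
  simp only [tauPoly, map_sub, Derivation.leibniz, pderiv_boxPoly,
    pderiv_sum_qv_dv, pderiv_sum_qv'_dv, pderiv_sum_qv_qv', tauGrad, smul_eq_mul]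
  ring

theorem pderiv_tauGrad (i : Fin d) : pderiv (Sum.inr i) (tauGrad i : GenPoly d) = 0 := by
  simp only [tauGrad, map_sub, Derivation.leibniz, pderiv_boxPoly, pderiv_dv, pderiv_qv',
    pderiv_sum_qv'_dv, smul_eq_mul]
  ring

theorem pderiv_rhoGrad (i : Fin d) :
    pderiv (Sum.inr i) (rhoGrad i : GenPoly d) = boxPoly - dv i * dv i := by
  simp only [rhoGrad, map_sub, Derivation.leibniz, pderiv_boxPoly, pderiv_dv, pderiv_qv,
    pderiv_sum_qv_dv, smul_eq_mul, if_true]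
  ring

theorem sum_pderiv_rhoGrad :
    ∑ i, pderiv (Sum.inr i) (rhoGrad i : GenPoly d) = ((d : GenPoly d) - 1) * boxPoly := by
  simp only [pderiv_rhoGrad, Finset.sum_sub_distrib]
  rw [← boxPoly]
  simp
  ring

theorem pderiv_spinTerm (i : Fin d) (n k : ℕ) :
    pderiv (Sum.inr i) ((2 * tauPoly) ^ n * (rhoSq * rhoSq') ^ k : GenPoly d) =
      2 * (n : GenPoly d) * (2 * tauPoly) ^ (n - 1) * (rhoSq * rhoSq') ^ k * tauGrad i +
        2 * (k : GenPoly d) * (2 * tauPoly) ^ n * (rhoSq * rhoSq') ^ (k - 1) * rhoSq' * rhoGrad i := by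
  have h2 : pderiv (Sum.inr i) (2 : GenPoly d) = 0 := by
    have := (pderiv (R := MvPolynomial (Fin d) ℂ) (Sum.inr i : Fin d ⊕ Fin d)).map_natCast 2
    exact_mod_cast this
  simp only [Derivation.leibniz, Derivation.leibniz_pow, h2, pderiv_tauPoly, pderiv_rhoSq,
    pderiv_rhoSq', smul_eq_mul, nsmul_eq_mul]
  ring

/-- The chain rule produces scalar products of gradients only, and these lie again in the algebra
generated by `□`, `ρ²`, `ρ'²`, `τ`. The result has two terms, one lowering the power of `τ` by two
and one lowering the power of `ρ²ρ'²` by one. -/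
theorem laplacian_spinTerm (n k : ℕ) :
    ∑ i, pderiv (Sum.inr i) (pderiv (Sum.inr i)
        ((2 * tauPoly) ^ n * (rhoSq * rhoSq') ^ k : GenPoly d)) =
      boxPoly * rhoSq' * (4 * (n : GenPoly d) * ((n : GenPoly d) - 1) * ((2 * tauPoly) ^ (n - 2) * (rhoSq * rhoSq') ^ k) +
        (k : GenPoly d) * (4 * (n : GenPoly d) + 4 * ((k : GenPoly d) - 1) + 2 * ((d : GenPoly d) - 1)) *
          ((2 * tauPoly) ^ n * (rhoSq * rhoSq') ^ (k - 1))) := by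
  have hc : ∀ (i : Fin d) (m : ℕ), pderiv (Sum.inr i) (m : GenPoly d) = 0 := fun i m =>
    (pderiv (R := MvPolynomial (Fin d) ℂ) (Sum.inr i : Fin d ⊕ Fin d)).map_natCast m
  have h2 : ∀ i : Fin d, pderiv (Sum.inr i) (2 : GenPoly d) = 0 := fun i => by
    exact_mod_cast hc i 2
  have key : ∀ i : Fin d, pderiv (Sum.inr i) (pderiv (Sum.inr i)
        ((2 * tauPoly) ^ n * (rhoSq * rhoSq') ^ k : GenPoly d)) =
      4 * (n : GenPoly d) * ((n - 1 : ℕ) : GenPoly d) * (2 * tauPoly) ^ (n - 2) * (rhoSq * rhoSq') ^ k *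
          (tauGrad i * tauGrad i) +
        8 * (n : GenPoly d) * (k : GenPoly d) * (2 * tauPoly) ^ (n - 1) * (rhoSq * rhoSq') ^ (k - 1) * rhoSq' *
          (tauGrad i * rhoGrad i) +
        4 * (k : GenPoly d) * ((k - 1 : ℕ) : GenPoly d) * (2 * tauPoly) ^ n * (rhoSq * rhoSq') ^ (k - 2) *
          rhoSq' ^ 2 * (rhoGrad i * rhoGrad i) +
        2 * (k : GenPoly d) * (2 * tauPoly) ^ n * (rhoSq * rhoSq') ^ (k - 1) * rhoSq' *
          pderiv (Sum.inr i) (rhoGrad i) := by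
    intro i
    rw [pderiv_spinTerm]
    simp only [map_add, Derivation.leibniz, Derivation.leibniz_pow, h2, hc, pderiv_tauPoly,
      pderiv_rhoSq, pderiv_rhoSq', pderiv_tauGrad, smul_eq_mul, nsmul_eq_mul,
      show n - 1 - 1 = n - 2 by omega, show k - 1 - 1 = k - 2 by omega]
    ring
  rw [Finset.sum_congr rfl fun i _ => key i]
  simp only [Finset.sum_add_distrib, ← Finset.mul_sum]
  rw [sum_tauGrad_mul_self, sum_tauGrad_mul_rhoGrad, sum_rhoGrad_mul_self, sum_pderiv_rhoGrad]
  -- Truncated subtraction in the exponents is harmless, since each such power carries a factor that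
  -- vanishes when the subtraction truncates.
  have e1 : (n : GenPoly d) * (2 * tauPoly) ^ (n - 1) * (2 * tauPoly) =
      (n : GenPoly d) * (2 * tauPoly) ^ n := by
    rcases n with _ | n
    · simp
    · rw [Nat.add_sub_cancel, mul_assoc, ← pow_succ]
  have e2 : (k : GenPoly d) * ((k - 1 : ℕ) : GenPoly d) * (rhoSq * rhoSq') ^ (k - 2) *
      (rhoSq * rhoSq') = (k : GenPoly d) * ((k : GenPoly d) - 1) * (rhoSq * rhoSq') ^ (k - 1) := by
    rcases k with _ | _ | k
    · simp
    · simp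
    · rw [show k + 1 + 1 - 2 = k by omega, show k + 1 + 1 - 1 = k + 1 by omega, mul_assoc,
        ← pow_succ]
      push_cast
      ring
  have e3 : (n : GenPoly d) * ((n - 1 : ℕ) : GenPoly d) = (n : GenPoly d) * ((n : GenPoly d) - 1) := by
    rcases n with _ | n
    · simp
    · push_cast; simp
  linear_combination (4 * (2 * tauPoly) ^ (n - 2) * (rhoSq * rhoSq') ^ k * boxPoly * rhoSq') * e3 +
    (4 * (k : GenPoly d) * (rhoSq * rhoSq') ^ (k - 1) * rhoSq' * boxPoly) * e1 +
    (4 * (2 * tauPoly) ^ n * rhoSq' * boxPoly) * e2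

/-- The part of the Laplacian of the `k`-th term that lowers `τ` cancels against the part of the
`(k+1)`-st term that lowers `ρ²ρ'²`, by `gegCoeff_succ`. -/
theorem spinPoly_traceless (hd : 3 ≤ d) (s : ℕ) :
    ∑ i, pderiv (Sum.inr i) (pderiv (Sum.inr i) (spinPoly s : GenPoly d)) = 0 := by
  have hν : 0 ≤ ((d : ℝ) - 3) / 2 := by
    have : (3 : ℝ) ≤ d := by exact_mod_cast hd
    linarith
  have h1 : ∀ i : Fin d, pderiv (Sum.inr i) (pderiv (Sum.inr i) (spinPoly s : GenPoly d)) =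
      ∑ k ∈ Finset.range (s / 2 + 1), genConst (gegCoeff (((d : ℝ) - 3) / 2) s k) *
        pderiv (Sum.inr i) (pderiv (Sum.inr i)
          ((2 * tauPoly) ^ (s - 2 * k) * (rhoSq * rhoSq') ^ k)) := by
    intro i
    rw [spinPoly_eq, map_sum, map_sum]
    refine Finset.sum_congr rfl fun k _ => ?_
    rw [genConst_apply, MvPolynomial.pderiv_C_mul, MvPolynomial.pderiv_C_mul]
  rw [Finset.sum_congr rfl fun i _ => h1 i, Finset.sum_comm]
  simp only [← Finset.mul_sum, laplacian_spinTerm]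
  have h2 : ∀ k, genConst (gegCoeff (((d : ℝ) - 3) / 2) s k) * (boxPoly * rhoSq' *
      (4 * ((s - 2 * k : ℕ) : GenPoly d) * (((s - 2 * k : ℕ) : GenPoly d) - 1) *
        ((2 * tauPoly) ^ (s - 2 * k - 2) * (rhoSq * rhoSq') ^ k) +
        (k : GenPoly d) * (4 * ((s - 2 * k : ℕ) : GenPoly d) + 4 * ((k : GenPoly d) - 1) +
          2 * ((d : GenPoly d) - 1)) *
          ((2 * tauPoly) ^ (s - 2 * k) * (rhoSq * rhoSq') ^ (k - 1)))) =
      boxPoly * rhoSq' * (genConst (gegCoeff (((d : ℝ) - 3) / 2) s k) *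
        (4 * ((s - 2 * k : ℕ) : GenPoly d) * (((s - 2 * k : ℕ) : GenPoly d) - 1)) *
          ((2 * tauPoly) ^ (s - 2 * k - 2) * (rhoSq * rhoSq') ^ k)) +
      boxPoly * rhoSq' * (genConst (gegCoeff (((d : ℝ) - 3) / 2) s k) *
        ((k : GenPoly d) * (4 * ((s - 2 * k : ℕ) : GenPoly d) + 4 * ((k : GenPoly d) - 1) +
          2 * ((d : GenPoly d) - 1))) *
          ((2 * tauPoly) ^ (s - 2 * k) * (rhoSq * rhoSq') ^ (k - 1))) := fun k => by ring
  -- Shift the index of the second sum by one. This isolates the last term of the first sum and the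
  -- `k = 0` term of the second, both of which vanish.
  rw [Finset.sum_congr rfl fun k _ => h2 k, Finset.sum_add_distrib, Finset.sum_range_succ,
    Finset.sum_range_succ' (fun k => boxPoly * rhoSq' * (genConst (gegCoeff (((d : ℝ) - 3) / 2) s k) *
        ((k : GenPoly d) * (4 * ((s - 2 * k : ℕ) : GenPoly d) + 4 * ((k : GenPoly d) - 1) +
          2 * ((d : GenPoly d) - 1))) *
          ((2 * tauPoly) ^ (s - 2 * k) * (rhoSq * rhoSq') ^ (k - 1))))]
  -- The lowest power of `τ` is `0` or `1`, so its second derivative is zero.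
  have h3 : (4 * ((s - 2 * (s / 2) : ℕ) : GenPoly d) *
      (((s - 2 * (s / 2) : ℕ) : GenPoly d) - 1)) = 0 := by
    rcases (by omega : s - 2 * (s / 2) = 0 ∨ s - 2 * (s / 2) = 1) with h | h <;> simp [h]
  rw [h3]
  simp only [mul_zero, zero_mul, Nat.cast_zero, add_zero]
  rw [← Finset.sum_add_distrib]
  refine Finset.sum_eq_zero fun k hk => ?_
  obtain ⟨n, rfl⟩ : ∃ n, s = n + 2 * k + 2 :=
    ⟨s - 2 * k - 2, by have := Finset.mem_range.mp hk; omega⟩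
  rw [show n + 2 * k + 2 - 2 * (k + 1) = n by omega, show n + 2 * k + 2 - 2 * k = n + 2 by omega,
    show k + 1 - 1 = k by omega, show n + 2 - 2 = n by omega]
  have h4 := congrArg (genConst (d := d)) (gegCoeff_succ hν (n := n) (k := k))
  have h5 : (genConst (((k : ℝ) + 1) * (n + k + 1 + ((d : ℝ) - 3) / 2)) : GenPoly d) * 4 =
      ((k + 1 : ℕ) : GenPoly d) * (4 * (n : GenPoly d) + 4 * (((k + 1 : ℕ) : GenPoly d) - 1) +
        2 * ((d : GenPoly d) - 1)) := by
    have : (((k : ℝ) + 1) * (n + k + 1 + ((d : ℝ) - 3) / 2)) * 4 =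
        ((k + 1 : ℕ) : ℝ) * (4 * n + 4 * ((k + 1 : ℕ) - 1) + 2 * (d - 1)) := by
      push_cast; ring
    have := congrArg (genConst (d := d)) this
    simpa only [map_mul, map_add, map_sub, map_natCast, map_ofNat, map_one] using this
  have h6 : (genConst (((n : ℝ) + 2) * (n + 1)) : GenPoly d) =
      ((n + 2 : ℕ) : GenPoly d) * (((n + 2 : ℕ) : GenPoly d) - 1) := by
    simp only [map_mul, map_add, map_natCast, map_ofNat, map_one]
    push_cast
    ring
  rw [map_neg, map_mul, map_mul genConst (gegCoeff _ (n + 2 * k + 2) k), h6] at h4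
  linear_combination (boxPoly * rhoSq' * ((2 * tauPoly) ^ n * (rhoSq * rhoSq') ^ k) * 4) * h4 -
    (boxPoly * rhoSq' * genConst (gegCoeff (((d : ℝ) - 3) / 2) (n + 2 * k + 2) (k + 1)) *
      ((2 * tauPoly) ^ n * (rhoSq * rhoSq') ^ k)) * h5

/-- All dependence on `q` is through `ρ²` and `τ`, whose `q`-gradients are orthogonal to `∂`. -/
theorem spinPoly_transverse (s : ℕ) :
    ∑ i, dv i * pderiv (Sum.inr i) (spinPoly s : GenPoly d) = 0 := by
  have h1 : ∀ i : Fin d, dv i * pderiv (Sum.inr i) (spinPoly s : GenPoly d) =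
      ∑ k ∈ Finset.range (s / 2 + 1), genConst (gegCoeff (((d : ℝ) - 3) / 2) s k) *
        (2 * ((s - 2 * k : ℕ) : GenPoly d) * (2 * tauPoly) ^ (s - 2 * k - 1) *
          (rhoSq * rhoSq') ^ k * (dv i * tauGrad i) +
        2 * (k : GenPoly d) * (2 * tauPoly) ^ (s - 2 * k) * (rhoSq * rhoSq') ^ (k - 1) * rhoSq' *
          (dv i * rhoGrad i)) := by
    intro i
    rw [spinPoly_eq, map_sum, Finset.mul_sum]
    refine Finset.sum_congr rfl fun k _ => ?_
    rw [genConst_apply, MvPolynomial.pderiv_C_mul, pderiv_spinTerm]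
    ring
  rw [Finset.sum_congr rfl fun i _ => h1 i, Finset.sum_comm]
  refine Finset.sum_eq_zero fun k _ => ?_
  rw [← Finset.mul_sum, Finset.sum_add_distrib, ← Finset.mul_sum, ← Finset.mul_sum,
    sum_dv_mul_tauGrad, sum_dv_mul_rhoGrad]
  simp

end pderiv

/-! ### Degrees -/

/-- Every coefficient is a homogeneous differential operator of order `n`. -/
def HasOrder (n : ℕ) (G : GenPoly d) : Prop := ∀ a, (G.coeff a).IsHomogeneous n

theorem HasOrder.mul {m n : ℕ} {G H : GenPoly d} (hG : HasOrder m G) (hH : HasOrder n H) :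
    HasOrder (m + n) (G * H) := fun a => by
  classical
  rw [MvPolynomial.coeff_mul]
  exact MvPolynomial.IsHomogeneous.sum _ _ _ fun x _ => (hG _).mul (hH _)

theorem HasOrder.add {n : ℕ} {G H : GenPoly d} (hG : HasOrder n G) (hH : HasOrder n H) :
    HasOrder n (G + H) := fun a => by
  rw [MvPolynomial.coeff_add]; exact (hG a).add (hH a)

theorem HasOrder.sub {n : ℕ} {G H : GenPoly d} (hG : HasOrder n G) (hH : HasOrder n H) :
    HasOrder n (G - H) := fun a => by
  rw [MvPolynomial.coeff_sub]; exact (hG a).sub (hH a)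

theorem HasOrder.sum {ι : Type*} {n : ℕ} (t : Finset ι) {G : ι → GenPoly d}
    (h : ∀ i ∈ t, HasOrder n (G i)) : HasOrder n (∑ i ∈ t, G i) := fun a => by
  rw [MvPolynomial.coeff_sum]
  exact MvPolynomial.IsHomogeneous.sum _ _ _ fun i hi => h i hi a

theorem HasOrder.C {n : ℕ} {W : MvPolynomial (Fin d) ℂ} (hW : W.IsHomogeneous n) :
    HasOrder n (MvPolynomial.C W : GenPoly d) := fun a => by
  classical
  rw [MvPolynomial.coeff_C]
  split_ifs
  · exact hW
  · exact MvPolynomial.isHomogeneous_zero _ _ _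

theorem HasOrder.X (i : Fin d ⊕ Fin d) : HasOrder 0 (MvPolynomial.X i : GenPoly d) := fun a => by
  classical
  rw [MvPolynomial.coeff_X]
  split_ifs
  · exact MvPolynomial.isHomogeneous_one _ _
  · exact MvPolynomial.isHomogeneous_zero _ _ _

theorem HasOrder.pow {n : ℕ} {G : GenPoly d} (hG : HasOrder n G) (k : ℕ) :
    HasOrder (n * k) (G ^ k) := by
  induction k with
  | zero =>
    rw [pow_zero, ← MvPolynomial.C_1]
    exact HasOrder.C (MvPolynomial.isHomogeneous_one _ _)
  | succ k ih => rw [pow_succ]; exact ih.mul hG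

theorem hasOrder_genConst (c : ℝ) : HasOrder 0 (genConst c : GenPoly d) :=
  HasOrder.C (MvPolynomial.isHomogeneous_C _ _)

theorem hasOrder_dv (i : Fin d) : HasOrder 1 (dv i) := HasOrder.C (MvPolynomial.isHomogeneous_X _ _)

theorem hasOrder_boxPoly : HasOrder 2 (boxPoly : GenPoly d) :=
  HasOrder.sum _ fun i _ => (hasOrder_dv i).mul (hasOrder_dv i)

theorem hasOrder_rhoSq : HasOrder 2 (rhoSq : GenPoly d) :=
  (hasOrder_boxPoly.mul (n := 0) (HasOrder.sum _ fun _ _ => (HasOrder.X _).mul (HasOrder.X _))).sub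
    ((HasOrder.sum (n := 1) _ fun i _ => by
      simpa [qv] using (HasOrder.X (Sum.inr i)).mul (hasOrder_dv i)).pow 2)

theorem hasOrder_rhoSq' : HasOrder 2 (rhoSq' : GenPoly d) :=
  (hasOrder_boxPoly.mul (n := 0) (HasOrder.sum _ fun _ _ => (HasOrder.X _).mul (HasOrder.X _))).sub
    ((HasOrder.sum (n := 1) _ fun i _ => by
      simpa [qv'] using (HasOrder.X (Sum.inl i)).mul (hasOrder_dv i)).pow 2)

theorem hasOrder_tauPoly : HasOrder 2 (tauPoly : GenPoly d) :=
  (hasOrder_boxPoly.mul (n := 0) (HasOrder.sum _ fun _ _ => (HasOrder.X _).mul (HasOrder.X _))).sub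
    ((HasOrder.sum (n := 1) _ fun i _ => by
      simpa [qv] using (HasOrder.X (Sum.inr i)).mul (hasOrder_dv i)).mul
    (HasOrder.sum (n := 1) _ fun i _ => by
      simpa [qv'] using (HasOrder.X (Sum.inl i)).mul (hasOrder_dv i)))

theorem hasOrder_two : HasOrder 0 (2 : GenPoly d) := by
  have h := hasOrder_genConst (d := d) 2
  rwa [map_ofNat] at h

theorem hasOrder_spinPoly (s : ℕ) : HasOrder (2 * s) (spinPoly s : GenPoly d) := by
  rw [spinPoly_eq]
  refine HasOrder.sum _ fun k hk => ?_
  have h := (hasOrder_genConst (d := d) (gegCoeff (((d : ℝ) - 3) / 2) s k)).mul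
    (((hasOrder_two.mul hasOrder_tauPoly).pow (s - 2 * k)).mul
      ((hasOrder_rhoSq.mul hasOrder_rhoSq').pow k))
  rwa [show 0 + ((0 + 2) * (s - 2 * k) + (2 + 2) * k) = 2 * s by
    have := Finset.mem_range.mp hk; omega] at h

/-- The weight counting `a` for every left and `b` for every right variable. -/
def sideWeight (a b : ℕ) : Fin d ⊕ Fin d → ℕ := Sum.elim (fun _ => a) (fun _ => b)

open MvPolynomial (IsWeightedHomogeneous)

theorem weight_sideWeight (a b : ℕ) (m : Fin d ⊕ Fin d →₀ ℕ) :
    Finsupp.weight (sideWeight a b) m = (∑ i, m (Sum.inl i)) * a + (∑ i, m (Sum.inr i)) * b := by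
  rw [Finsupp.weight_apply, Finsupp.sum_fintype _ _ (by simp), Fintype.sum_sum_type,
    Finset.sum_mul, Finset.sum_mul]
  rfl

theorem isWeightedHomogeneous_qv (a b : ℕ) (i : Fin d) :
    IsWeightedHomogeneous (sideWeight a b) (qv i : GenPoly d) b :=
  MvPolynomial.isWeightedHomogeneous_X _ _ _

theorem isWeightedHomogeneous_qv' (a b : ℕ) (i : Fin d) :
    IsWeightedHomogeneous (sideWeight a b) (qv' i : GenPoly d) a :=
  MvPolynomial.isWeightedHomogeneous_X _ _ _

theorem isWeightedHomogeneous_dv (a b : ℕ) (i : Fin d) :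
    IsWeightedHomogeneous (sideWeight a b) (dv i : GenPoly d) 0 :=
  MvPolynomial.isWeightedHomogeneous_C _ _

theorem isWeightedHomogeneous_boxPoly (a b : ℕ) :
    IsWeightedHomogeneous (sideWeight a b) (boxPoly : GenPoly d) 0 :=
  IsWeightedHomogeneous.sum _ _ _ fun i _ =>
    (isWeightedHomogeneous_dv a b i).mul (isWeightedHomogeneous_dv a b i)

theorem IsWeightedHomogeneous.sub' {a b n : ℕ} {G H : GenPoly d}
    (hG : IsWeightedHomogeneous (sideWeight a b) G n)
    (hH : IsWeightedHomogeneous (sideWeight a b) H n) :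
    IsWeightedHomogeneous (sideWeight a b) (G - H) n :=
  (MvPolynomial.weightedHomogeneousSubmodule (MvPolynomial (Fin d) ℂ) (sideWeight a b) n).sub_mem
    hG hH

theorem isWeightedHomogeneous_rhoSq (a b : ℕ) :
    IsWeightedHomogeneous (sideWeight a b) (rhoSq : GenPoly d) (2 * b) := by
  have h1 := (isWeightedHomogeneous_boxPoly (d := d) a b).mul
    (IsWeightedHomogeneous.sum Finset.univ _ _ fun i _ =>
      (isWeightedHomogeneous_qv a b i).mul (isWeightedHomogeneous_qv a b i))
  have h2 := (IsWeightedHomogeneous.sum (Finset.univ : Finset (Fin d)) _ _ fun i _ =>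
      (isWeightedHomogeneous_qv a b i).mul (isWeightedHomogeneous_dv a b i)).pow 2
  rw [show 0 + (b + b) = 2 * b by ring] at h1
  rw [show 2 • (b + 0) = 2 * b by simp] at h2
  exact IsWeightedHomogeneous.sub' h1 h2

theorem isWeightedHomogeneous_rhoSq' (a b : ℕ) :
    IsWeightedHomogeneous (sideWeight a b) (rhoSq' : GenPoly d) (2 * a) := by
  have h1 := (isWeightedHomogeneous_boxPoly (d := d) a b).mul
    (IsWeightedHomogeneous.sum Finset.univ _ _ fun i _ =>
      (isWeightedHomogeneous_qv' a b i).mul (isWeightedHomogeneous_qv' a b i))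
  have h2 := (IsWeightedHomogeneous.sum (Finset.univ : Finset (Fin d)) _ _ fun i _ =>
      (isWeightedHomogeneous_qv' a b i).mul (isWeightedHomogeneous_dv a b i)).pow 2
  rw [show 0 + (a + a) = 2 * a by ring] at h1
  rw [show 2 • (a + 0) = 2 * a by simp] at h2
  exact IsWeightedHomogeneous.sub' h1 h2

theorem isWeightedHomogeneous_tauPoly (a b : ℕ) :
    IsWeightedHomogeneous (sideWeight a b) (tauPoly : GenPoly d) (a + b) := by
  have h1 := (isWeightedHomogeneous_boxPoly (d := d) a b).mul
    (IsWeightedHomogeneous.sum Finset.univ _ _ fun i _ =>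
      (isWeightedHomogeneous_qv a b i).mul (isWeightedHomogeneous_qv' a b i))
  have h2 := (IsWeightedHomogeneous.sum (Finset.univ : Finset (Fin d)) _ _ fun i _ =>
      (isWeightedHomogeneous_qv a b i).mul (isWeightedHomogeneous_dv a b i)).mul
    (IsWeightedHomogeneous.sum (Finset.univ : Finset (Fin d)) _ _ fun i _ =>
      (isWeightedHomogeneous_qv' a b i).mul (isWeightedHomogeneous_dv a b i))
  rw [show 0 + (b + a) = a + b by ring] at h1
  rw [show b + 0 + (a + 0) = a + b by ring] at h2
  exact IsWeightedHomogeneous.sub' h1 h2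

theorem isWeightedHomogeneous_genConst (a b : ℕ) (c : ℝ) :
    IsWeightedHomogeneous (sideWeight a b) (genConst c : GenPoly d) 0 :=
  MvPolynomial.isWeightedHomogeneous_C _ _

theorem isWeightedHomogeneous_two_mul_tauPoly (a b : ℕ) :
    IsWeightedHomogeneous (sideWeight a b) (2 * tauPoly : GenPoly d) (a + b) := by
  have := (isWeightedHomogeneous_genConst (d := d) a b 2).mul (isWeightedHomogeneous_tauPoly a b)
  rwa [map_ofNat, zero_add] at this

/-- General weights treat both slots at once: `(1, 0)` gives the degree in `q'` and `(0, 1)` the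
degree in `q`. -/
theorem isWeightedHomogeneous_spinPoly (a b s : ℕ) :
    IsWeightedHomogeneous (sideWeight a b) (spinPoly s : GenPoly d) ((a + b) * s) := by
  rw [spinPoly_eq]
  refine IsWeightedHomogeneous.sum _ _ _ fun k hk => ?_
  have h := (isWeightedHomogeneous_genConst (d := d) a b (gegCoeff (((d : ℝ) - 3) / 2) s k)).mul
    (((isWeightedHomogeneous_two_mul_tauPoly a b).pow (s - 2 * k)).mul
      (((isWeightedHomogeneous_rhoSq a b).mul (isWeightedHomogeneous_rhoSq' a b)).pow k))
  obtain ⟨n, rfl⟩ : ∃ n, s = n + 2 * k :=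
    ⟨s - 2 * k, by have := Finset.mem_range.mp hk; omega⟩
  rw [Nat.add_sub_cancel] at h ⊢
  convert h using 1
  simp only [smul_eq_mul]
  ring

theorem spinPoly_rank {s : ℕ} {m : Fin d ⊕ Fin d →₀ ℕ} (hm : m ∈ (spinPoly s : GenPoly d).support) :
    ∑ i, m (Sum.inl i) = s ∧ ∑ i, m (Sum.inr i) = s := by
  have hm' := MvPolynomial.mem_support_iff.mp hm
  have h1 := isWeightedHomogeneous_spinPoly (d := d) 1 0 s hm'
  have h2 := isWeightedHomogeneous_spinPoly (d := d) 0 1 s hm'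
  rw [weight_sideWeight] at h1 h2
  simp at h1 h2
  exact ⟨h1, h2⟩

/-! ### Symmetry and nonvanishing -/

theorem rename_swap_tauPoly : MvPolynomial.rename Sum.swap (tauPoly : GenPoly d) = tauPoly := by
  simp only [tauPoly, boxPoly, qv, qv', dv, map_sub, map_mul, map_sum, MvPolynomial.rename_X,
    MvPolynomial.rename_C, Sum.swap_inl, Sum.swap_inr]
  rw [mul_comm (∑ i, MvPolynomial.X (Sum.inl i) * _ : GenPoly d)]
  simp only [mul_comm (MvPolynomial.X (Sum.inl _) : GenPoly d) (MvPolynomial.X (Sum.inr _))]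

theorem rename_swap_rhoSq : MvPolynomial.rename Sum.swap (rhoSq : GenPoly d) = rhoSq' := by
  simp only [rhoSq, rhoSq', boxPoly, qv, qv', dv, map_sub, map_mul, map_sum, map_pow,
    MvPolynomial.rename_X, MvPolynomial.rename_C, Sum.swap_inr]

theorem rename_swap_rhoSq' : MvPolynomial.rename Sum.swap (rhoSq' : GenPoly d) = rhoSq := by
  simp only [rhoSq, rhoSq', boxPoly, qv, qv', dv, map_sub, map_mul, map_sum, map_pow,
    MvPolynomial.rename_X, MvPolynomial.rename_C, Sum.swap_inl]

theorem rename_swap_spinPoly (s : ℕ) :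
    MvPolynomial.rename Sum.swap (spinPoly s : GenPoly d) = spinPoly s := by
  simp only [spinPoly_eq, map_sum, map_mul, map_pow, rename_swap_tauPoly, rename_swap_rhoSq,
    rename_swap_rhoSq', genConst_apply, MvPolynomial.rename_C, map_ofNat]
  simp only [mul_comm (rhoSq' : GenPoly d) rhoSq]

/-- At a point where `ρ'² = 0` and `τ = 1`, only the leading Gegenbauer coefficient survives, and it
is nonzero. -/
theorem spinPoly_ne_zero (hd : 3 ≤ d) (s : ℕ) : (spinPoly s : GenPoly d) ≠ 0 := by
  intro h0
  -- With `∂ = e₀`, `q = e₁`, `q' = e₁ + i e₂`, the vector `q'` is isotropic and transverse. Three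
  -- coordinates are needed, which is where `3 ≤ d` enters.
  let κ : Fin d → ℂ := Pi.single ⟨0, by omega⟩ 1
  let u : Fin d → ℂ := Pi.single ⟨1, by omega⟩ 1
  let v : Fin d → ℂ := Pi.single ⟨2, by omega⟩ 1
  obtain ⟨φ, hφ⟩ : ∃ φ : GenPoly d →+* ℂ, φ = MvPolynomial.eval₂Hom (MvPolynomial.eval κ)
      (Sum.elim (fun i => u i + Complex.I * v i) u) := ⟨_, rfl⟩
  have hq : ∀ i, φ (qv i) = u i := fun i => by rw [hφ]; simp [qv]
  have hq' : ∀ i, φ (qv' i) = u i + Complex.I * v i := fun i => by rw [hφ]; simp [qv']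
  have hdv : ∀ i, φ (dv i) = κ i := fun i => by rw [hφ]; simp [dv]
  have hc : ∀ c : ℝ, φ (genConst c) = c := fun c => by rw [hφ, genConst_apply]; simp
  have hτ : φ tauPoly = 1 := by
    simp [tauPoly, boxPoly, hq, hq', hdv, κ, u, v, Pi.single_apply]
  have hρ : φ rhoSq' = 0 := by
    simp [rhoSq', boxPoly, hq', hdv, κ, u, v, Pi.single_apply, mul_add, add_mul,
      Finset.sum_add_distrib]
  have h1 := congrArg φ h0
  rw [spinPoly_eq, map_sum, map_zero, Finset.sum_range_succ', Finset.sum_eq_zero] at h1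
  · simp only [map_mul, hc, map_pow, hτ, map_ofNat, gegCoeff] at h1
    simp [Nat.factorial_ne_zero] at h1
  · intro k _
    simp [hρ]

theorem isConformalSpin_spinPoly (hd : 2 < d) (s : ℕ) :
    IsConformalSpin s (spinPoly s : GenPoly d) where
  ne_zero := spinPoly_ne_zero hd s
  rank_left _ ha := (spinPoly_rank ha).1
  rank_right _ ha := (spinPoly_rank ha).2
  order := hasOrder_spinPoly s
  symm := rename_swap_spinPoly s
  traceless := spinPoly_traceless hd s
  transverse := spinPoly_transverse s
  invariant R q q' κ := by
    simp only [evalGen_spinPoly, tauVal, rhoVal, LinearIsometryEquiv.norm_map,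
      LinearIsometryEquiv.inner_map_map]

theorem confGen_smul (s : ℕ) (q q' κ : E d) {t : ℝ} (hκ : κ ≠ 0) (ht : 0 < t) :
    confGen s q q' (t • κ) = ((t ^ ((d : ℝ) - 4 + 2 * s) : ℝ) : ℂ) * confGen s q q' κ := by
  have hn : 0 < ‖κ‖ := norm_pos_iff.mpr hκ
  have h1 : (‖t • κ‖ ^ 2) ^ ((d : ℝ) / 2 - 2) =
      t ^ ((d : ℝ) - 4) * (‖κ‖ ^ 2) ^ ((d : ℝ) / 2 - 2) := by
    rw [norm_smul, Real.norm_of_nonneg ht.le, mul_pow, Real.mul_rpow (by positivity) (by positivity),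
      ← Real.rpow_natCast t 2, ← Real.rpow_mul ht.le]
    congr 2
    push_cast
    ring
  have hτ : tauVal q q' (t • κ) = t ^ 2 * tauVal q q' κ := by
    rw [tauVal, tauVal, norm_smul, Real.norm_of_nonneg ht.le, inner_smul_right, inner_smul_right]
    ring
  have hρ : ∀ x : E d, rhoVal x (t • κ) = t ^ 2 * rhoVal x κ := fun x => by
    rw [rhoVal, rhoVal, norm_smul, Real.norm_of_nonneg ht.le, inner_smul_right]
    ring
  have h2 : evalGen (spinPoly s) q q' (t • κ) =
      ((t ^ (2 * s) : ℝ) : ℂ) * evalGen (spinPoly s) q q' κ := by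
    rw [evalGen_spinPoly, evalGen_spinPoly, ← Complex.ofReal_mul, Finset.mul_sum]
    congr 1
    refine Finset.sum_congr rfl fun k hk => ?_
    rw [hτ, hρ, hρ]
    obtain ⟨n, rfl⟩ : ∃ n, s = n + 2 * k :=
      ⟨s - 2 * k, by have := Finset.mem_range.mp hk; omega⟩
    rw [Nat.add_sub_cancel]
    ring
  have h3 : t ^ ((d : ℝ) - 4 + 2 * s) = t ^ ((d : ℝ) - 4) * t ^ (2 * s) := by
    rw [Real.rpow_add ht, ← Real.rpow_natCast t (2 * s)]
    push_cast
    rfl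
  rw [confGen, confGen, h1, h2, h3]
  push_cast
  ring

/-! ### Gegenbauer's addition theorem -/

theorem gamma_le_gamma_add_nat {x : ℝ} (hx : 1 ≤ x) (r : ℕ) :
    Real.Gamma x ≤ Real.Gamma (x + r) := by
  induction r with
  | zero => simp
  | succ r ih =>
    have h : (0 : ℝ) ≤ r := r.cast_nonneg
    have hp : 0 < Real.Gamma (x + r) := Real.Gamma_pos_of_pos (by linarith)
    push_cast
    rw [← add_assoc, Real.Gamma_add_one (by linarith)]
    nlinarith

/-- Supplies the factor `1/s!` that makes the sum over spins converge. -/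
theorem factorial_mul_gamma_le {ν : ℝ} (hν : 0 ≤ ν) (s : ℕ) :
    s.factorial * Real.Gamma (ν + 1) ≤ Real.Gamma (s + ν + 1) := by
  induction s with
  | zero => simp
  | succ s ih =>
    have h : (0 : ℝ) ≤ s := s.cast_nonneg
    have hp : 0 < Real.Gamma (s + ν + 1) := Real.Gamma_pos_of_pos (by positivity)
    have e : ((s + 1 : ℕ) : ℝ) + ν + 1 = (s + ν + 1) + 1 := by push_cast; ring
    rw [e, Real.Gamma_add_one (s := s + ν + 1) (by positivity), Nat.factorial_succ]
    push_cast
    rw [mul_assoc]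
    exact mul_le_mul (by linarith) ih
      (mul_nonneg (by positivity) (Real.Gamma_pos_of_pos (by positivity)).le) (by positivity)

/-- The bound is crude in `r` but keeps `1/Γ(ν+1)`. At order `s + ν`, two such factors outweigh the
single `Γ(s+ν+1)` in the addition theorem. -/
theorem abs_besselCoeff_le {ν : ℝ} (hν : 0 ≤ ν) (r : ℕ) :
    |besselCoeff ν r| ≤ (Real.Gamma (ν + 1))⁻¹ * (1 / r.factorial) := by
  have h1 : 0 < Real.Gamma (ν + 1) := Real.Gamma_pos_of_pos (by positivity)
  have h2 := gamma_le_gamma_add_nat (x := ν + 1) (by linarith) r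
  have h3 : (1 / 2 : ℝ) ^ (ν + 2 * r) ≤ 1 :=
    Real.rpow_le_one (by norm_num) (by norm_num) (by positivity)
  have hf : (0 : ℝ) < r.factorial := by exact_mod_cast r.factorial_pos
  have h5 : 0 < Real.Gamma (ν + r + 1) := Real.Gamma_pos_of_pos (by positivity)
  have h6 : (0 : ℝ) ≤ (1 / 2 : ℝ) ^ (ν + 2 * r) := by positivity
  rw [besselCoeff, abs_div, abs_mul, abs_pow, abs_neg, abs_one, one_pow, one_mul,
    abs_of_nonneg h6, abs_of_pos (mul_pos hf h5), ← one_div, one_div_mul_one_div]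
  refine div_le_div₀ zero_le_one h3 (by positivity) ?_
  rw [show ν + r + 1 = ν + 1 + r by ring, mul_comm]
  exact mul_le_mul_of_nonneg_left h2 hf.le

theorem summable_norm_besselReg {ν : ℝ} (hν : 0 ≤ ν) (w : ℂ) :
    Summable fun r : ℕ => ‖(besselCoeff ν r : ℂ) * w ^ r‖ := by
  refine Summable.of_nonneg_of_le (fun _ => norm_nonneg _) (fun r => ?_)
    ((Real.summable_pow_div_factorial ‖w‖).mul_left (Real.Gamma (ν + 1))⁻¹)
  rw [norm_mul, norm_pow, Complex.norm_real, Real.norm_eq_abs]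
  calc _ ≤ (Real.Gamma (ν + 1))⁻¹ * (1 / r.factorial) * ‖w‖ ^ r :=
        mul_le_mul_of_nonneg_right (abs_besselCoeff_le hν r) (by positivity)
    _ = _ := by ring

theorem hasSum_besselReg {ν : ℝ} (hν : 0 ≤ ν) (w : ℂ) :
    HasSum (fun r : ℕ => (besselCoeff ν r : ℂ) * w ^ r) (besselReg ν w) :=
  (summable_norm_besselReg hν w).of_norm.hasSum

/-- Every factor of the denominator is at least `1`: for `i < k` and `2k ≤ s` one has `s + ν - 1 - i
≥ k`. -/
theorem abs_gegCoeff_le {ν : ℝ} (hν : 0 ≤ ν) {s k : ℕ} (hk : 2 * k ≤ s) :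
    |gegCoeff ν s k| ≤ 1 := by
  have hs : (2 * k : ℝ) ≤ s := by exact_mod_cast hk
  have h1 : 1 ≤ ∏ i ∈ Finset.range k, ((s : ℝ) + ν - 1 - i) := by
    refine Finset.one_le_prod fun i hi => ?_
    have hi' : (i : ℝ) + 1 ≤ k := by exact_mod_cast Finset.mem_range.mp hi
    have : (1 : ℝ) ≤ k := by
      have : (0 : ℝ) ≤ i := i.cast_nonneg
      linarith
    linarith
  have h2 : (1 : ℝ) ≤ k.factorial := by exact_mod_cast k.factorial_pos
  have h3 : (1 : ℝ) ≤ (s - 2 * k).factorial := by exact_mod_cast (s - 2 * k).factorial_pos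
  rw [gegCoeff, abs_div, abs_pow, abs_neg, abs_one, one_pow]
  refine div_le_one_of_le₀ ((one_le_mul_of_one_le_of_one_le
    (one_le_mul_of_one_le_of_one_le h1 h2) h3).trans (le_abs_self _)) (abs_nonneg _)

/-- `Γ(ν)/Γ(s+ν) (xy)^{s/2} C_s^ν(t / √(xy))`. -/
def gegSum (ν : ℝ) (s : ℕ) (x y t : ℂ) : ℂ :=
  ∑ k ∈ Finset.range (s / 2 + 1), (gegCoeff ν s k : ℂ) * (2 * t) ^ (s - 2 * k) * (x * y) ^ k

theorem norm_gegSum_le {ν : ℝ} (hν : 0 ≤ ν) (s : ℕ) (x y t : ℂ) :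
    ‖gegSum ν s x y t‖ ≤ (2 * (1 + ‖2 * t‖ + ‖x * y‖)) ^ s := by
  set M := 1 + ‖2 * t‖ + ‖x * y‖ with hM
  have hM1 : 1 ≤ M := by
    have := norm_nonneg (2 * t); have := norm_nonneg (x * y); linarith
  have h : ‖gegSum ν s x y t‖ ≤ ∑ k ∈ Finset.range (s / 2 + 1), M ^ s := by
    refine norm_sum_le_of_le _ fun k hk => ?_
    have hk' : 2 * k ≤ s := by have := Finset.mem_range.mp hk; omega
    rw [norm_mul, norm_mul, norm_pow, norm_pow, Complex.norm_real, Real.norm_eq_abs]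
    calc _ ≤ 1 * M ^ (s - 2 * k) * M ^ k := by
          gcongr
          · exact abs_gegCoeff_le hν hk'
          · have := norm_nonneg (x * y); linarith
          · have := norm_nonneg (2 * t); linarith
      _ = M ^ (s - 2 * k + k) := by rw [one_mul, pow_add]
      _ ≤ M ^ s := pow_le_pow_right₀ hM1 (by omega)
  refine h.trans ?_
  rw [Finset.sum_const, Finset.card_range, nsmul_eq_mul, mul_pow]
  refine mul_le_mul_of_nonneg_right ?_ (by positivity)
  -- The number of terms is absorbed into the geometric bound.
  have : s / 2 + 1 ≤ 2 ^ s := by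
    have := s.lt_two_pow_self
    omega
  exact_mod_cast this

theorem hasSum_antidiagonal {f : ℕ × ℕ → ℂ} {S : ℂ} (hf : HasSum f S) :
    HasSum (fun n => ∑ p ∈ Finset.HasAntidiagonal.antidiagonal n, f p) S := by
  refine ((Finset.HasAntidiagonal.sigmaAntidiagonalEquivProd.hasSum_iff).mpr hf).sigma fun n => ?_
  exact Finset.hasSum (Finset.HasAntidiagonal.antidiagonal n) f

theorem hasSum_antidiagonal_antidiagonal {f : ℕ × ℕ × ℕ → ℂ} {S : ℂ} (hf : HasSum f S) :
    HasSum (fun n => ∑ p ∈ Finset.HasAntidiagonal.antidiagonal n,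
      ∑ q ∈ Finset.HasAntidiagonal.antidiagonal p.2, f (p.1, q)) S := by
  let e : (Σ p : ℕ × ℕ, Finset.HasAntidiagonal.antidiagonal p.2) ≃ ℕ × ℕ × ℕ :=
    { toFun := fun u => (u.1.1, u.2.1)
      invFun := fun v => ⟨(v.1, v.2.1 + v.2.2), ⟨v.2, by simp⟩⟩
      left_inv := by
        rintro ⟨⟨s, r⟩, ⟨⟨a, b⟩, h⟩⟩
        obtain rfl : a + b = r := by simpa using h
        rfl
      right_inv := fun _ => rfl }
  refine hasSum_antidiagonal (((e.hasSum_iff).mpr hf).sigma fun p => ?_)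
  exact Finset.hasSum (Finset.HasAntidiagonal.antidiagonal p.2) fun q => f (p.1, q)

theorem hasSum_const_mul {ι : Type*} {f : ι → ℂ} {a : ℂ} (hf : HasSum f a) (c : ℂ) :
    HasSum (fun n => c * f n) (c * a) :=
  hf.mul_left c

theorem HasSum.mul_mul_of_norm {f g : ℕ → ℂ} {a b : ℂ} (hf : HasSum f a) (hg : HasSum g b)
    (hf' : Summable fun n => ‖f n‖) (hg' : Summable fun n => ‖g n‖) (c e : ℂ) :
    HasSum (fun p : ℕ × ℕ => c * (f p.1 * g p.2) * e) (c * (a * b) * e) :=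
  ((hf.mul hg (summable_mul_of_summable_norm hf' hg')).mul_left c).mul_right e

/-- The triple series over the spin and the two Bessel indices converges absolutely, so it may be
summed in two ways. By total degree, `bessel_addition` gives the left-hand Bessel function of the
addition theorem; by spin, the two inner series give the product of Bessel functions. -/
theorem hasSum_besselReg_addition {ν : ℝ} (hν : 0 ≤ ν) (x y t : ℂ) :
    HasSum (fun s : ℕ => ((2 ^ ν * (-1) ^ s * Real.Gamma (s + ν + 1) : ℝ) : ℂ) *
      (besselReg (s + ν) x * besselReg (s + ν) y) * gegSum ν s x y t)
      (besselReg ν (x + y + 2 * t)) := by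
  let F : ℕ × ℕ × ℕ → ℂ := fun u => ((2 ^ ν * (-1) ^ u.1 * Real.Gamma (u.1 + ν + 1) : ℝ) : ℂ) *
    (((besselCoeff (u.1 + ν) u.2.1 : ℂ) * x ^ u.2.1) *
      ((besselCoeff (u.1 + ν) u.2.2 : ℂ) * y ^ u.2.2)) * gegSum ν u.1 x y t
  set M := 2 * (1 + ‖2 * t‖ + ‖x * y‖) with hM
  have hM0 : 0 ≤ M := by positivity
  have hΓ : ∀ s : ℕ, 0 < Real.Gamma (s + ν + 1) := fun s => Real.Gamma_pos_of_pos (by positivity)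
  have hΓ0 : 0 < Real.Gamma (ν + 1) := Real.Gamma_pos_of_pos (by positivity)
  have hsF : Summable F := by
    have h1 := Real.summable_pow_div_factorial M
    have h2 := Real.summable_pow_div_factorial ‖x‖
    have h3 := Real.summable_pow_div_factorial ‖y‖
    have h4 := h1.mul_of_nonneg (h2.mul_of_nonneg h3 (fun _ => by positivity)
      fun _ => by positivity) (fun _ => by positivity) fun _ => by positivity
    refine Summable.of_norm_bounded (h4.mul_left (2 ^ ν * (Real.Gamma (ν + 1))⁻¹)) ?_
    rintro ⟨s, a, b⟩
    have hsν : 0 ≤ (s : ℝ) + ν := by positivity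
    have ha := abs_besselCoeff_le hsν a
    have hb := abs_besselCoeff_le hsν b
    have hs := factorial_mul_gamma_le hν s
    have hg := norm_gegSum_le hν s x y t
    have hsf : (0 : ℝ) < s.factorial := by exact_mod_cast s.factorial_pos
    simp only [F, norm_mul, norm_pow, Complex.norm_real, Real.norm_eq_abs,
      abs_neg, abs_one, one_pow, mul_one, abs_of_pos (hΓ s),
      abs_of_pos (Real.rpow_pos_of_pos (zero_lt_two' ℝ) ν)]
    -- One gamma factor in the numerator and two in the denominator leave `1/Γ(s+ν+1)`, which is at
    -- most a constant times `1/s!`.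
    calc _ ≤ 2 ^ ν * Real.Gamma (s + ν + 1) *
          (((Real.Gamma (s + ν + 1))⁻¹ * (1 / a.factorial) * ‖x‖ ^ a) *
          ((Real.Gamma (s + ν + 1))⁻¹ * (1 / b.factorial) * ‖y‖ ^ b)) * M ^ s := by
          have := (hΓ s).le
          gcongr
      _ = 2 ^ ν * (Real.Gamma (s + ν + 1))⁻¹ * M ^ s *
          (‖x‖ ^ a / a.factorial * (‖y‖ ^ b / b.factorial)) := by
          have := (hΓ s).ne'
          field_simp
      _ ≤ 2 ^ ν * (s.factorial * Real.Gamma (ν + 1))⁻¹ * M ^ s *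
          (‖x‖ ^ a / a.factorial * (‖y‖ ^ b / b.factorial)) := by
          gcongr
      _ = _ := by
          rw [mul_inv]
          ring
  have hF := hsF.hasSum
  have h1 := hasSum_antidiagonal_antidiagonal hF
  have h2 : (fun n => ∑ p ∈ Finset.HasAntidiagonal.antidiagonal n,
      ∑ q ∈ Finset.HasAntidiagonal.antidiagonal p.2, F (p.1, q)) =
      fun J => (besselCoeff ν J : ℂ) * (x + y + 2 * t) ^ J := by
    funext J
    have := bessel_addition Complex.ofRealHom hν x y t J
    simp only [Complex.ofRealHom_eq_coe] at this
    rw [this]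
    refine Finset.sum_congr rfl fun p _ => Finset.sum_congr rfl fun q _ => ?_
    simp only [F, gegSum]
    push_cast
    ring
  rw [h2] at h1
  rw [h1.unique (hasSum_besselReg hν _)] at hF
  refine hF.prod_fiberwise fun s => ?_
  simp only [F]
  have hsν : 0 ≤ (s : ℝ) + ν := by positivity
  exact HasSum.mul_mul_of_norm (hasSum_besselReg hsν x) (hasSum_besselReg hsν y)
    (summable_norm_besselReg hsν x) (summable_norm_besselReg hsν y) _ _

theorem gegSum_smul (ν : ℝ) (s : ℕ) (c x y t : ℂ) :
    gegSum ν s (c * x) (c * y) (c * t) = c ^ s * gegSum ν s x y t := by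
  rw [gegSum, gegSum, Finset.mul_sum]
  refine Finset.sum_congr rfl fun k hk => ?_
  obtain ⟨n, rfl⟩ : ∃ n, s = n + 2 * k :=
    ⟨s - 2 * k, by have := Finset.mem_range.mp hk; omega⟩
  rw [Nat.add_sub_cancel]
  ring

/-- Polarization of the quadratic form `q ↦ ρ²`. This is why the addition theorem applies to `f = q
+ q'`. -/
theorem rhoVal_add (q q' κ : E d) :
    rhoVal (q + q') κ = rhoVal q κ + rhoVal q' κ + 2 * tauVal q q' κ := by
  rw [rhoVal, rhoVal, rhoVal, tauVal, norm_add_sq_real, inner_add_left]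
  ring

theorem genFun_eq {ħ : ℝ} (hħ : 0 < ħ) (q q' κ : E d) :
    genFun ħ q q' κ = ((kappa d ħ * (ħ / 2) ^ ((d : ℝ) - 4) *
      (‖κ‖ ^ 2) ^ ((d : ℝ) / 2 - 2) : ℝ) : ℂ) *
      besselReg (((d : ℝ) - 3) / 2) ((-(ħ ^ 2 / 4) * rhoVal (q + q') κ : ℝ) : ℂ) := by
  have h1 : ‖(-(ħ / 2)) • κ‖ = ħ / 2 * ‖κ‖ := by
    rw [norm_smul, Real.norm_eq_abs, abs_neg, abs_of_pos (by positivity)]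
  rw [genFun, h1, inner_smul_left, mul_pow, Real.mul_rpow (by positivity) (by positivity),
    ← Real.rpow_natCast (ħ / 2) 2, ← Real.rpow_mul (by positivity), rhoVal,
    real_inner_comm (q + q') κ]
  have e : ((2 : ℕ) : ℝ) * ((d : ℝ) / 2 - 2) = d - 4 := by push_cast; ring
  rw [e, ← mul_assoc]
  congr 3
  simp
  ring

/-- The addition theorem at `m²ρ²`, `m²ρ'²`, `m²τ` with `m² = -ħ²/4`. Apart from `m^{d-3}`, which
the prefactor removes, only `m²` occurs, so both signs of `m` are allowed. -/
theorem hasSum_deformedGen (hd : 2 < d) {ħ : ℝ} (hħ : 0 < ħ) (q q' κ : E d) {m : ℂ}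
    (hm : m = Complex.I * ħ / 2 ∨ m = -(Complex.I * ħ / 2)) :
    HasSum (fun s : ℕ => (m ^ (d - 3))⁻¹ * ((-1) ^ s * (specCoeff d ħ s : ℂ)) *
      deformedGen m s q q' κ) (genFun ħ q q' κ) := by
  have hd' : (3 : ℝ) ≤ d := by exact_mod_cast hd
  have hν : 0 ≤ ((d : ℝ) - 3) / 2 := by linarith
  have hħ0 : (ħ : ℂ) ≠ 0 := by exact_mod_cast hħ.ne'
  have hm2 : m ^ 2 = ((-(ħ ^ 2 / 4) : ℝ) : ℂ) := by
    rcases hm with rfl | rfl <;> push_cast <;> ring_nf <;> rw [Complex.I_sq] <;> ring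
  have hm0 : m ≠ 0 := by
    rcases hm with rfl | rfl <;> simp [hħ0]
  have h := hasSum_const_mul (hasSum_besselReg_addition hν (m ^ 2 * rhoVal q κ)
    (m ^ 2 * rhoVal q' κ) (m ^ 2 * tauVal q q' κ)) (((kappa d ħ * (ħ / 2) ^ ((d : ℝ) - 4) *
      (‖κ‖ ^ 2) ^ ((d : ℝ) / 2 - 2) : ℝ) : ℂ))
  have e : (m ^ 2 * rhoVal q κ + m ^ 2 * rhoVal q' κ + 2 * (m ^ 2 * tauVal q q' κ) : ℂ) =
      ((-(ħ ^ 2 / 4) * rhoVal (q + q') κ : ℝ) : ℂ) := by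
    rw [hm2, rhoVal_add]; push_cast; ring
  rw [e, ← genFun_eq hħ] at h
  refine (congrArg (HasSum · (genFun ħ q q' κ)) (funext fun s => ?_)).mpr h
  have hgeg : evalGen (spinPoly s) q q' κ =
      gegSum (((d : ℝ) - 3) / 2) s (rhoVal q κ) (rhoVal q' κ) (tauVal q q' κ) := by
    rw [evalGen_spinPoly, gegSum]
    push_cast
    rfl
  have hG : (s : ℝ) + ((d : ℝ) - 3) / 2 + 1 = s + ((d : ℝ) - 1) / 2 := by ring
  rw [gegSum_smul, deformedGen, confGen, hgeg, specCoeff, hG, pow_add m, pow_mul m]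
  have hc := inv_mul_cancel₀ (pow_ne_zero (d - 3) hm0)
  simp only [Complex.ofReal_mul, Complex.ofReal_pow, Complex.ofReal_neg, Complex.ofReal_one]
  generalize besselReg _ _ = b₁
  generalize besselReg _ _ = b₂
  generalize gegSum _ _ _ _ _ = g
  generalize (((2 : ℝ) ^ (((d : ℝ) - 3) / 2) : ℝ) : ℂ) = c₁
  generalize (((ħ / 2) ^ ((d : ℝ) - 4) : ℝ) : ℂ) = c₂
  generalize (((‖κ‖ ^ 2) ^ ((d : ℝ) / 2 - 2) : ℝ) : ℂ) = c₃
  generalize ((Real.Gamma (s + ((d : ℝ) - 1) / 2) : ℝ) : ℂ) = c₄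
  generalize m ^ (d - 3) = c at hc ⊢
  linear_combination ((-1) ^ s * (c₁ * c₂ * kappa d ħ * c₄) * (m ^ 2) ^ s * b₁ * b₂ * c₃ * g) * hc

/-! ### Moyal products with exponentials -/

/-! ### Taylor series along a line, at a complex parameter. -/

section Taylor

variable {F : Type*} [NormedAddCommGroup F] [NormedSpace ℝ F]

theorem iteratedFDeriv_const_eq_iteratedDeriv {g : F → ℂ} (hg : ∀ n : ℕ, ContDiff ℝ n g)
    (z u : F) (r : ℕ) :
    iteratedFDeriv ℝ r g z (fun _ => u) = iteratedDeriv r (fun t : ℝ => g (z + t • u)) 0 := by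
  have h1 : ContDiff ℝ r (fun y => g (z + y)) := (hg r).comp (contDiff_const.add contDiff_id)
  have h2 : (fun t : ℝ => g (z + t • u)) =
      (fun y => g (z + y)) ∘ (ContinuousLinearMap.toSpanSingleton ℝ u) := by
    funext t; simp
  rw [iteratedDeriv_eq_iteratedFDeriv, h2,
    ContinuousLinearMap.iteratedFDeriv_comp_right _ h1 _ le_rfl,
    ContinuousMultilinearMap.compContinuousLinearMap_apply, iteratedFDeriv_comp_add_left]
  simp

theorem iteratedDeriv_comp_ofReal {G : ℂ → ℂ} (hG : Differentiable ℂ G) (r : ℕ) :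
    iteratedDeriv r (fun t : ℝ => G t) = fun t : ℝ => iteratedDeriv r G t := by
  induction r with
  | zero => simp
  | succ r ih =>
    rw [iteratedDeriv_succ, ih]
    funext t
    have h : Differentiable ℂ (iteratedDeriv r G) :=
      (hG.contDiff (n := (r + 1 : ℕ))).differentiable_iteratedDeriv r (by exact_mod_cast r.lt_succ_self)
    rw [iteratedDeriv_succ]
    exact ((h t).hasDerivAt.comp_ofReal).deriv

/-- This gives a meaning to the shift of a symbol by an imaginary vector: the restriction of `g` to
a real line extends to an entire function, and the Taylor series of `g` along the line sums to the
value of that extension. -/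
theorem hasSum_iteratedFDeriv_line {g : F → ℂ} (hg : ∀ n : ℕ, ContDiff ℝ n g) {z u : F}
    {G : ℂ → ℂ} (hG : Differentiable ℂ G) (h : ∀ t : ℝ, g (z + t • u) = G t) (c : ℂ) :
    HasSum (fun r : ℕ => (1 / (r.factorial : ℂ)) * c ^ r * iteratedFDeriv ℝ r g z (fun _ => u))
      (G c) := by
  have h1 := Complex.hasSum_taylorSeries_of_entire hG 0 c
  refine (congrArg (HasSum · (G c)) (funext fun r => ?_)).mpr h1
  rw [iteratedFDeriv_const_eq_iteratedDeriv hg, funext h, iteratedDeriv_comp_ofReal hG]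
  simp [mul_assoc]

theorem iteratedFDeriv_cexp_clm (ℓ : F →L[ℝ] ℝ) (r : ℕ) (z : F) (v : Fin r → F) :
    iteratedFDeriv ℝ r (fun y => Complex.exp (ℓ y : ℝ)) z v =
      (∏ i, ((ℓ (v i) : ℝ) : ℂ)) * Complex.exp (ℓ z : ℝ) := by
  have h1 : ContDiff ℝ r (fun t : ℝ => Complex.exp t) :=
    Complex.contDiff_exp.comp Complex.ofRealCLM.contDiff
  have h2 : (fun y => Complex.exp (ℓ y : ℝ)) = (fun t : ℝ => Complex.exp t) ∘ ℓ := rfl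
  rw [h2, ContinuousLinearMap.iteratedFDeriv_comp_right _ h1 _ le_rfl,
    ContinuousMultilinearMap.compContinuousLinearMap_apply,
    iteratedFDeriv_apply_eq_iteratedDeriv_mul_prod,
    iteratedDeriv_comp_ofReal Complex.differentiable_exp, iteratedDeriv_eq_iterate,
    Complex.iter_deriv_exp, Complex.real_smul]
  push_cast
  rfl

end Taylor

/-- The exponent of `planeWave q κ`. -/
def waveForm (q κ : E d) : E d × E d →L[ℝ] ℝ :=
  (innerSL ℝ q).comp (ContinuousLinearMap.snd ℝ _ _) +
    (innerSL ℝ κ).comp (ContinuousLinearMap.fst ℝ _ _)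

theorem waveForm_apply (q κ : E d) (z : E d × E d) :
    waveForm q κ z = inner ℝ q z.2 + inner ℝ κ z.1 := rfl

theorem planeWave_eq (q κ : E d) : planeWave q κ = fun z => Complex.exp (waveForm q κ z : ℝ) := rfl

/-- The sign in the Poisson bivector, as a real number. -/
def bivectorSign (a : Fin d × Bool) : ℝ := if a.2 then -1 else 1

theorem nablaSign_eq (a : Fin d × Bool) : nablaSign a = (bivectorSign a : ℂ) := by
  rw [nablaSign, bivectorSign]; split_ifs <;> simp

/-- Contracting the Poisson bivector with the wave covector gives the direction in which the wave
shifts the other factor. -/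
theorem sum_phaseVec (q κ : E d) :
    ∑ a : Fin d × Bool, (bivectorSign a * waveForm q κ (phaseVec a)) • phaseVec (a.1, !a.2) =
      ((-q, κ) : E d × E d) := by
  rw [Fintype.sum_prod_type]
  simp only [Fintype.sum_bool]
  refine Prod.ext ?_ ?_
  · ext i
    simp [phaseVec, bivectorSign, waveForm_apply, EuclideanSpace.inner_single_right,
      Prod.fst_sum, Pi.single_apply]
  · ext i
    simp [phaseVec, bivectorSign, waveForm_apply, EuclideanSpace.inner_single_right,
      Prod.snd_sum, Pi.single_apply]

/-- Exponentials are eigenfunctions of all derivatives, so by multilinearity the bidifferential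
operator collapses to an `r`-fold derivative of `g` in a single direction. -/
theorem starTerm_planeWave (ħ : ℝ) (q κ : E d) (g : Symb d) (r : ℕ) (z : E d × E d) :
    starTerm ħ r (planeWave q κ) g z = planeWave q κ z *
      ((1 / (r.factorial : ℂ)) * (Complex.I * (ħ : ℂ) / 2) ^ r *
        iteratedFDeriv ℝ r g z (fun _ => (-q, κ))) := by
  rw [starTerm, ← sum_phaseVec, ContinuousMultilinearMap.map_sum, Finset.mul_sum, Finset.mul_sum,
    Finset.mul_sum]
  refine Finset.sum_congr rfl fun w _ => ?_
  rw [ContinuousMultilinearMap.map_smul_univ, planeWave_eq, iteratedFDeriv_cexp_clm,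
    Complex.real_smul, Finset.prod_mul_distrib]
  simp only [nablaSign_eq]
  push_cast
  ring

/-- `e^{q·p + κ·x} * g = e^{q·p + κ·x} g(x - iħq/2, p + iħκ/2)`. -/
theorem star_planeWave {ħ : ℝ} {q κ : E d} {g : Symb d} (hg : ∀ n : ℕ, ContDiff ℝ n g)
    {z : E d × E d} {G : ℂ → ℂ} (hG : Differentiable ℂ G)
    (h : ∀ t : ℝ, g (z.1 - t • q, z.2 + t • κ) = G t) :
    star ħ (planeWave q κ) g z = planeWave q κ z * G (Complex.I * ħ / 2) := by
  have h1 : ∀ t : ℝ, g (z + t • ((-q, κ) : E d × E d)) = G t := fun t => by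
    rw [← h t]
    congr 1
    refine Prod.ext ?_ rfl
    simp [sub_eq_add_neg]
  rw [star]
  simp only [starTerm_planeWave]
  exact (hasSum_const_mul (hasSum_iteratedFDeriv_line hg hG h1 _) _).tsum_eq

/-- The symbol `e^{κ·x} Q(p)`. -/
def xWave (κ : E d) (Q : E d → ℂ) : Symb d := fun z => Complex.exp ((inner ℝ κ z.1 : ℝ) : ℂ) * Q z.2

theorem contDiff_xWave (κ : E d) {Q : E d → ℂ} (hQ : ∀ n : ℕ, ContDiff ℝ n Q) (n : ℕ) :
    ContDiff ℝ n (xWave κ Q) :=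
  (Complex.contDiff_exp.comp (Complex.ofRealCLM.contDiff.comp
    ((innerSL ℝ κ).contDiff.comp contDiff_fst))).mul ((hQ n).comp contDiff_snd)

theorem iteratedFDeriv_xWave (κ : E d) {Q : E d → ℂ} (hQ : ∀ n : ℕ, ContDiff ℝ n Q) (r : ℕ)
    (z : E d × E d) (v : Fin r → E d) :
    iteratedFDeriv ℝ r (xWave κ Q) z (fun i => (v i, 0)) =
      (∏ i, ((inner ℝ κ (v i) : ℝ) : ℂ)) * xWave κ Q z := by
  have h1 : ContDiff ℝ r (fun y => xWave κ Q (z + y)) :=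
    (contDiff_xWave κ hQ r).comp (contDiff_const.add contDiff_id)
  have h2 : (fun y => xWave κ Q (z + y)) ∘ (ContinuousLinearMap.inl ℝ (E d) (E d)) =
      (xWave κ Q z) • fun y : E d => Complex.exp ((innerSL ℝ κ y : ℝ) : ℂ) := by
    funext y
    simp [xWave, inner_add_right, Complex.exp_add]
    ring
  have h3 := ContinuousLinearMap.iteratedFDeriv_comp_right
    (ContinuousLinearMap.inl ℝ (E d) (E d)) h1 0 (i := r) le_rfl
  have h4 : ContDiff ℝ r (fun y : E d => Complex.exp ((innerSL ℝ κ y : ℝ) : ℂ)) :=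
    Complex.contDiff_exp.comp (Complex.ofRealCLM.contDiff.comp (innerSL ℝ κ).contDiff)
  rw [h2, iteratedFDeriv_const_smul_apply h4.contDiffAt, map_zero,
    iteratedFDeriv_comp_add_left, add_zero] at h3
  have h5 := congrArg (fun M => M v) h3
  simp only [smul_apply, iteratedFDeriv_cexp_clm,
    ContinuousMultilinearMap.compContinuousLinearMap_apply, ContinuousLinearMap.inl_apply] at h5
  rw [← h5]
  simp
  ring

/-- The left factor depends on `p` alone, so only `x`-derivatives reach the right factor, and
`e^{κ·x} Q(p)` is an eigenfunction of these for arbitrary `Q`. -/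
theorem starTerm_xWave (ħ : ℝ) {f : E d → ℂ} (hf : ∀ n : ℕ, ContDiff ℝ n f) (κ : E d)
    {Q : E d → ℂ} (hQ : ∀ n : ℕ, ContDiff ℝ n Q) (r : ℕ) (z : E d × E d) :
    starTerm ħ r (fun y => f y.2) (xWave κ Q) z = xWave κ Q z *
      ((1 / (r.factorial : ℂ)) * (Complex.I * (ħ : ℂ) / 2) ^ r *
        iteratedFDeriv ℝ r f z.2 (fun _ => -κ)) := by
  have h1 : ∀ v : Fin r → E d × E d, iteratedFDeriv ℝ r (fun y : E d × E d => f y.2) z v =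
      iteratedFDeriv ℝ r f z.2 (fun i => (v i).2) := fun v => by
    have := ContinuousLinearMap.iteratedFDeriv_comp_right
      (ContinuousLinearMap.snd ℝ (E d) (E d)) (hf r) z (i := r) le_rfl
    exact congrArg (fun M => M v) this
  have h2 : -κ = ∑ a : Fin d × Bool,
      (bivectorSign a * inner ℝ κ (phaseVec (a.1, !a.2)).1) • (phaseVec a).2 := by
    rw [Fintype.sum_prod_type]
    simp only [Fintype.sum_bool]
    ext i
    simp [phaseVec, bivectorSign, EuclideanSpace.inner_single_right, Pi.single_apply]
  rw [starTerm, h2, ContinuousMultilinearMap.map_sum, Finset.mul_sum, Finset.mul_sum,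
    Finset.mul_sum]
  refine Finset.sum_congr rfl fun w _ => ?_
  rw [ContinuousMultilinearMap.map_smul_univ, h1]
  -- A word containing an `x`-derivative annihilates `f(p)`; on the right side its vector also has
  -- zero momentum component.
  by_cases hw : ∀ i, (w i).2 = true
  · have h3 : (fun i => phaseVec ((w i).1, !(w i).2)) =
        fun i => ((phaseVec ((w i).1, !(w i).2)).1, (0 : E d)) := by
      funext i
      simp [phaseVec, hw i]
    rw [h3, iteratedFDeriv_xWave κ hQ, Complex.real_smul, Finset.prod_mul_distrib]
    simp only [nablaSign_eq]
    push_cast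
    ring
  · push Not at hw
    obtain ⟨i, hi⟩ := hw
    rw [(iteratedFDeriv ℝ r f z.2).map_coord_zero i (by simp [phaseVec, hi])]
    simp

/-- `f(p) * e^{κ·x} Q(p) = f(p - iħκ/2) e^{κ·x} Q(p)`. -/
theorem star_xWave {ħ : ℝ} {f : E d → ℂ} (hf : ∀ n : ℕ, ContDiff ℝ n f) {κ : E d}
    {Q : E d → ℂ} (hQ : ∀ n : ℕ, ContDiff ℝ n Q) {z : E d × E d} {G : ℂ → ℂ}
    (hG : Differentiable ℂ G) (h : ∀ t : ℝ, f (z.2 - t • κ) = G t) :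
    star ħ (fun y => f y.2) (xWave κ Q) z = xWave κ Q z * G (Complex.I * ħ / 2) := by
  have h1 : ∀ t : ℝ, f (z.2 + t • (-κ)) = G t := fun t => by
    rw [← h t, smul_neg, sub_eq_add_neg]
  rw [star]
  simp only [starTerm_xWave ħ hf κ hQ]
  exact (hasSum_const_mul (hasSum_iteratedFDeriv_line hf hG h1 _) _).tsum_eq

/-! ### The Moyal powers of `-p² + e₁ h₁ + e₂ h₂` for plane waves -/

/-- `-(p + ζκ)²`. -/
def kinetic (κ p : E d) (ζ : ℂ) : ℂ :=
  -((‖p‖ ^ 2 : ℝ) + 2 * ζ * (inner ℝ p κ : ℝ) + ζ ^ 2 * (‖κ‖ ^ 2 : ℝ))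

/-- `-p²`. -/
def negSq (p : E d) : ℂ := -((‖p‖ ^ 2 : ℝ) : ℂ)

theorem vacuum_eq : (vacuum : Symb d) = fun y => negSq y.2 := rfl

theorem contDiff_kinetic (κ : E d) (ζ : ℂ) (n : ℕ) : ContDiff ℝ n fun p => kinetic κ p ζ := by
  unfold kinetic
  have h1 : ContDiff ℝ n fun p : E d => ((‖p‖ ^ 2 : ℝ) : ℂ) :=
    Complex.ofRealCLM.contDiff.comp (contDiff_norm_sq ℝ)
  have h2 : ContDiff ℝ n fun p : E d => ((inner ℝ p κ : ℝ) : ℂ) :=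
    Complex.ofRealCLM.contDiff.comp (contDiff_id.inner ℝ contDiff_const)
  exact ((h1.add (contDiff_const.mul h2)).add contDiff_const).neg

theorem kinetic_zero (κ p : E d) : kinetic κ p 0 = negSq p := by simp [kinetic, negSq]

theorem contDiff_negSq (n : ℕ) : ContDiff ℝ n (negSq : E d → ℂ) := by
  have := contDiff_kinetic (0 : E d) 0 n
  simpa only [kinetic_zero] using this

theorem kinetic_add_smul (κ p : E d) (ζ : ℂ) (t : ℝ) :
    kinetic κ (p + t • κ) ζ = kinetic κ p (ζ + t) := by
  rw [kinetic, kinetic, norm_add_sq_real, inner_add_left, inner_smul_left, inner_smul_right,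
    norm_smul, real_inner_self_eq_norm_sq, mul_pow, Real.norm_eq_abs, sq_abs]
  push_cast
  simp
  ring

theorem kinetic_sub_smul (κ p : E d) (ζ : ℂ) (t : ℝ) :
    kinetic κ (p - t • κ) ζ = kinetic κ p (ζ - t) := by
  have := kinetic_add_smul κ p ζ (-t)
  rw [neg_smul, ← sub_eq_add_neg] at this
  rw [this]
  push_cast
  rw [← sub_eq_add_neg]

theorem kinetic_neg (κ p : E d) (ζ : ℂ) : kinetic (-κ) p ζ = kinetic κ p (-ζ) := by
  simp [kinetic]

theorem differentiable_kinetic (κ p : E d) : Differentiable ℂ (kinetic κ p) := by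
  unfold kinetic; fun_prop

/-- `∑_{i + j = k - 1} aⁱ bʲ`. -/
def divDiff₂ (a b : ℂ) : ℕ → ℂ
  | 0 => 0
  | k + 1 => a * divDiff₂ a b k + b ^ k

/-- The divided difference of `xᵏ` at `a, a, b`. -/
def divDiff₃ (a b : ℂ) : ℕ → ℂ
  | 0 => 0
  | k + 1 => a * divDiff₃ a b k + divDiff₂ a b k

theorem sub_mul_divDiff₂ (a b : ℂ) (k : ℕ) : (a - b) * divDiff₂ a b k = a ^ k - b ^ k := by
  induction k with
  | zero => simp [divDiff₂]
  | succ k ih => rw [divDiff₂]; linear_combination a * ih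

theorem divDiff₂_comm (a b : ℂ) (k : ℕ) : divDiff₂ a b k = divDiff₂ b a k := by
  induction k with
  | zero => rfl
  | succ k ih => rw [divDiff₂, divDiff₂, ← ih]; linear_combination sub_mul_divDiff₂ a b k

section smooth

variable {X : Type*} [NormedAddCommGroup X] [NormedSpace ℝ X]

theorem contDiff_divDiff₂ {a b : X → ℂ} (ha : ∀ n : ℕ, ContDiff ℝ n a)
    (hb : ∀ n : ℕ, ContDiff ℝ n b) (k n : ℕ) : ContDiff ℝ n fun x => divDiff₂ (a x) (b x) k := by
  induction k with
  | zero => exact contDiff_const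
  | succ k ih => exact ((ha n).mul ih).add ((hb n).pow k)

theorem contDiff_divDiff₃ {a b : X → ℂ} (ha : ∀ n : ℕ, ContDiff ℝ n a)
    (hb : ∀ n : ℕ, ContDiff ℝ n b) (k n : ℕ) : ContDiff ℝ n fun x => divDiff₃ (a x) (b x) k := by
  induction k with
  | zero => exact contDiff_const
  | succ k ih => exact ((ha n).mul ih).add (contDiff_divDiff₂ ha hb k n)

end smooth

theorem differentiable_divDiff₂ {a b : ℂ → ℂ} (ha : Differentiable ℂ a) (hb : Differentiable ℂ b)
    (k : ℕ) : Differentiable ℂ fun x => divDiff₂ (a x) (b x) k := by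
  induction k with
  | zero => exact differentiable_const _
  | succ k ih => exact (ha.mul ih).add (hb.pow k)

/-- Symbols depending on `p` alone multiply pointwise; this is the case `κ = 0` of `star_xWave`. -/
theorem powZero_eq (ħ : ℝ) (k : ℕ) : powZero ħ k = xWave 0 fun p : E d => negSq p ^ k := by
  induction k with
  | zero => funext z; simp [powZero, xWave]
  | succ k ih =>
    funext z
    rw [powZero, ih, vacuum_eq, star_xWave contDiff_negSq (fun n => (contDiff_negSq n).pow k)
      (differentiable_const (negSq z.2)) (by simp)]
    simp [xWave, pow_succ]

theorem planeWave_eq_xWave (q κ : E d) :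
    planeWave q κ = xWave κ fun p => Complex.exp ((inner ℝ q p : ℝ) : ℂ) := by
  funext z
  rw [planeWave, xWave, ← Complex.exp_add]
  push_cast
  rw [add_comm]

theorem contDiff_cexp_inner (q : E d) (n : ℕ) :
    ContDiff ℝ n fun p : E d => Complex.exp ((inner ℝ q p : ℝ) : ℂ) :=
  Complex.contDiff_exp.comp (Complex.ofRealCLM.contDiff.comp (innerSL ℝ q).contDiff)

/-- Multiplication by `-p²` from the left evaluates it at `p - iħκ/2`, while the wave multiplied by
a power of `-p²` evaluates that power at `p + iħκ/2`. The recursion for the powers is then that of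
the divided difference at these two values. -/
theorem powOne_planeWave (ħ : ℝ) (q κ : E d) (k : ℕ) :
    powOne ħ (planeWave q κ) k = xWave κ fun p => Complex.exp ((inner ℝ q p : ℝ) : ℂ) *
      divDiff₂ (kinetic κ p (-(Complex.I * ħ / 2))) (kinetic κ p (Complex.I * ħ / 2)) k := by
  induction k with
  | zero => funext z; simp [powOne, xWave, divDiff₂]
  | succ k ih =>
    funext z
    have h1 : star ħ (vacuum : Symb d) (powOne ħ (planeWave q κ) k) z =
        powOne ħ (planeWave q κ) k z * kinetic κ z.2 (-(Complex.I * ħ / 2)) := by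
      rw [ih, vacuum_eq]
      refine star_xWave (G := fun t => kinetic κ z.2 (-t)) contDiff_negSq (fun n => ?_)
        ((differentiable_kinetic κ z.2).comp differentiable_neg) fun t => ?_
      · exact (contDiff_cexp_inner q n).mul
          (contDiff_divDiff₂ (contDiff_kinetic κ _) (contDiff_kinetic κ _) k n)
      · rw [← kinetic_zero κ, kinetic_sub_smul, zero_sub]
    have h2 : star ħ (planeWave q κ) (powZero ħ k) z =
        planeWave q κ z * kinetic κ z.2 (Complex.I * ħ / 2) ^ k := by
      rw [powZero_eq]
      refine star_planeWave (G := fun t => kinetic κ z.2 t ^ k)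
        (contDiff_xWave 0 fun n => (contDiff_negSq n).pow k)
        ((differentiable_kinetic κ z.2).pow k) fun t => ?_
      rw [xWave, ← kinetic_zero κ, kinetic_add_smul]
      simp
    rw [powOne, Pi.add_apply, h1, h2, ih, planeWave_eq_xWave, xWave, xWave, xWave, divDiff₂]
    ring

/-- The second wave shifts `p` by a further `-iħκ/2`, which moves the two nodes to `-(p - iħκ)²` and
`-p²`. The `x`-dependence cancels, and shifting the first exponential leaves the phase `e^{-iħ
κ·(q+q')/2}`. -/
theorem star_planeWave_powOne (ħ : ℝ) (q q' κ : E d) (k : ℕ) (z : E d × E d) :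
    star ħ (planeWave q' (-κ)) (powOne ħ (planeWave q κ) k) z =
      Complex.exp ((inner ℝ (q + q') z.2 : ℝ) : ℂ) *
        (Complex.exp (-(Complex.I * ħ / 2) * (inner ℝ κ (q + q') : ℝ)) *
          divDiff₂ (negSq z.2) (kinetic κ z.2 (-(2 * (Complex.I * ħ / 2)))) k) := by
  rw [powOne_planeWave]
  rw [star_planeWave (G := fun t => Complex.exp ((inner ℝ q z.2 + inner ℝ κ z.1 : ℝ) -
      t * (inner ℝ κ (q + q') : ℝ)) * divDiff₂ (kinetic κ z.2 (-(Complex.I * ħ / 2) - t))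
        (kinetic κ z.2 (Complex.I * ħ / 2 - t)) k)]
  · rw [planeWave, ← mul_assoc, ← Complex.exp_add, ← mul_assoc, ← Complex.exp_add, sub_self,
      kinetic_zero, divDiff₂_comm]
    congr 2
    · simp only [inner_neg_left, inner_add_left]
      push_cast
      ring
    · ring_nf
  · exact contDiff_xWave κ fun n => (contDiff_cexp_inner q n).mul
      (contDiff_divDiff₂ (contDiff_kinetic κ _) (contDiff_kinetic κ _) k n)
  · refine Differentiable.mul (by fun_prop) (differentiable_divDiff₂ ?_ ?_ k)
    · exact (differentiable_kinetic κ z.2).comp (by fun_prop)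
    · exact (differentiable_kinetic κ z.2).comp (by fun_prop)
  · intro t
    rw [xWave, smul_neg, ← sub_eq_add_neg, kinetic_sub_smul, kinetic_sub_smul, ← mul_assoc,
      ← Complex.exp_add]
    congr 2
    simp only [inner_sub_right, inner_smul_right, inner_add_right, real_inner_comm q κ]
    push_cast
    ring

theorem star_planeWave_powOne' (ħ : ℝ) (q q' κ : E d) (k : ℕ) (z : E d × E d) :
    star ħ (planeWave q κ) (powOne ħ (planeWave q' (-κ)) k) z =
      Complex.exp ((inner ℝ (q + q') z.2 : ℝ) : ℂ) *
        (Complex.exp ((Complex.I * ħ / 2) * (inner ℝ κ (q + q') : ℝ)) *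
          divDiff₂ (negSq z.2) (kinetic κ z.2 (2 * (Complex.I * ħ / 2))) k) := by
  have h := star_planeWave_powOne ħ q' q (-κ) k z
  rw [neg_neg] at h
  rw [h, kinetic_neg, neg_neg, inner_neg_left, add_comm q']
  push_cast
  rw [neg_mul_neg]

/-- The symbol no longer depends on `x`, so left multiplication by `-p²` is pointwise. This doubles
the node `-p²`, and the two terms are the two orderings of the waves. -/
theorem powTwo_planeWave (ħ : ℝ) (q q' κ : E d) (k : ℕ) :
    powTwo ħ (planeWave q' (-κ)) (planeWave q κ) k = xWave 0 fun p =>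
      Complex.exp ((inner ℝ (q + q') p : ℝ) : ℂ) *
        (Complex.exp (-(Complex.I * ħ / 2) * (inner ℝ κ (q + q') : ℝ)) *
          divDiff₃ (negSq p) (kinetic κ p (-(2 * (Complex.I * ħ / 2)))) k +
        Complex.exp ((Complex.I * ħ / 2) * (inner ℝ κ (q + q') : ℝ)) *
          divDiff₃ (negSq p) (kinetic κ p (2 * (Complex.I * ħ / 2))) k) := by
  induction k with
  | zero => funext z; simp [powTwo, xWave, divDiff₃]
  | succ k ih =>
    funext z
    have h1 : star ħ (vacuum : Symb d) (powTwo ħ (planeWave q' (-κ)) (planeWave q κ) k) z =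
        powTwo ħ (planeWave q' (-κ)) (planeWave q κ) k z * negSq z.2 := by
      rw [ih, vacuum_eq]
      refine star_xWave (G := fun _ => negSq z.2) contDiff_negSq (fun n => ?_)
        (differentiable_const _) (by simp)
      exact (contDiff_cexp_inner (q + q') n).mul ((contDiff_const.mul (contDiff_divDiff₃
        contDiff_negSq (contDiff_kinetic κ _) k n)).add (contDiff_const.mul (contDiff_divDiff₃
        contDiff_negSq (contDiff_kinetic κ _) k n)))
    rw [powTwo, Pi.add_apply, Pi.add_apply, h1, star_planeWave_powOne, star_planeWave_powOne', ih]
    simp only [xWave, inner_zero_left, divDiff₃, Complex.ofReal_zero, Complex.exp_zero]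
    ring

/-! ### The exponential series of divided differences -/

/-- The Hermite–Genocchi formula for two nodes. Unlike the quotient `(aᵏ - bᵏ)/(a - b)`, it stays
valid at coinciding nodes. -/
theorem divDiff₂_succ (a b : ℂ) (k : ℕ) :
    divDiff₂ a b (k + 1) = (k + 1) * ∫ s in (0 : ℝ)..1, (a + s * (b - a)) ^ k := by
  induction k with
  | zero => simp [divDiff₂]
  | succ k ih =>
    -- The derivative is arranged to contain the integrands for both `k` and `k + 1`, using `s(b -
    -- a) = (a + s(b - a)) - a`. Its integral is then the recursion of the divided difference.
    have hd : ∀ s : ℝ, HasDerivAt (fun s : ℝ => (s : ℂ) * (a + s * (b - a)) ^ (k + 1))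
        ((a + s * (b - a)) ^ (k + 1) +
          (k + 1) * ((a + s * (b - a)) ^ (k + 1) - a * (a + s * (b - a)) ^ k)) s := by
      intro s
      have h0 : HasDerivAt (fun s : ℝ => (s : ℂ)) 1 s := Complex.ofRealCLM.hasDerivAt
      have h1 := h0.mul (((h0.mul_const (b - a)).const_add a).pow (k + 1))
      refine h1.congr_deriv ?_
      simp only [Nat.add_sub_cancel, Pi.pow_apply]
      push_cast
      ring
    have hi := intervalIntegral.integral_eq_sub_of_hasDerivAt (a := 0) (b := 1)
      (fun s _ => hd s) (Continuous.intervalIntegrable (by fun_prop) _ _)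
    rw [intervalIntegral.integral_add (Continuous.intervalIntegrable (by fun_prop) _ _)
      (Continuous.intervalIntegrable (by fun_prop) _ _), intervalIntegral.integral_const_mul,
      intervalIntegral.integral_sub (Continuous.intervalIntegrable (by fun_prop) _ _)
      (Continuous.intervalIntegrable (by fun_prop) _ _), intervalIntegral.integral_const_mul] at hi
    rw [divDiff₂, ih]
    push_cast at hi ⊢
    simp only [one_mul, zero_mul, sub_zero, add_sub_cancel] at hi
    linear_combination -hi

/-- Hermite–Genocchi with the node `a` taken twice: integrating the simplex over the two weights of
`a` leaves the factor `1 - s`. -/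
theorem divDiff₃_add_two (a b : ℂ) (k : ℕ) :
    divDiff₃ a b (k + 2) =
      (k + 2) * (k + 1) * ∫ s in (0 : ℝ)..1, (1 - s) * (a + s * (b - a)) ^ k := by
  induction k with
  | zero =>
    have : ∫ s in (0 : ℝ)..1, (1 - (s : ℂ)) = 1 / 2 := by
      have : ∀ s : ℝ, (1 - (s : ℂ)) = ((1 - s : ℝ) : ℂ) := fun s => by push_cast; rfl
      simp only [this, intervalIntegral.integral_ofReal]
      rw [intervalIntegral.integral_sub (by simp) (by simp)]
      norm_num
    simp [divDiff₃, divDiff₂, this]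
  | succ k ih =>
    have hd : ∀ s : ℝ, HasDerivAt (fun s : ℝ => (s : ℂ) * (1 - s) * (a + s * (b - a)) ^ (k + 1))
        (2 * ((1 - s) * (a + s * (b - a)) ^ (k + 1)) - (a + s * (b - a)) ^ (k + 1) +
          (k + 1) * ((1 - s) * (a + s * (b - a)) ^ (k + 1) -
            a * ((1 - s) * (a + s * (b - a)) ^ k))) s := by
      intro s
      have h0 : HasDerivAt (fun s : ℝ => (s : ℂ)) 1 s := Complex.ofRealCLM.hasDerivAt
      have h1 := (h0.mul (h0.const_sub 1)).mul (((h0.mul_const (b - a)).const_add a).pow (k + 1))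
      refine h1.congr_deriv ?_
      simp only [Nat.add_sub_cancel, Pi.pow_apply, Pi.mul_apply]
      push_cast
      ring
    have hi := intervalIntegral.integral_eq_sub_of_hasDerivAt (a := 0) (b := 1)
      (fun s _ => hd s) (Continuous.intervalIntegrable (by fun_prop) _ _)
    rw [intervalIntegral.integral_add (Continuous.intervalIntegrable (by fun_prop) _ _)
      (Continuous.intervalIntegrable (by fun_prop) _ _), intervalIntegral.integral_const_mul,
      intervalIntegral.integral_sub (Continuous.intervalIntegrable (by fun_prop) _ _)
      (Continuous.intervalIntegrable (by fun_prop) _ _),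
      intervalIntegral.integral_sub (Continuous.intervalIntegrable (by fun_prop) _ _)
      (Continuous.intervalIntegrable (by fun_prop) _ _), intervalIntegral.integral_const_mul,
      intervalIntegral.integral_const_mul] at hi
    rw [divDiff₃, ih, divDiff₂_succ]
    push_cast at hi ⊢
    simp only [sub_self, mul_zero, zero_mul] at hi
    linear_combination (-(k + 2 : ℂ)) * hi

/-- The exponential series is summed under the Hermite–Genocchi integral, giving the divided
difference of `x ↦ e^{lx}` at `a, a, b`. -/
theorem hasSum_divDiff₃ (a b l : ℂ) :
    HasSum (fun k : ℕ => l ^ k / (k.factorial : ℂ) * divDiff₃ a b k)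
      (l ^ 2 * ∫ s in (0 : ℝ)..1, (1 - s) * Complex.exp (l * (a + s * (b - a)))) := by
  have h1 : HasSum (fun k : ℕ => ∫ s in (0 : ℝ)..1,
      (1 - (s : ℂ)) * ((l * (a + s * (b - a))) ^ k / (k.factorial : ℂ)))
      (∫ s in (0 : ℝ)..1, (1 - (s : ℂ)) * Complex.exp (l * (a + s * (b - a)))) := by
    set M : ℝ := ‖l‖ * (‖a‖ + ‖b - a‖) with hM
    refine intervalIntegral.hasSum_integral_of_dominated_convergence
      (fun k _ => M ^ k / k.factorial) (fun k => ?_) (fun k => ?_) ?_ ?_ ?_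
    · exact (Continuous.aestronglyMeasurable (by fun_prop))
    · refine Filter.Eventually.of_forall fun s hs => ?_
      rw [Set.uIoc_of_le zero_le_one] at hs
      rw [norm_mul, norm_div, norm_pow, Complex.norm_natCast]
      have e1 : ‖(1 - (s : ℂ))‖ ≤ 1 := by
        rw [← Complex.ofReal_one, ← Complex.ofReal_sub, Complex.norm_real, Real.norm_eq_abs,
          abs_le]
        constructor <;> linarith [hs.1, hs.2]
      have e2 : ‖l * (a + s * (b - a))‖ ≤ M := by
        rw [norm_mul]
        refine mul_le_mul_of_nonneg_left ((norm_add_le _ _).trans ?_) (norm_nonneg _)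
        rw [norm_mul, Complex.norm_real, Real.norm_eq_abs, abs_of_pos hs.1]
        have := mul_le_mul_of_nonneg_right hs.2 (norm_nonneg (b - a))
        linarith
      calc _ ≤ 1 * (M ^ k / k.factorial) := by gcongr
        _ = _ := one_mul _
    · exact Filter.Eventually.of_forall fun s _ => Real.summable_pow_div_factorial M
    · simp
    · refine Filter.Eventually.of_forall fun s _ => hasSum_const_mul ?_ _
      have := NormedSpace.expSeries_div_hasSum_exp (𝔸 := ℂ) (l * (a + s * (b - a)))
      rwa [← Complex.exp_eq_exp_ℂ] at this
  -- The terms `k = 0, 1` vanish, and `(k+2)(k+1)` turns `(k+2)!` into `k!`.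
  refine (hasSum_nat_add_iff' 2).mp ?_
  have h2 := hasSum_const_mul h1 (l ^ 2)
  simp only [Finset.sum_range_succ, Finset.sum_range_zero, divDiff₃, divDiff₂, mul_zero, add_zero,
    sub_zero]
  refine (congrArg (HasSum · _) (funext fun k => ?_)).mpr h2
  have h3 : ∀ s : ℝ, (1 - (s : ℂ)) * ((l * (a + s * (b - a))) ^ k / (k.factorial : ℂ)) =
      (l ^ k / (k.factorial : ℂ)) * ((1 - s) * (a + s * (b - a)) ^ k) := fun s => by
    rw [mul_pow]; ring
  simp only [h3, intervalIntegral.integral_const_mul]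
  have h4 := divDiff₃_add_two a b k
  rw [divDiff₃, divDiff₃, divDiff₂] at h4
  rw [h4, Nat.factorial_succ, Nat.factorial_succ]
  generalize (∫ s in (0 : ℝ)..1, (1 - (s : ℂ)) * (a + s * (b - a)) ^ k) = J
  have : (k.factorial : ℂ) ≠ 0 := by exact_mod_cast k.factorial_ne_zero
  have h5 : (k : ℂ) + 1 ≠ 0 := by exact_mod_cast k.succ_ne_zero
  have h6 : (k : ℂ) + 1 + 1 ≠ 0 := by exact_mod_cast (k + 1).succ_ne_zero
  push_cast
  field_simp
  ring

/-! ### The momentum integral -/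

open MeasureTheory

theorem integral_cexp_neg_mul_normSq_add_sum {l : ℂ} (hl : 0 < l.re) (c : Fin d → ℂ) :
    ∫ p : E d, Complex.exp (-l * (‖p‖ ^ 2 : ℝ) + ∑ i, c i * (p i : ℂ)) =
      (Real.pi / l) ^ ((d : ℂ) / 2) * Complex.exp ((∑ i, c i ^ 2) / (4 * l)) := by
  have h := GaussianFourier.integral_cexp_neg_mul_sum_add hl c
  rw [Fintype.card_fin] at h
  rw [← h, ← (EuclideanSpace.volume_preserving_symm_measurableEquiv_toLp (Fin d)).integral_comp
    (MeasurableEquiv.measurableEmbedding _)]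
  refine integral_congr_ae (Filter.Eventually.of_forall fun p => ?_)
  simp only
  congr 3
  rw [EuclideanSpace.real_norm_sq_eq]
  push_cast
  rfl

theorem integrable_exp_inner_sub_normSq {c : ℝ} (hc : 0 < c) (w : E d) :
    Integrable fun p : E d => Real.exp (inner ℝ w p - c * ‖p‖ ^ 2) := by
  have h := (GaussianFourier.integrable_cexp_neg_mul_sq_norm_add (V := E d) (b := (c : ℂ))
    (by simpa using hc) 1 w).norm
  refine h.congr (Filter.Eventually.of_forall fun p => ?_)
  simp only [Complex.norm_exp]
  rw [show (-(c : ℂ) * (‖p‖ : ℂ) ^ 2 + 1 * ((inner ℝ w p : ℝ) : ℂ)) =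
    ((inner ℝ w p - c * ‖p‖ ^ 2 : ℝ) : ℂ) by push_cast; ring, Complex.ofReal_re]

/-- Bounds an exponential whose exponent is linear in `s` by its values at the endpoints, uniformly
in `s`; this is what Fubini's theorem needs below. -/
theorem exp_mul_le_one_add_exp {s x : ℝ} (hs : 0 ≤ s) (hs' : s ≤ 1) :
    Real.exp (s * x) ≤ 1 + Real.exp x := by
  rcases le_total x 0 with h | h
  · have : Real.exp (s * x) ≤ 1 := Real.exp_le_one_iff.mpr (mul_nonpos_of_nonneg_of_nonpos hs h)
    linarith [Real.exp_pos x]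
  · have : Real.exp (s * x) ≤ Real.exp x := Real.exp_le_exp.mpr (by nlinarith)
    linarith

/-- The integrand of the momentum and parameter integrals. -/
def momentumIntegrand (l : ℂ) (f κ : E d) (ζ : ℂ) (p : E d) (s : ℝ) : ℂ :=
  Complex.exp ((inner ℝ f p : ℝ) : ℂ) * ((1 - s) * Complex.exp (l * (negSq p +
    s * (kinetic κ p ζ - negSq p))))

theorem continuous_negSq : Continuous (negSq : E d → ℂ) := (contDiff_negSq 0).continuous

theorem continuous_kinetic (κ : E d) (ζ : ℂ) : Continuous fun p => kinetic κ p ζ :=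
  (contDiff_kinetic κ ζ 0).continuous

/-- The quadratic term `-Re(l) p²` does not depend on `s`, and the rest of the exponent is affine in
`p` and linear in `s`. Two Gaussians therefore dominate for every `s` in `[0,1]`. -/
theorem norm_momentumIntegrand_le (l : ℂ) (f κ : E d) (ζ : ℂ) (p : E d) {s : ℝ} (hs : 0 ≤ s)
    (hs' : s ≤ 1) : ‖momentumIntegrand l f κ ζ p s‖ ≤
      Real.exp (inner ℝ f p - l.re * ‖p‖ ^ 2) +
        Real.exp (-(l * ζ ^ 2).re * ‖κ‖ ^ 2) *
          Real.exp (inner ℝ (f + (-(2 * l * ζ).re) • κ) p - l.re * ‖p‖ ^ 2) := by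
  have e1 : ‖(1 - (s : ℂ))‖ ≤ 1 := by
    rw [← Complex.ofReal_one, ← Complex.ofReal_sub, Complex.norm_real, Real.norm_eq_abs, abs_le]
    constructor <;> linarith
  set x : ℝ := -(l * ζ ^ 2).re * ‖κ‖ ^ 2 - (2 * l * ζ).re * inner ℝ p κ with hx
  have e2 : (l * (negSq p + s * (kinetic κ p ζ - negSq p))).re = -(l.re * ‖p‖ ^ 2) + s * x := by
    have : l * (negSq p + s * (kinetic κ p ζ - negSq p)) = -(((‖p‖ ^ 2 : ℝ) : ℂ) * l) +
        ((s : ℝ) : ℂ) * (-(((‖κ‖ ^ 2 : ℝ) : ℂ) * (l * ζ ^ 2)) -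
          ((inner ℝ p κ : ℝ) : ℂ) * (2 * l * ζ)) := by
      rw [negSq, kinetic]; ring
    rw [this, Complex.add_re, Complex.neg_re, Complex.re_ofReal_mul, Complex.re_ofReal_mul,
      Complex.sub_re, Complex.neg_re, Complex.re_ofReal_mul, Complex.re_ofReal_mul, hx]
    ring
  rw [momentumIntegrand, norm_mul, norm_mul, Complex.norm_exp, Complex.norm_exp, e2,
    Complex.ofReal_re]
  calc _ ≤ Real.exp (inner ℝ f p) * (1 * (Real.exp (-(l.re * ‖p‖ ^ 2)) * (1 + Real.exp x))) := by
        rw [Real.exp_add]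
        gcongr
        exact exp_mul_le_one_add_exp hs hs'
    _ = _ := by
        rw [one_mul, mul_add, mul_one, mul_add, ← Real.exp_add, ← Real.exp_add, ← Real.exp_add,
          ← Real.exp_add, hx, inner_add_left, inner_smul_left, real_inner_comm κ p]
        simp only [sub_eq_add_neg, RCLike.conj_to_real]
        congr 2
        ring

theorem integrable_momentumIntegrand {l : ℂ} (hl : 0 < l.re) (f κ : E d) (ζ : ℂ) :
    Integrable (Function.uncurry (momentumIntegrand l f κ ζ))
      ((volume : Measure (E d)).prod (volume.restrict (Set.Ioc 0 1))) := by
  have h1 : Integrable (fun z : E d × ℝ => Real.exp (inner ℝ f z.1 - l.re * ‖z.1‖ ^ 2) +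
        Real.exp (-(l * ζ ^ 2).re * ‖κ‖ ^ 2) *
          Real.exp (inner ℝ (f + (-(2 * l * ζ).re) • κ) z.1 - l.re * ‖z.1‖ ^ 2))
      ((volume : Measure (E d)).prod (volume.restrict (Set.Ioc 0 1))) :=
    ((integrable_exp_inner_sub_normSq hl _).add
      ((integrable_exp_inner_sub_normSq hl _).const_mul _)).comp_fst _
  refine h1.mono' ?_ ?_
  · refine Continuous.aestronglyMeasurable ?_
    unfold Function.uncurry momentumIntegrand
    have h2 : Continuous fun z : E d × ℝ => negSq z.1 := continuous_negSq.comp continuous_fst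
    have h3 : Continuous fun z : E d × ℝ => kinetic κ z.1 ζ :=
      (continuous_kinetic κ ζ).comp continuous_fst
    fun_prop
  · have h4 : ∀ᵐ z ∂((volume : Measure (E d)).prod (volume.restrict (Set.Ioc (0 : ℝ) 1))),
        z.2 ∈ Set.Ioc (0 : ℝ) 1 :=
      Measure.quasiMeasurePreserving_snd.ae (ae_restrict_mem measurableSet_Ioc)
    filter_upwards [h4] with z hz
    exact norm_momentumIntegrand_le l f κ ζ z.1 hz.1.le hz.2

theorem integral_momentumIntegrand {l : ℂ} (hl : 0 < l.re) (f κ : E d) (ζ : ℂ) (s : ℝ) :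
    ∫ p, momentumIntegrand l f κ ζ p s = (1 - s) * ((Real.pi / l) ^ ((d : ℂ) / 2) *
      Complex.exp ((‖f‖ ^ 2 : ℝ) / (4 * l) - s * ζ * (inner ℝ κ f : ℝ) -
        l * ζ ^ 2 * (‖κ‖ ^ 2 : ℝ) * (s * (1 - s)))) := by
  have hl0 : l ≠ 0 := by rintro rfl; simp at hl
  have hin : ∀ x y : E d, ((inner ℝ x y : ℝ) : ℂ) = ∑ i, (x i : ℂ) * (y i : ℂ) := fun x y => by
    rw [PiLp.inner_apply, Complex.ofReal_sum]
    exact Finset.sum_congr rfl fun i _ => by rw [real_inner_eq_re_inner]; simp; ring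
  have hno : ∀ x : E d, ((‖x‖ ^ 2 : ℝ) : ℂ) = ∑ i, (x i : ℂ) ^ 2 := fun x => by
    rw [EuclideanSpace.real_norm_sq_eq]; push_cast; rfl
  have h1 : ∀ p : E d, momentumIntegrand l f κ ζ p s =
      ((1 - s) * Complex.exp (-(l * ζ ^ 2 * s * (‖κ‖ ^ 2 : ℝ)))) *
        Complex.exp (-l * (‖p‖ ^ 2 : ℝ) + ∑ i, ((f i : ℂ) - 2 * l * s * ζ * κ i) * (p i : ℂ)) := by
    intro p
    have : ∑ i, ((f i : ℂ) - 2 * l * s * ζ * κ i) * (p i : ℂ) =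
        (inner ℝ f p : ℝ) - 2 * l * s * ζ * (inner ℝ p κ : ℝ) := by
      rw [hin, hin, Finset.mul_sum, ← Finset.sum_sub_distrib]
      exact Finset.sum_congr rfl fun i _ => by ring
    rw [this, momentumIntegrand, mul_assoc, ← Complex.exp_add, mul_left_comm, ← Complex.exp_add,
      negSq, kinetic]
    congr 2
    ring
  simp only [h1]
  rw [integral_const_mul, integral_cexp_neg_mul_normSq_add_sum hl, mul_assoc,
    mul_left_comm (Complex.exp _), ← Complex.exp_add]
  congr 4
  have h2 : ∑ i, ((f i : ℂ) - 2 * l * s * ζ * κ i) ^ 2 = (‖f‖ ^ 2 : ℝ) -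
      4 * l * s * ζ * (inner ℝ κ f : ℝ) + 4 * l ^ 2 * s ^ 2 * ζ ^ 2 * (‖κ‖ ^ 2 : ℝ) := by
    rw [hin, hno, hno, Finset.mul_sum, Finset.mul_sum, ← Finset.sum_sub_distrib,
      ← Finset.sum_add_distrib]
    exact Finset.sum_congr rfl fun i _ => by ring
  rw [h2]
  field_simp
  ring

/-- The mixed second-order coefficient of `exp (l H*)` for plane waves. -/
def heatKernel (ħ : ℝ) (f κ : E d) (l : ℂ) (p : E d) : ℂ :=
  l ^ 2 * (Complex.exp (-(Complex.I * ħ / 2) * (inner ℝ κ f : ℝ)) *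
      (∫ s in (0 : ℝ)..1, momentumIntegrand l f κ (-(2 * (Complex.I * ħ / 2))) p s) +
    Complex.exp ((Complex.I * ħ / 2) * (inner ℝ κ f : ℝ)) *
      ∫ s in (0 : ℝ)..1, momentumIntegrand l f κ (2 * (Complex.I * ħ / 2)) p s)

theorem hasSum_heatKernel (ħ : ℝ) (q q' κ x p : E d) (l : ℂ) :
    HasSum (fun k : ℕ => l ^ k / (k.factorial : ℂ) *
      powTwo ħ (planeWave q' (-κ)) (planeWave q κ) k (x, p)) (heatKernel ħ (q + q') κ l p) := by
  have hA := hasSum_divDiff₃ (negSq p) (kinetic κ p (-(2 * (Complex.I * ħ / 2)))) l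
  have hB := hasSum_divDiff₃ (negSq p) (kinetic κ p (2 * (Complex.I * ħ / 2))) l
  have h := hasSum_const_mul ((hasSum_const_mul hA
    (Complex.exp (-(Complex.I * ħ / 2) * (inner ℝ κ (q + q') : ℝ)))).add (hasSum_const_mul hB
    (Complex.exp ((Complex.I * ħ / 2) * (inner ℝ κ (q + q') : ℝ)))))
    (Complex.exp ((inner ℝ (q + q') p : ℝ) : ℂ))
  unfold heatKernel
  simp only [momentumIntegrand, intervalIntegral.integral_const_mul]
  convert h using 1
  · funext k
    rw [powTwo_planeWave, xWave]
    simp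
    ring
  · ring

theorem integrable_integral_momentumIntegrand {l : ℂ} (hl : 0 < l.re) (f κ : E d) (ζ : ℂ) :
    Integrable fun p : E d => ∫ s in (0 : ℝ)..1, momentumIntegrand l f κ ζ p s := by
  simp only [intervalIntegral.integral_of_le zero_le_one]
  exact (integrable_momentumIntegrand hl f κ ζ).integral_prod_left

theorem integrable_heatKernel (ħ : ℝ) {l : ℂ} (hl : 0 < l.re) (f κ : E d) :
    Integrable (heatKernel ħ f κ l) :=
  (((integrable_integral_momentumIntegrand hl f κ _).const_mul _).add
    ((integrable_integral_momentumIntegrand hl f κ _).const_mul _)).const_mul _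

theorem integral_integral_momentumIntegrand {l : ℂ} (hl : 0 < l.re) (f κ : E d) (ζ : ℂ) :
    ∫ p : E d, ∫ s in (0 : ℝ)..1, momentumIntegrand l f κ ζ p s =
      ∫ s in (0 : ℝ)..1, (1 - s) * ((Real.pi / l) ^ ((d : ℂ) / 2) *
        Complex.exp ((‖f‖ ^ 2 : ℝ) / (4 * l) - s * ζ * (inner ℝ κ f : ℝ) -
          l * ζ ^ 2 * (‖κ‖ ^ 2 : ℝ) * (s * (1 - s)))) := by
  simp only [intervalIntegral.integral_of_le zero_le_one]
  rw [integral_integral_swap (integrable_momentumIntegrand hl f κ ζ)]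
  simp only [integral_momentumIntegrand hl]

/-- `iħ (κ·f) (1/2 - s) + ħ² κ² s (1 - s) l`. -/
def loopExponent (ħ : ℝ) (f κ : E d) (l : ℂ) (s : ℝ) : ℂ :=
  Complex.I * ħ * (inner ℝ κ f : ℝ) * (1 / 2 - s) + l * ((ħ ^ 2 * ‖κ‖ ^ 2 * (s * (1 - s)) : ℝ) : ℂ)

theorem continuous_loopExponent (ħ : ℝ) (f κ : E d) (l : ℂ) :
    Continuous (loopExponent ħ f κ l) := by
  unfold loopExponent; fun_prop

theorem exp_mul_mul_exp {B c x y u w : ℂ} (h : x + y = u + w) :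
    Complex.exp x * (c * (B * Complex.exp y)) = B * Complex.exp u * (c * Complex.exp w) := by
  have : Complex.exp x * Complex.exp y = Complex.exp u * Complex.exp w := by
    rw [← Complex.exp_add, ← Complex.exp_add, h]
  linear_combination B * c * this

/-- After the Gaussian integral the two orderings have the same exponent up to the reflection `s ↦ 1
- s`. Reflecting one of them gives the weights `s` and `1 - s`, which add up to `1`. -/
theorem integral_heatKernel (ħ : ℝ) {l : ℂ} (hl : 0 < l.re) (f κ : E d) :
    ∫ p, heatKernel ħ f κ l p = l ^ 2 * (Real.pi / l) ^ ((d : ℂ) / 2) *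
      Complex.exp ((‖f‖ ^ 2 : ℝ) / (4 * l)) *
        ∫ s in (0 : ℝ)..1, Complex.exp (loopExponent ħ f κ l s) := by
  unfold heatKernel
  rw [integral_const_mul, integral_add ((integrable_integral_momentumIntegrand hl f κ _).const_mul _)
    ((integrable_integral_momentumIntegrand hl f κ _).const_mul _), integral_const_mul,
    integral_const_mul, integral_integral_momentumIntegrand hl,
    integral_integral_momentumIntegrand hl, mul_assoc (l ^ 2), mul_assoc (l ^ 2)]
  congr 1
  set A : ℂ := (Real.pi / l) ^ ((d : ℂ) / 2) * Complex.exp ((‖f‖ ^ 2 : ℝ) / (4 * l)) with hA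
  have hI : (Complex.I * ħ / 2) ^ 2 = -((ħ : ℂ) ^ 2 / 4) := by
    rw [div_pow, mul_pow, Complex.I_sq]; ring
  have e1 : Complex.exp (-(Complex.I * ħ / 2) * (inner ℝ κ f : ℝ)) * ∫ s in (0 : ℝ)..1,
      (1 - (s : ℂ)) * ((Real.pi / l) ^ ((d : ℂ) / 2) * Complex.exp ((‖f‖ ^ 2 : ℝ) / (4 * l) -
        s * (-(2 * (Complex.I * ħ / 2))) * (inner ℝ κ f : ℝ) -
          l * (-(2 * (Complex.I * ħ / 2))) ^ 2 * (‖κ‖ ^ 2 : ℝ) * (s * (1 - s)))) =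
      A * ∫ s in (0 : ℝ)..1, (s : ℂ) * Complex.exp (loopExponent ħ f κ l s) := by
    have hs := intervalIntegral.integral_comp_sub_left (a := 0) (b := 1)
      (fun s : ℝ => (s : ℂ) * Complex.exp (loopExponent ħ f κ l s)) 1
    rw [sub_self, sub_zero] at hs
    rw [← hs, ← intervalIntegral.integral_const_mul, ← intervalIntegral.integral_const_mul]
    refine intervalIntegral.integral_congr fun s _ => ?_
    rw [hA, Complex.ofReal_sub, Complex.ofReal_one]
    refine exp_mul_mul_exp ?_
    rw [loopExponent, neg_sq, mul_pow, hI]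
    push_cast
    ring
  have e2 : Complex.exp ((Complex.I * ħ / 2) * (inner ℝ κ f : ℝ)) * ∫ s in (0 : ℝ)..1,
      (1 - (s : ℂ)) * ((Real.pi / l) ^ ((d : ℂ) / 2) * Complex.exp ((‖f‖ ^ 2 : ℝ) / (4 * l) -
        s * (2 * (Complex.I * ħ / 2)) * (inner ℝ κ f : ℝ) -
          l * (2 * (Complex.I * ħ / 2)) ^ 2 * (‖κ‖ ^ 2 : ℝ) * (s * (1 - s)))) =
      A * ∫ s in (0 : ℝ)..1, (1 - (s : ℂ)) * Complex.exp (loopExponent ħ f κ l s) := by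
    rw [← intervalIntegral.integral_const_mul, ← intervalIntegral.integral_const_mul]
    refine intervalIntegral.integral_congr fun s _ => ?_
    rw [hA]
    refine exp_mul_mul_exp ?_
    rw [loopExponent, mul_pow, hI]
    push_cast
    ring
  have hc := continuous_loopExponent ħ f κ l
  rw [e1, e2, ← mul_add, ← intervalIntegral.integral_add
    (Continuous.intervalIntegrable (by fun_prop) _ _)
    (Continuous.intervalIntegrable (by fun_prop) _ _)]
  congr 1
  refine intervalIntegral.integral_congr fun s _ => ?_
  ring

/-! ### Oscillatory integrals with slowly decaying amplitude -/

-- Interpolation between `|e^{iτa} - 1| ≤ 2` and `|e^{iτa} - 1| ≤ |τ|a` with exponents `3/4` and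
-- `1/4`. The growth `|τ|^{1/4}` is weaker than the decay `|τ|^{-1/2}` of the amplitude, and
-- `a^{-3/4}` is integrable where `a = A s(1-s)` vanishes.
open MeasureTheory Filter in
theorem norm_cexp_sub_one_le {a : ℝ} (ha : 0 < a) (τ : ℝ) :
    ‖(Complex.exp (Complex.I * (τ * a : ℝ)) - 1) / (Complex.I * a)‖ ≤
      2 * a ^ (-(3 / 4) : ℝ) * (1 + τ ^ 2) ^ (1 / 8 : ℝ) := by
  have h1 : ‖Complex.exp (Complex.I * (τ * a : ℝ)) - 1‖ ≤ |τ| * a := by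
    refine Real.norm_exp_I_mul_ofReal_sub_one_le.trans ?_
    rw [Real.norm_eq_abs, abs_mul, abs_of_pos ha]
  have h2 : ‖Complex.exp (Complex.I * (τ * a : ℝ)) - 1‖ ≤ 2 := by
    refine (norm_sub_le _ _).trans ?_
    rw [mul_comm Complex.I, Complex.norm_exp_ofReal_mul_I]
    norm_num
  set y := ‖Complex.exp (Complex.I * (τ * a : ℝ)) - 1‖
  have hy : 0 ≤ y := norm_nonneg _
  have h3 : y = y ^ (3 / 4 : ℝ) * y ^ (1 / 4 : ℝ) := by
    rw [← Real.rpow_add_of_nonneg hy (by norm_num) (by norm_num)]; norm_num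
  have h4 : y ^ (3 / 4 : ℝ) ≤ 2 := by
    calc y ^ (3 / 4 : ℝ) ≤ 2 ^ (3 / 4 : ℝ) := Real.rpow_le_rpow hy h2 (by norm_num)
      _ ≤ 2 ^ (1 : ℝ) := Real.rpow_le_rpow_of_exponent_le (by norm_num) (by norm_num)
      _ = 2 := Real.rpow_one 2
  have h5 : |τ| ^ (1 / 4 : ℝ) ≤ (1 + τ ^ 2) ^ (1 / 8 : ℝ) := by
    have : |τ| ^ (1 / 4 : ℝ) = (τ ^ 2) ^ (1 / 8 : ℝ) := by
      rw [← sq_abs, ← Real.rpow_natCast, ← Real.rpow_mul (abs_nonneg τ)]; norm_num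
    rw [this]
    exact Real.rpow_le_rpow (sq_nonneg τ) (by linarith) (by norm_num)
  have h6 : y ^ (1 / 4 : ℝ) ≤ (1 + τ ^ 2) ^ (1 / 8 : ℝ) * a ^ (1 / 4 : ℝ) := by
    calc y ^ (1 / 4 : ℝ) ≤ (|τ| * a) ^ (1 / 4 : ℝ) := Real.rpow_le_rpow hy h1 (by norm_num)
      _ = |τ| ^ (1 / 4 : ℝ) * a ^ (1 / 4 : ℝ) := Real.mul_rpow (abs_nonneg τ) ha.le
      _ ≤ _ := by gcongr
  have h7 : a ^ (1 / 4 : ℝ) = a ^ (-(3 / 4) : ℝ) * a := by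
    nth_rewrite 3 [← Real.rpow_one a]
    rw [← Real.rpow_add ha]; norm_num
  rw [norm_div, norm_mul, Complex.norm_I, one_mul, Complex.norm_real, Real.norm_of_nonneg ha.le,
    div_le_iff₀ ha]
  calc y = y ^ (3 / 4 : ℝ) * y ^ (1 / 4 : ℝ) := h3
    _ ≤ 2 * ((1 + τ ^ 2) ^ (1 / 8 : ℝ) * a ^ (1 / 4 : ℝ)) := by gcongr
    _ = _ := by rw [h7]; ring

/-- The constant `b` of the antiderivative is left free: `b = 1` gives estimates good for small `a`,
and `b = 0` gives the limit `T → ∞`. -/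
theorem hasDerivAt_cexp_div {a : ℝ} (ha : a ≠ 0) (b : ℂ) (τ : ℝ) :
    HasDerivAt (fun τ : ℝ => (Complex.exp (Complex.I * (τ * a : ℝ)) - b) / (Complex.I * a))
      (Complex.exp (Complex.I * (τ * a : ℝ))) τ := by
  have h1 : HasDerivAt (fun τ : ℝ => Complex.I * ((τ * a : ℝ) : ℂ)) (Complex.I * ((1 * a : ℝ) : ℂ)) τ :=
    (((hasDerivAt_id τ).mul_const a).ofReal_comp).const_mul _
  have h2 := (h1.cexp.sub_const b).div_const (Complex.I * a)
  have : (a : ℂ) ≠ 0 := by exact_mod_cast ha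
  rwa [one_mul, mul_div_cancel_right₀ _ (mul_ne_zero Complex.I_ne_zero this)] at h2

theorem integrable_one_add_sq_rpow {p : ℝ} (hp : p < -(1 / 2)) :
    MeasureTheory.Integrable fun τ : ℝ => (1 + τ ^ 2) ^ p := by
  have h := integrable_rpow_neg_one_add_norm_sq (E := ℝ) (μ := MeasureTheory.volume) (r := -2 * p)
    (by simp; linarith)
  refine h.congr (Filter.Eventually.of_forall fun τ => ?_)
  simp only [Real.norm_eq_abs, sq_abs]
  congr 1
  ring

/-- A continuously differentiable amplitude of order `-1/2` whose derivative has order `-3/2`. -/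
structure IsAmplitude (C : ℝ) (g g' : ℝ → ℂ) : Prop where
  hasDerivAt : ∀ τ, HasDerivAt g (g' τ) τ
  continuous_deriv : Continuous g'
  norm_le : ∀ τ, ‖g τ‖ ≤ C * (1 + τ ^ 2) ^ (-(1 / 4) : ℝ)
  norm_deriv_le : ∀ τ, ‖g' τ‖ ≤ C * (1 + τ ^ 2) ^ (-(3 / 4) : ℝ)

namespace IsAmplitude

variable {C : ℝ} {g g' : ℝ → ℂ}

theorem nonneg (h : IsAmplitude C g g') : 0 ≤ C := by
  have := (norm_nonneg _).trans (h.norm_le 0)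
  simpa using this

theorem integral_eq (h : IsAmplitude C g g') {a : ℝ} (ha : a ≠ 0) (b : ℂ) (S T : ℝ) :
    ∫ τ in S..T, g τ * Complex.exp (Complex.I * (τ * a : ℝ)) =
      g T * ((Complex.exp (Complex.I * (T * a : ℝ)) - b) / (Complex.I * a)) -
      g S * ((Complex.exp (Complex.I * (S * a : ℝ)) - b) / (Complex.I * a)) -
      ∫ τ in S..T, g' τ * ((Complex.exp (Complex.I * (τ * a : ℝ)) - b) / (Complex.I * a)) :=
  intervalIntegral.integral_mul_deriv_eq_deriv_mul (fun τ _ => h.hasDerivAt τ)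
    (fun τ _ => hasDerivAt_cexp_div ha b τ) (h.continuous_deriv.intervalIntegrable _ _)
    ((by fun_prop : Continuous fun τ : ℝ =>
      Complex.exp (Complex.I * (τ * a : ℝ))).intervalIntegrable _ _)

/-- Integration by parts with `b = 1`. The amplitude need not be integrable, but its derivative,
even multiplied by `|τ|^{1/4}`, is of order `-5/4`. The bound is uniform in `T`, as dominated
convergence in `s` requires. -/
theorem norm_integral_le (h : IsAmplitude C g g') {a : ℝ} (ha : 0 < a) {T : ℝ} (hT : 0 ≤ T) :
    ‖∫ τ in (-T)..T, g τ * Complex.exp (Complex.I * (τ * a : ℝ))‖ ≤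
      C * (4 + 2 * ∫ τ : ℝ, (1 + τ ^ 2) ^ (-(5 / 8) : ℝ)) * a ^ (-(3 / 4) : ℝ) := by
  set A := a ^ (-(3 / 4) : ℝ)
  have hA : 0 ≤ A := by positivity
  have hC := h.nonneg
  have hone : ∀ τ : ℝ, 1 ≤ 1 + τ ^ 2 := fun τ => by nlinarith
  have hbd : ∀ τ : ℝ,
      ‖g τ * ((Complex.exp (Complex.I * (τ * a : ℝ)) - 1) / (Complex.I * a))‖ ≤ 2 * C * A := by
    intro τ
    rw [norm_mul]
    calc _ ≤ (C * (1 + τ ^ 2) ^ (-(1 / 4) : ℝ)) * (2 * A * (1 + τ ^ 2) ^ (1 / 8 : ℝ)) :=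
          mul_le_mul (h.norm_le τ) (norm_cexp_sub_one_le ha τ) (norm_nonneg _) (by positivity)
      _ = 2 * C * A * ((1 + τ ^ 2) ^ (-(1 / 4) : ℝ) * (1 + τ ^ 2) ^ (1 / 8 : ℝ)) := by ring
      _ = 2 * C * A * (1 + τ ^ 2) ^ (-(1 / 8) : ℝ) := by
          rw [← Real.rpow_add (by positivity)]; norm_num
      _ ≤ 2 * C * A * 1 := by
          gcongr
          exact Real.rpow_le_one_of_one_le_of_nonpos (hone τ) (by norm_num)
      _ = _ := mul_one _
  have hint := integrable_one_add_sq_rpow (p := -(5 / 8)) (by norm_num)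
  have hbd' : ‖∫ τ in (-T)..T, g' τ * ((Complex.exp (Complex.I * (τ * a : ℝ)) - 1) /
      (Complex.I * a))‖ ≤ 2 * C * A * ∫ τ : ℝ, (1 + τ ^ 2) ^ (-(5 / 8) : ℝ) := by
    calc _ ≤ ∫ τ in (-T)..T, 2 * C * A * (1 + τ ^ 2) ^ (-(5 / 8) : ℝ) := by
          refine intervalIntegral.norm_integral_le_of_norm_le (by linarith)
            (Filter.Eventually.of_forall fun τ _ => ?_) ((hint.const_mul _).intervalIntegrable)
          rw [norm_mul]
          calc _ ≤ (C * (1 + τ ^ 2) ^ (-(3 / 4) : ℝ)) * (2 * A * (1 + τ ^ 2) ^ (1 / 8 : ℝ)) :=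
                mul_le_mul (h.norm_deriv_le τ) (norm_cexp_sub_one_le ha τ) (norm_nonneg _)
                  (by positivity)
            _ = 2 * C * A * ((1 + τ ^ 2) ^ (-(3 / 4) : ℝ) * (1 + τ ^ 2) ^ (1 / 8 : ℝ)) := by ring
            _ = 2 * C * A * (1 + τ ^ 2) ^ (-(5 / 8) : ℝ) := by
                rw [← Real.rpow_add (by positivity)]; norm_num
      _ ≤ _ := by
          rw [intervalIntegral.integral_const_mul, intervalIntegral.integral_of_le (by linarith)]
          exact mul_le_mul_of_nonneg_left (MeasureTheory.setIntegral_le_integral hint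
            (Filter.Eventually.of_forall fun τ => by positivity)) (by positivity)
  rw [h.integral_eq ha.ne' 1]
  calc _ ≤ 2 * C * A + 2 * C * A + 2 * C * A * ∫ τ : ℝ, (1 + τ ^ 2) ^ (-(5 / 8) : ℝ) :=
        (norm_sub_le _ _).trans (add_le_add ((norm_sub_le _ _).trans
          (add_le_add (hbd T) (hbd (-T)))) hbd')
    _ = _ := by ring

theorem integrable_deriv (h : IsAmplitude C g g') : MeasureTheory.Integrable g' :=
  ((integrable_one_add_sq_rpow (p := -(3 / 4)) (by norm_num)).const_mul C).mono'
    h.continuous_deriv.aestronglyMeasurable (Filter.Eventually.of_forall h.norm_deriv_le)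

theorem norm_cexp_mul (a τ : ℝ) : ‖Complex.exp (Complex.I * (τ * a : ℝ))‖ = 1 := by
  rw [mul_comm Complex.I, Complex.norm_exp_ofReal_mul_I]

/-- Integration by parts with `b = 0`: the boundary terms decay with the amplitude, and the
remaining integral converges absolutely. -/
theorem tendsto_integral (h : IsAmplitude C g g') {a : ℝ} (ha : 0 < a) :
    Filter.Tendsto (fun T : ℝ => ∫ τ in (-T)..T, g τ * Complex.exp (Complex.I * (τ * a : ℝ)))
      Filter.atTop
      (nhds (Complex.I / a * ∫ τ : ℝ, g' τ * Complex.exp (Complex.I * (τ * a : ℝ)))) := by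
  have hC := h.nonneg
  have ha' : (a : ℂ) ≠ 0 := by exact_mod_cast ha.ne'
  have hdecay : Filter.Tendsto (fun T : ℝ => C * (1 + T ^ 2) ^ (-(1 / 4) : ℝ) * a⁻¹) Filter.atTop
      (nhds 0) := by
    have h1 : Filter.Tendsto (fun T : ℝ => 1 + T ^ 2) Filter.atTop Filter.atTop :=
      Filter.tendsto_atTop_add_const_left _ _ (Filter.tendsto_pow_atTop two_ne_zero)
    have h2 := (tendsto_rpow_neg_atTop (y := 1 / 4) (by norm_num)).comp h1
    simpa using (h2.const_mul C).mul_const a⁻¹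
  have hE : ∀ τ : ℝ, ‖(Complex.exp (Complex.I * (τ * a : ℝ)) - 0) / (Complex.I * a)‖ = a⁻¹ := by
    intro τ
    rw [sub_zero, norm_div, norm_cexp_mul, norm_mul, Complex.norm_I, one_mul, Complex.norm_real,
      Real.norm_of_nonneg ha.le, one_div]
  have hB : Filter.Tendsto (fun T : ℝ =>
      g T * ((Complex.exp (Complex.I * (T * a : ℝ)) - 0) / (Complex.I * a))) Filter.atTop
      (nhds 0) := by
    refine squeeze_zero_norm (fun T => ?_) hdecay
    rw [norm_mul, hE]
    gcongr
    exact h.norm_le T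
  have hB' : Filter.Tendsto (fun T : ℝ =>
      g (-T) * ((Complex.exp (Complex.I * ((-T) * a : ℝ)) - 0) / (Complex.I * a))) Filter.atTop
      (nhds 0) := by
    refine squeeze_zero_norm (fun T => ?_) hdecay
    rw [norm_mul, hE]
    gcongr
    simpa using h.norm_le (-T)
  have hI : MeasureTheory.Integrable fun τ : ℝ =>
      g' τ * ((Complex.exp (Complex.I * (τ * a : ℝ)) - 0) / (Complex.I * a)) := by
    refine h.integrable_deriv.mul_bdd (c := a⁻¹) (Continuous.aestronglyMeasurable (by fun_prop))
      (Filter.Eventually.of_forall fun τ => (hE τ).le)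
  have hlim := MeasureTheory.intervalIntegral_tendsto_integral hI
    (Filter.tendsto_neg_atTop_atBot (G := ℝ)) Filter.tendsto_id
  have := (hB.sub hB').sub hlim
  refine (this.congr fun T => (h.integral_eq ha.ne' 0 (-T) T).symm).trans (le_of_eq ?_)
  congr 1
  rw [sub_zero, zero_sub, ← MeasureTheory.integral_const_mul, ← MeasureTheory.integral_neg]
  refine MeasureTheory.integral_congr_ae (Filter.Eventually.of_forall fun τ => ?_)
  field_simp
  simp only [Complex.I_sq]
  ring

end IsAmplitude

/-! ### Laplace transforms of powers and their inversion -/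

theorem integrableOn_rpow_mul_exp {b : ℝ} (hb : 0 < b) {c : ℝ} (hc : 0 < c) :
    MeasureTheory.IntegrableOn (fun t : ℝ => t ^ (b - 1) * Real.exp (-(c * t))) (Set.Ioi 0) := by
  have := integrableOn_rpow_mul_exp_neg_mul_rpow (s := b - 1) (p := 1) (by linarith) one_pos hc
  simpa using this

-- Both sides are analytic in the right half-plane and agree on the positive reals, so the identity
-- theorem applies. The left side is analytic as the complex moment generating function of the
-- measure `t^{b-1} dt` on `(0, ∞)`.
open MeasureTheory ProbabilityTheory in
theorem integral_rpow_mul_cexp {b : ℝ} (hb : 0 < b) {l : ℂ} (hl : 0 < l.re) :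
    ∫ t in Set.Ioi (0 : ℝ), ((t ^ (b - 1) : ℝ) : ℂ) * Complex.exp (-(l * t)) =
      Real.Gamma b * l ^ (-(b : ℂ)) := by
  set μ : Measure ℝ := (volume.restrict (Set.Ioi 0)).withDensity
    fun t : ℝ => ((t ^ (b - 1)).toNNReal : ENNReal) with hμ
  have hmeas : Measurable fun t : ℝ => (t ^ (b - 1)).toNNReal := by fun_prop
  have hmgf : ∀ z, complexMGF id μ z =
      ∫ t in Set.Ioi (0 : ℝ), ((t ^ (b - 1) : ℝ) : ℂ) * Complex.exp (z * t) := by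
    intro z
    rw [complexMGF, hμ, integral_withDensity_eq_integral_smul hmeas]
    refine setIntegral_congr_fun measurableSet_Ioi fun t ht => ?_
    have h0 : 0 ≤ t ^ (b - 1) := Real.rpow_nonneg (le_of_lt ht) _
    simp [NNReal.smul_def, Real.coe_toNNReal _ h0]
  have hset : Set.Iio 0 ⊆ integrableExpSet id μ := by
    intro t ht
    change Integrable (fun ω : ℝ => Real.exp (t * ω)) μ
    rw [hμ, integrable_withDensity_iff_integrable_smul hmeas]
    refine (integrableOn_rpow_mul_exp hb (neg_pos.mpr ht)).congr ?_
    refine (ae_restrict_iff' measurableSet_Ioi).mpr (Filter.Eventually.of_forall fun x hx => ?_)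
    have h0 : 0 ≤ x ^ (b - 1) := Real.rpow_nonneg (le_of_lt hx) _
    simp [NNReal.smul_def, Real.coe_toNNReal _ h0]
  set U : Set ℂ := {z | 0 < z.re} with hU
  have hUo : IsOpen U := isOpen_lt continuous_const Complex.continuous_re
  have hf : AnalyticOnNhd ℂ (fun z => complexMGF id μ (-z)) U := by
    refine DifferentiableOn.analyticOnNhd ?_ hUo
    refine differentiableOn_complexMGF.comp (differentiableOn_neg U) fun z hz => ?_
    refine mem_interior.mpr ⟨Set.Iio 0, hset, isOpen_Iio, ?_⟩
    simpa [hU] using hz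
  have hg : AnalyticOnNhd ℂ (fun z : ℂ => Real.Gamma b * z ^ (-(b : ℂ))) U := by
    refine DifferentiableOn.analyticOnNhd (fun z hz => ?_) hUo
    refine DifferentiableAt.differentiableWithinAt ?_
    exact (((hasDerivAt_id z).cpow_const (Or.inl hz)).differentiableAt).const_mul _
  -- The real points `1 + 1/(n+1)` accumulate at `1` without being equal to it.
  have hfreq : ∃ᶠ z in nhdsWithin (1 : ℂ) {1}ᶜ,
      complexMGF id μ (-z) = Real.Gamma b * z ^ (-(b : ℂ)) := by
    have hreal : ∀ r : ℝ, 0 < r →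
        complexMGF id μ (-(r : ℂ)) = Real.Gamma b * (r : ℂ) ^ (-(b : ℂ)) := by
      intro r hr
      have h := Real.integral_rpow_mul_exp_neg_mul_Ioi hb hr
      rw [hmgf, Complex.cpow_neg, ← Complex.ofReal_cpow hr.le, ← Complex.ofReal_inv,
        ← Complex.ofReal_mul, ← Real.inv_rpow hr.le, mul_comm, ← one_div, ← h, ← integral_complex_ofReal]
      refine setIntegral_congr_fun measurableSet_Ioi fun t _ => ?_
      push_cast
      ring_nf
    have htend : Filter.Tendsto (fun n : ℕ => ((1 + 1 / ((n : ℝ) + 1) : ℝ) : ℂ)) Filter.atTop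
        (nhdsWithin (1 : ℂ) {1}ᶜ) := by
      refine tendsto_nhdsWithin_iff.mpr ⟨?_, Filter.Eventually.of_forall fun n => ?_⟩
      · have h := (tendsto_one_div_add_atTop_nhds_zero_nat (𝕜 := ℝ)).const_add 1
        have := (Complex.continuous_ofReal.tendsto _).comp h
        simpa [Function.comp_def] using this
      · have : (0 : ℝ) < 1 / ((n : ℝ) + 1) := by positivity
        simp only [Set.mem_compl_iff, Set.mem_singleton_iff]
        intro h
        have h' : (1 + 1 / ((n : ℝ) + 1) : ℝ) = 1 := by exact_mod_cast h
        linarith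
    exact htend.frequently (Filter.Frequently.of_forall fun n => hreal _ (by positivity))
  have hpre : IsPreconnected U := (convex_halfSpace_re_gt 0).isPreconnected
  have := hf.eqOn_of_preconnected_of_frequently_eq hg hpre (by simp [hU] : (1 : ℂ) ∈ U) hfreq hl
  have h2 := hmgf (-l)
  simp only at this
  rw [this] at h2
  rw [h2]
  simp

theorem re_add_mul_I (c τ : ℝ) : ((c : ℂ) + τ * Complex.I).re = c := by simp

theorem norm_add_mul_I (c τ : ℝ) : ‖(c : ℂ) + τ * Complex.I‖ = (c ^ 2 + τ ^ 2) ^ (1 / 2 : ℝ) := by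
  rw [Complex.norm_add_mul_I, Real.sqrt_eq_rpow]

theorem norm_vertical_cpow_le {c : ℝ} (hc : 0 < c) {b : ℝ} (hb : b ≤ 0) (τ : ℝ) :
    ‖((c : ℂ) + τ * Complex.I) ^ (b : ℂ)‖ ≤ (min c 1) ^ b * (1 + τ ^ 2) ^ (b / 2) := by
  have hm : 0 < min c 1 := lt_min hc one_pos
  rw [Complex.norm_cpow_real, norm_add_mul_I, ← Real.rpow_mul (by positivity)]
  have h1 : (min c 1) ^ b = ((min c 1) ^ 2) ^ (b / 2) := by
    rw [← Real.rpow_natCast, ← Real.rpow_mul hm.le]; congr 1; push_cast; ring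
  rw [h1, ← Real.mul_rpow (by positivity) (by positivity), one_div_mul_eq_div]
  refine Real.rpow_le_rpow_of_nonpos (by positivity) ?_ (by linarith)
  have h2 : (min c 1) ^ 2 ≤ c ^ 2 := pow_le_pow_left₀ hm.le (min_le_left _ _) 2
  have h3 : (min c 1) ^ 2 ≤ 1 := by
    simpa using pow_le_pow_left₀ hm.le (min_le_right c 1) 2
  nlinarith [sq_nonneg τ]

theorem norm_vertical_cpow_le_rpow {c : ℝ} (hc : 0 < c) {b : ℝ} (hb : b ≤ 0) (τ : ℝ) :
    ‖((c : ℂ) + τ * Complex.I) ^ (b : ℂ)‖ ≤ c ^ b := by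
  rw [Complex.norm_cpow_real]
  refine Real.rpow_le_rpow_of_nonpos hc ?_ hb
  exact (le_abs_self c).trans (by simpa using Complex.abs_re_le_norm ((c : ℂ) + τ * Complex.I))

theorem vertical_mem_slitPlane {c : ℝ} (hc : 0 < c) (τ : ℝ) :
    (c : ℂ) + τ * Complex.I ∈ Complex.slitPlane :=
  Or.inl (by simpa using hc)

theorem continuous_vertical_cpow {c : ℝ} (hc : 0 < c) (b : ℂ) :
    Continuous fun τ : ℝ => ((c : ℂ) + τ * Complex.I) ^ b :=
  (by fun_prop : Continuous fun τ : ℝ => (c : ℂ) + τ * Complex.I).cpow continuous_const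
    (vertical_mem_slitPlane hc)

theorem integrable_vertical_cpow {c : ℝ} (hc : 0 < c) {b : ℝ} (hb : 1 < b) :
    MeasureTheory.Integrable fun τ : ℝ => ((c : ℂ) + τ * Complex.I) ^ (-(b : ℂ)) := by
  refine ((integrable_one_add_sq_rpow (p := -b / 2) (by linarith)).const_mul
    ((min c 1) ^ (-b))).mono' (continuous_vertical_cpow hc _).aestronglyMeasurable
    (Filter.Eventually.of_forall fun τ => ?_)
  have := norm_vertical_cpow_le hc (b := -b) (by linarith) τ
  simpa using this

-- Fourier inversion for `t^{b-1} e^{-ct}` on `t > 0`, whose transform is `Γ(b)(c + 2πiw)^{-b}`. The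
-- condition `b > 1` makes the transform integrable.
open MeasureTheory in
theorem integral_vertical_cpow {c : ℝ} (hc : 0 < c) {b : ℝ} (hb : 1 < b) {a : ℝ} (ha : 0 < a) :
    ∫ τ : ℝ, ((c : ℂ) + τ * Complex.I) ^ (-(b : ℂ)) * Complex.exp (Complex.I * (τ * a : ℝ)) =
      ((2 * Real.pi * (a ^ (b - 1) / Real.Gamma b) * Real.exp (-(c * a)) : ℝ) : ℂ) := by
  have hΓ : Real.Gamma b ≠ 0 := (Real.Gamma_pos_of_pos (by linarith)).ne'
  set u : ℝ → ℂ := (Set.Ioi 0).indicator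
    fun t : ℝ => ((t ^ (b - 1) * Real.exp (-(c * t)) : ℝ) : ℂ) with hu
  have hui : Integrable u := by
    rw [hu, integrable_indicator_iff measurableSet_Ioi]
    exact (integrableOn_rpow_mul_exp (by linarith) hc).ofReal
  have hF : ∀ w : ℝ, 𝓕 u w =
      Real.Gamma b * ((c : ℂ) + (2 * Real.pi * w : ℝ) * Complex.I) ^ (-(b : ℂ)) := by
    intro w
    rw [Real.fourier_eq', ← integral_rpow_mul_cexp (by linarith)
      (by rw [re_add_mul_I]; exact hc), ← integral_indicator measurableSet_Ioi]
    refine integral_congr_ae (Filter.Eventually.of_forall fun t => ?_)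
    by_cases ht : t ∈ Set.Ioi (0 : ℝ)
    · simp only [hu, Set.indicator_of_mem ht, smul_eq_mul]
      push_cast
      rw [mul_left_comm, ← Complex.exp_add]
      congr 2
      simp
      ring
    · simp [hu, Set.indicator_of_notMem ht]
  have hFi : Integrable (𝓕 u) := by
    have h1 := (integrable_vertical_cpow hc hb).comp_mul_left' (R := 2 * Real.pi) (by positivity)
    exact (h1.const_mul (Real.Gamma b : ℂ)).congr
      (Filter.Eventually.of_forall fun w => (hF w).symm)
  have hcont : ContinuousAt u a := by
    have h1 : ContinuousAt (fun t : ℝ => ((t ^ (b - 1) * Real.exp (-(c * t)) : ℝ) : ℂ)) a := by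
      have : ContinuousAt (fun t : ℝ => t ^ (b - 1)) a :=
        Real.continuousAt_rpow_const _ _ (Or.inl ha.ne')
      exact Complex.continuous_ofReal.continuousAt.comp (this.mul (by fun_prop))
    refine h1.congr ?_
    filter_upwards [Ioi_mem_nhds ha] with t ht
    rw [hu, Set.indicator_of_mem ht]
  have hinv := hui.fourierInv_fourier_eq hFi hcont
  rw [Real.fourierInv_eq', hu, Set.indicator_of_mem (show a ∈ Set.Ioi (0 : ℝ) from ha)] at hinv
  have hsub := Measure.integral_comp_mul_left (fun τ : ℝ => ((c : ℂ) + τ * Complex.I) ^ (-(b : ℂ)) *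
    Complex.exp (Complex.I * (τ * a : ℝ))) (2 * Real.pi)
  have h2 : ∫ w : ℝ, Complex.exp (((2 * Real.pi * inner ℝ w a : ℝ) : ℂ) * Complex.I) • 𝓕 u w =
      Real.Gamma b * ∫ w : ℝ, ((c : ℂ) + (2 * Real.pi * w : ℝ) * Complex.I) ^ (-(b : ℂ)) *
        Complex.exp (Complex.I * ((2 * Real.pi * w) * a : ℝ)) := by
    rw [← integral_const_mul]
    refine integral_congr_ae (Filter.Eventually.of_forall fun w => ?_)
    simp only [hF, smul_eq_mul]
    rw [mul_comm, mul_assoc]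
    congr 3
    simp
    ring
  rw [h2, hsub, abs_of_pos (by positivity)] at hinv
  have hπ : (Real.pi : ℂ) ≠ 0 := by exact_mod_cast Real.pi_ne_zero
  have hΓ' : (Real.Gamma b : ℂ) ≠ 0 := by exact_mod_cast hΓ
  rw [Complex.real_smul] at hinv
  push_cast at hinv ⊢
  generalize (∫ y : ℝ, ((c : ℂ) + y * Complex.I) ^ (-(b : ℂ)) *
    Complex.exp (Complex.I * (y * a))) = J at hinv ⊢
  field_simp at hinv ⊢
  linear_combination hinv

/-- `l^{-β} e^{F/l}` on the vertical line `l = c + iτ`. -/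
def verticalAmp (c β F : ℝ) (τ : ℝ) : ℂ :=
  ((c : ℂ) + τ * Complex.I) ^ (-(β : ℂ)) * Complex.exp (F / ((c : ℂ) + τ * Complex.I))

/-- The derivative of `verticalAmp`. -/
def verticalAmpDeriv (c β F : ℝ) (τ : ℝ) : ℂ :=
  -Complex.I * ((β * ((c : ℂ) + τ * Complex.I) ^ (-((β + 1 : ℝ) : ℂ)) +
    F * ((c : ℂ) + τ * Complex.I) ^ (-((β + 2 : ℝ) : ℂ))) *
      Complex.exp (F / ((c : ℂ) + τ * Complex.I)))

theorem add_mul_I_ne_zero {c : ℝ} (hc : 0 < c) (τ : ℝ) : (c : ℂ) + τ * Complex.I ≠ 0 :=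
  Complex.slitPlane_ne_zero (vertical_mem_slitPlane hc τ)

theorem hasDerivAt_verticalAmp {c : ℝ} (hc : 0 < c) (β F τ : ℝ) :
    HasDerivAt (verticalAmp c β F) (verticalAmpDeriv c β F τ) τ := by
  have hl := vertical_mem_slitPlane hc τ
  have hl0 := add_mul_I_ne_zero hc τ
  have h1 : HasDerivAt (fun τ : ℝ => (c : ℂ) + τ * Complex.I) Complex.I τ := by
    simpa using ((Complex.ofRealCLM.hasDerivAt (x := τ)).mul_const Complex.I).const_add (c : ℂ)
  have h2 : HasDerivAt (fun l : ℂ => l ^ (-(β : ℂ)) * Complex.exp (F / l))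
      ((-(β : ℂ) * ((c : ℂ) + τ * Complex.I) ^ (-(β : ℂ) - 1) * 1) *
          Complex.exp (F / ((c : ℂ) + τ * Complex.I)) +
        ((c : ℂ) + τ * Complex.I) ^ (-(β : ℂ)) *
          (Complex.exp (F / ((c : ℂ) + τ * Complex.I)) *
            (F * (-1 / ((c : ℂ) + τ * Complex.I) ^ 2)))) ((c : ℂ) + τ * Complex.I) := by
    have h0 : HasDerivAt (fun l : ℂ => (F : ℂ) / l) (F * (-1 / ((c : ℂ) + τ * Complex.I) ^ 2))
        ((c : ℂ) + τ * Complex.I) := by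
      simp only [div_eq_mul_inv (F : ℂ)]
      refine ((hasDerivAt_inv hl0).const_mul (F : ℂ)).congr_deriv ?_
      ring
    exact ((hasDerivAt_id _).cpow_const hl).mul h0.cexp
  have h3 := h2.comp τ h1
  refine h3.congr_deriv ?_
  rw [verticalAmpDeriv]
  have e1 : -((β + 1 : ℝ) : ℂ) = -(β : ℂ) - 1 := by push_cast; ring
  have e2 : -((β + 2 : ℝ) : ℂ) = -(β : ℂ) - 2 := by push_cast; ring
  rw [e1, e2, Complex.cpow_sub (-(β : ℂ)) 2 hl0, Complex.cpow_ofNat]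
  ring

theorem continuous_verticalAmp {c : ℝ} (hc : 0 < c) (β F : ℝ) :
    Continuous (verticalAmp c β F) :=
  continuous_iff_continuousAt.mpr fun τ => (hasDerivAt_verticalAmp hc β F τ).continuousAt

theorem continuous_exp_div_vertical {c : ℝ} (hc : 0 < c) (F : ℝ) :
    Continuous fun τ : ℝ => Complex.exp (F / ((c : ℂ) + τ * Complex.I)) :=
  Complex.continuous_exp.comp (continuous_const.div (by fun_prop) (add_mul_I_ne_zero hc))

theorem continuous_verticalAmpDeriv {c : ℝ} (hc : 0 < c) (β F : ℝ) :
    Continuous (verticalAmpDeriv c β F) :=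
  continuous_const.mul (((continuous_const.mul (continuous_vertical_cpow hc _)).add
    (continuous_const.mul (continuous_vertical_cpow hc _))).mul (continuous_exp_div_vertical hc F))

theorem norm_exp_div_le {c : ℝ} (hc : 0 < c) {F : ℝ} (hF : 0 ≤ F) (τ : ℝ) :
    ‖Complex.exp (F / ((c : ℂ) + τ * Complex.I))‖ ≤ Real.exp (F / c) := by
  refine (Complex.norm_exp_le_exp_norm _).trans (Real.exp_le_exp.mpr ?_)
  rw [norm_div, Complex.norm_real, Real.norm_of_nonneg hF]
  refine div_le_div_of_nonneg_left hF hc ?_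
  exact (le_abs_self c).trans (by simpa using Complex.abs_re_le_norm ((c : ℂ) + τ * Complex.I))

theorem norm_vertical_cpow_neg_le {c : ℝ} (hc : 0 < c) {b r : ℝ} (hr : 0 ≤ r) (hb : 2 * r ≤ b)
    (τ : ℝ) : ‖((c : ℂ) + τ * Complex.I) ^ (-(b : ℂ))‖ ≤ (min c 1) ^ (-b) * (1 + τ ^ 2) ^ (-r) := by
  have h := norm_vertical_cpow_le hc (b := -b) (by linarith) τ
  rw [Complex.ofReal_neg] at h
  refine h.trans ?_
  have hm : 0 < min c 1 := lt_min hc one_pos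
  gcongr
  · nlinarith [sq_nonneg τ]
  · linarith

/-- For `β = d/2 - 1` the condition `1/2 ≤ β` is `3 ≤ d`. The constant adds up the bounds for the
powers `-β`, `-β-1`, `-β-2` of `l`, with `e^{F/l}` bounded by `e^{F/c}`. -/
theorem exists_isAmplitude {c : ℝ} (hc : 0 < c) {β : ℝ} (hβ : 1 / 2 ≤ β) {F : ℝ} (hF : 0 ≤ F) :
    ∃ C, IsAmplitude C (verticalAmp c β F) (verticalAmpDeriv c β F) := by
  set m := min c 1
  have hm : 0 < m := lt_min hc one_pos
  set e := Real.exp (F / c)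
  have he : 0 < e := Real.exp_pos _
  refine ⟨(m ^ (-β) + β * m ^ (-(β + 1)) + F * m ^ (-(β + 2))) * e,
    hasDerivAt_verticalAmp hc β F, continuous_verticalAmpDeriv hc β F, fun τ => ?_, fun τ => ?_⟩
  · have h1 := norm_vertical_cpow_neg_le hc (b := β) (r := 1 / 4) (by norm_num) (by linarith) τ
    rw [verticalAmp, norm_mul]
    calc _ ≤ (m ^ (-β) * (1 + τ ^ 2) ^ (-(1 / 4) : ℝ)) * e :=
          mul_le_mul h1 (norm_exp_div_le hc hF τ) (norm_nonneg _) (by positivity)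
      _ = m ^ (-β) * e * (1 + τ ^ 2) ^ (-(1 / 4) : ℝ) := by ring
      _ ≤ _ := by
          gcongr
          have : 0 ≤ β * m ^ (-(β + 1)) := mul_nonneg (by linarith) (by positivity)
          have : 0 ≤ F * m ^ (-(β + 2)) := by positivity
          linarith
  · have h1 := norm_vertical_cpow_neg_le hc (b := β + 1) (r := 3 / 4) (by norm_num)
      (by linarith) τ
    have h2 := norm_vertical_cpow_neg_le hc (b := β + 2) (r := 3 / 4) (by norm_num)
      (by linarith) τ
    rw [verticalAmpDeriv, norm_mul, norm_neg, Complex.norm_I, one_mul, norm_mul]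
    have h3 : ‖(β : ℂ) * ((c : ℂ) + τ * Complex.I) ^ (-((β + 1 : ℝ) : ℂ)) +
        F * ((c : ℂ) + τ * Complex.I) ^ (-((β + 2 : ℝ) : ℂ))‖ ≤
        β * (m ^ (-(β + 1)) * (1 + τ ^ 2) ^ (-(3 / 4) : ℝ)) +
          F * (m ^ (-(β + 2)) * (1 + τ ^ 2) ^ (-(3 / 4) : ℝ)) := by
      refine (norm_add_le _ _).trans ?_
      rw [norm_mul, norm_mul, Complex.norm_real, Complex.norm_real, Real.norm_of_nonneg hF,
        Real.norm_of_nonneg (by linarith : 0 ≤ β)]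
      have : 0 ≤ β := by linarith
      gcongr
    have hβ0 : 0 ≤ β := by linarith
    calc _ ≤ (β * (m ^ (-(β + 1)) * (1 + τ ^ 2) ^ (-(3 / 4) : ℝ)) +
          F * (m ^ (-(β + 2)) * (1 + τ ^ 2) ^ (-(3 / 4) : ℝ))) * e :=
          mul_le_mul h3 (norm_exp_div_le hc hF τ) (norm_nonneg _) (by positivity)
      _ = (β * m ^ (-(β + 1)) + F * m ^ (-(β + 2))) * e * (1 + τ ^ 2) ^ (-(3 / 4) : ℝ) := by ring
      _ ≤ _ := by
          gcongr
          have : 0 ≤ m ^ (-β) := by positivity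
          linarith

theorem hasSum_natCast_add_mul_pow_div_factorial (b x : ℂ) :
    HasSum (fun j : ℕ => (b + j) * (x ^ j / j.factorial)) ((b + x) * Complex.exp x) := by
  have h0 : HasSum (fun j : ℕ => x ^ j / j.factorial) (Complex.exp x) := by
    rw [Complex.exp_eq_exp_ℂ]; exact NormedSpace.expSeries_div_hasSum_exp x
  have h1 : HasSum (fun j : ℕ => (j : ℂ) * (x ^ j / j.factorial)) (x * Complex.exp x) := by
    rw [← hasSum_nat_add_iff' 1]
    simp only [Finset.range_one, Finset.sum_singleton, Nat.cast_zero, zero_mul, sub_zero]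
    refine (h0.mul_left x).congr_fun ?_
    intro j
    have : ((j : ℂ) + 1) ≠ 0 := by exact_mod_cast Nat.succ_ne_zero j
    have : (j.factorial : ℂ) ≠ 0 := by exact_mod_cast j.factorial_ne_zero
    rw [Nat.factorial_succ]
    push_cast
    field_simp
    try ring
  rw [add_mul]
  refine ((h0.mul_left b).add h1).congr_fun fun j => ?_
  ring

/-- It is the derivative that is expanded, not the amplitude, because its exponents `β + j + 1`
exceed `1`. Each term then has an absolutely convergent inversion integral even for `β = 1/2`. -/
theorem hasSum_verticalAmpDeriv {c : ℝ} (hc : 0 < c) (β F τ : ℝ) :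
    HasSum (fun j : ℕ => ((F ^ j / j.factorial * (β + j) : ℝ) : ℂ) * (-Complex.I) *
      ((c : ℂ) + τ * Complex.I) ^ (-((β + j + 1 : ℝ) : ℂ))) (verticalAmpDeriv c β F τ) := by
  have hl0 := add_mul_I_ne_zero hc τ
  set l := (c : ℂ) + τ * Complex.I
  have h := (hasSum_natCast_add_mul_pow_div_factorial (β : ℂ) (F / l)).mul_left
    (-Complex.I * l ^ (-((β + 1 : ℝ) : ℂ)))
  have e2 : l ^ (-((β + 2 : ℝ) : ℂ)) = l ^ (-((β + 1 : ℝ) : ℂ)) / l := by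
    have : -((β + 2 : ℝ) : ℂ) = -((β + 1 : ℝ) : ℂ) - 1 := by push_cast; ring
    rw [this, Complex.cpow_sub _ _ hl0, Complex.cpow_one]
  have ev : verticalAmpDeriv c β F τ = -Complex.I * l ^ (-((β + 1 : ℝ) : ℂ)) *
      ((β + F / l) * Complex.exp (F / l)) := by
    rw [verticalAmpDeriv]
    change -Complex.I * ((β * l ^ (-((β + 1 : ℝ) : ℂ)) + F * l ^ (-((β + 2 : ℝ) : ℂ))) *
      Complex.exp (F / l)) = _
    rw [e2]
    ring
  rw [ev]
  refine h.congr_fun fun j => ?_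
  have : -((β + j + 1 : ℝ) : ℂ) = -((β + 1 : ℝ) : ℂ) - (j : ℕ) := by push_cast; ring
  rw [this, Complex.cpow_sub _ _ hl0, Complex.cpow_natCast, div_pow]
  push_cast
  field_simp

theorem summable_norm_pow_mul (β x : ℝ) :
    Summable fun j : ℕ => ‖x ^ j / j.factorial * (β + j)‖ := by
  have h := (hasSum_natCast_add_mul_pow_div_factorial (β : ℂ) (x : ℂ)).summable.norm
  refine h.congr fun j => ?_
  rw [← Complex.norm_real]
  congr 1
  push_cast
  ring

/-- The inverse Laplace transform of `l^{-β} e^{F/l}`, at `a`. -/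
def borelKernel (β F a : ℝ) : ℝ :=
  ∑' j : ℕ, F ^ j / j.factorial * (a ^ (β + j - 1) / Real.Gamma (β + j))

/-- Termwise inversion, justified by `|l^{-j}| ≤ c^{-j}`. The factor `i/a` from integration by parts
and the factor `β + j` from differentiation reduce `a^{β+j}/Γ(β+j+1)` to `a^{β+j-1}/Γ(β+j)`. The
first conjunct also records the convergence of the series of `borelKernel`. -/
theorem cexp_mul_integral_verticalAmpDeriv {c : ℝ} (hc : 0 < c) {β : ℝ} (hβ : 0 < β) (F : ℝ)
    {a : ℝ} (ha : 0 < a) :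
    HasSum (fun j : ℕ => 2 * Real.pi * (F ^ j / j.factorial *
        (a ^ (β + j - 1) / Real.Gamma (β + j))))
      (2 * Real.pi * borelKernel β F a) ∧
    Complex.exp ((c * a : ℝ)) * (Complex.I / a *
      ∫ τ : ℝ, verticalAmpDeriv c β F τ * Complex.exp (Complex.I * (τ * a : ℝ))) =
      ((2 * Real.pi * borelKernel β F a : ℝ) : ℂ) := by
  have ha' : (a : ℂ) ≠ 0 := by exact_mod_cast ha.ne'
  set G : ℕ → ℝ → ℂ := fun j τ => ((F ^ j / j.factorial * (β + j) : ℝ) : ℂ) * (-Complex.I) *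
    (((c : ℂ) + τ * Complex.I) ^ (-((β + j + 1 : ℝ) : ℂ)) *
      Complex.exp (Complex.I * (τ * a : ℝ))) with hG
  have hpow : ∀ j : ℕ, 1 < β + j + 1 := fun j => by
    have : (0 : ℝ) ≤ j := j.cast_nonneg
    linarith
  have hGi : ∀ j, MeasureTheory.Integrable (G j) := fun j =>
    (((integrable_vertical_cpow hc (hpow j)).mul_bdd (c := 1)
      (Continuous.aestronglyMeasurable (by fun_prop))
      (Filter.Eventually.of_forall fun τ => (IsAmplitude.norm_cexp_mul a τ).le)).const_mul _)
  set D := ∫ τ : ℝ, ‖((c : ℂ) + τ * Complex.I) ^ (-((β + 1 : ℝ) : ℂ))‖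
  have hD := (integrable_vertical_cpow hc (b := β + 1) (by linarith)).norm
  have hGn : ∀ j, ∫ τ : ℝ, ‖G j τ‖ ≤ ‖(F / c) ^ j / j.factorial * (β + j)‖ * D := by
    intro j
    rw [← MeasureTheory.integral_const_mul]
    refine MeasureTheory.integral_mono (hGi j).norm (hD.const_mul _) fun τ => ?_
    have e : -((β + j + 1 : ℝ) : ℂ) = ((-(j : ℝ) : ℝ) : ℂ) + -((β + 1 : ℝ) : ℂ) := by
      push_cast; ring
    simp only [hG]
    rw [norm_mul, norm_mul, norm_mul, IsAmplitude.norm_cexp_mul, norm_neg, Complex.norm_I, mul_one,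
      mul_one, Complex.norm_real, e, Complex.cpow_add _ _ (add_mul_I_ne_zero hc τ),
      norm_mul (((c : ℂ) + τ * Complex.I) ^ _)]
    have h1 := norm_vertical_cpow_le_rpow hc (b := -(j : ℝ)) (by simp) τ
    calc _ ≤ ‖F ^ j / j.factorial * (β + j)‖ * (c ^ (-(j : ℝ)) *
          ‖((c : ℂ) + τ * Complex.I) ^ (-((β + 1 : ℝ) : ℂ))‖) := by gcongr
      _ = _ := by
          rw [Real.rpow_neg hc.le, Real.rpow_natCast, ← mul_assoc]
          congr 1
          rw [← Real.norm_of_nonneg (by positivity : 0 ≤ (c ^ j)⁻¹), ← norm_mul]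
          congr 1
          rw [div_pow]
          ring
  have hsum := MeasureTheory.hasSum_integral_of_summable_integral_norm hGi
    (Summable.of_nonneg_of_le (fun j => MeasureTheory.integral_nonneg fun τ => norm_nonneg _) hGn
      ((summable_norm_pow_mul β (F / c)).mul_right D))
  have htsum : ∀ τ : ℝ, ∑' j, G j τ =
      verticalAmpDeriv c β F τ * Complex.exp (Complex.I * (τ * a : ℝ)) := by
    intro τ
    rw [← ((hasSum_verticalAmpDeriv hc β F τ).mul_right _).tsum_eq]
    refine tsum_congr fun j => ?_
    simp only [hG]
    ring
  simp only [htsum] at hsum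
  have hterm : ∀ j, Complex.exp ((c * a : ℝ)) * (Complex.I / a * ∫ τ : ℝ, G j τ) =
      ((2 * Real.pi * (F ^ j / j.factorial * (a ^ (β + j - 1) / Real.Gamma (β + j))) : ℝ) : ℂ) := by
    intro j
    have hj : β + j ≠ 0 := by positivity
    have hΓ : Real.Gamma (β + j) ≠ 0 := (Real.Gamma_pos_of_pos (by positivity)).ne'
    have h1 : ∫ τ : ℝ, G j τ = ((F ^ j / j.factorial * (β + j) : ℝ) : ℂ) * (-Complex.I) *
        ((2 * Real.pi * (a ^ (β + j + 1 - 1) / Real.Gamma (β + j + 1)) *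
          Real.exp (-(c * a)) : ℝ) : ℂ) := by
      rw [← integral_vertical_cpow hc (hpow j) ha, ← MeasureTheory.integral_const_mul]
    have e1 : a ^ (β + j + 1 - 1) = a ^ (β + j - 1) * a := by
      rw [← Real.rpow_add_one ha.ne']; congr 1; ring
    have e2 : Real.exp (-(c * a)) = (Real.exp (c * a))⁻¹ := Real.exp_neg _
    rw [h1, e1, e2, Real.Gamma_add_one hj, ← Complex.ofReal_exp]
    have e3 : ((Real.exp (c * a) : ℝ) : ℂ) ≠ 0 := by exact_mod_cast (Real.exp_pos _).ne'
    generalize Real.exp (c * a) = y at e3 ⊢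
    generalize a ^ (β + j - 1) = p
    generalize Real.Gamma (β + j) = g at hΓ ⊢
    have hg : (g : ℂ) ≠ 0 := by exact_mod_cast hΓ
    have hj' : ((β : ℂ) + j) ≠ 0 := by exact_mod_cast hj
    have hf : (j.factorial : ℂ) ≠ 0 := by exact_mod_cast j.factorial_ne_zero
    push_cast
    field_simp
    rw [Complex.I_sq]
    ring
  have hmain := (hsum.mul_left (Complex.I / a)).mul_left (Complex.exp ((c * a : ℝ)))
  simp only [hterm] at hmain
  have hre : HasSum (fun j : ℕ => 2 * Real.pi * (F ^ j / j.factorial *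
      (a ^ (β + j - 1) / Real.Gamma (β + j)))) (2 * Real.pi * borelKernel β F a) := by
    have h2π : (2 * Real.pi) ≠ 0 := by positivity
    have hs := (Complex.hasSum_iff _ _ |>.mp hmain).1
    simp only [Complex.ofReal_re] at hs
    have h1 := (summable_mul_left_iff h2π).mp hs.summable
    exact h1.hasSum.mul_left _
  refine ⟨hre, ?_⟩
  exact hmain.unique (Complex.hasSum_ofReal.mpr hre)

open MeasureTheory in
theorem intervalIntegrable_mul_one_sub_rpow {u : ℝ} (hu : 0 < u) :
    IntervalIntegrable (fun s : ℝ => (s * (1 - s)) ^ (u - 1)) volume 0 1 := by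
  have h := (Complex.betaIntegral_convergent (u := (u : ℂ)) (v := (u : ℂ)) (by simpa) (by simpa)).norm
  refine h.congr ?_
  intro s hs
  rw [Set.uIoc_of_le zero_le_one] at hs
  have h1 : 0 ≤ 1 - s := by linarith [hs.2]
  have e1 : (u : ℂ) - 1 = ((u - 1 : ℝ) : ℂ) := by push_cast; rfl
  have e2 : (1 : ℂ) - s = ((1 - s : ℝ) : ℂ) := by push_cast; rfl
  simp only
  rw [e1, e2, norm_mul, Complex.norm_cpow_real, Complex.norm_cpow_real, Complex.norm_real,
    Complex.norm_real, Real.norm_of_nonneg hs.1.le, Real.norm_of_nonneg h1, Real.mul_rpow hs.1.le h1]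

-- For finite `T` the integrals over `τ` and `s` are exchanged by compactness. The limit `T → ∞` is
-- then taken under the `s`-integral by dominated convergence, with the uniform bound `a^{-3/4}`, `a
-- = A s(1-s)`.
open MeasureTheory Filter in
theorem tendsto_inverseLaplace {c : ℝ} (hc : 0 < c) {β : ℝ} (hβ : 1 / 2 ≤ β) {F : ℝ} (hF : 0 ≤ F)
    (γ : ℝ) {A : ℝ} (hA : 0 < A) :
    Tendsto (fun T : ℝ => ∫ τ in (-T)..T, verticalAmp c β F τ *
        ∫ s in (0 : ℝ)..1, Complex.exp (Complex.I * (γ * (1 / 2 - s) : ℝ) +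
          ((c : ℂ) + τ * Complex.I) * (A * (s * (1 - s)) : ℝ))) atTop
      (nhds (∫ s in (0 : ℝ)..1, Complex.exp (Complex.I * (γ * (1 / 2 - s) : ℝ)) *
        ((2 * Real.pi * borelKernel β F (A * (s * (1 - s))) : ℝ) : ℂ))) := by
  obtain ⟨C, hamp⟩ := exists_isAmplitude hc hβ hF
  have hgc := continuous_verticalAmp hc β F
  set I₀ : ℝ → ℝ → ℂ := fun T s => Complex.exp (Complex.I * (γ * (1 / 2 - s) : ℝ)) *
    (Complex.exp ((c * (A * (s * (1 - s))) : ℝ)) *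
      ∫ τ in (-T)..T, verticalAmp c β F τ *
        Complex.exp (Complex.I * (τ * (A * (s * (1 - s))) : ℝ))) with hI₀
  have hswap : ∀ T : ℝ, ∫ τ in (-T)..T, verticalAmp c β F τ *
        ∫ s in (0 : ℝ)..1, Complex.exp (Complex.I * (γ * (1 / 2 - s) : ℝ) +
          ((c : ℂ) + τ * Complex.I) * (A * (s * (1 - s)) : ℝ)) = ∫ s in (0 : ℝ)..1, I₀ T s := by
    intro T
    have hcont : Continuous (Function.uncurry fun τ s : ℝ => verticalAmp c β F τ *
        Complex.exp (Complex.I * (γ * (1 / 2 - s) : ℝ) +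
          ((c : ℂ) + τ * Complex.I) * (A * (s * (1 - s)) : ℝ))) := by
      refine (hgc.comp continuous_fst).mul ?_
      fun_prop
    simp only [← intervalIntegral.integral_const_mul]
    rw [MeasureTheory.intervalIntegral_intervalIntegral_swap]
    · refine intervalIntegral.integral_congr fun s _ => ?_
      simp only [hI₀]
      rw [← intervalIntegral.integral_const_mul, ← intervalIntegral.integral_const_mul]
      refine intervalIntegral.integral_congr fun τ _ => ?_
      rw [mul_left_comm _ (verticalAmp c β F τ), mul_left_comm _ (verticalAmp c β F τ),
        ← Complex.exp_add, ← Complex.exp_add]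
      congr 2
      push_cast
      ring
    · refine (hcont.continuousOn.integrableOn_compact
        ((isCompact_uIcc (a := -T) (b := T)).prod (isCompact_uIcc (a := 0) (b := 1)))).mono_set ?_
      exact Set.prod_mono Set.uIoc_subset_uIcc Set.uIoc_subset_uIcc
  simp only [hswap]
  set K := C * (4 + 2 * ∫ τ : ℝ, (1 + τ ^ 2) ^ (-(5 / 8) : ℝ))
  -- The endpoint `s = 1`, where the oscillation stops, is a null set.
  have hae : ∀ᵐ s : ℝ, s ∈ Set.uIoc (0 : ℝ) 1 → 0 < s * (1 - s) := by
    have h1 : ∀ᵐ s : ℝ, s ≠ 1 := by simp [ae_iff, measure_singleton]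
    filter_upwards [h1] with s hs hs'
    rw [Set.uIoc_of_le zero_le_one] at hs'
    exact mul_pos hs'.1 (sub_pos.mpr (lt_of_le_of_ne hs'.2 hs))
  refine intervalIntegral.tendsto_integral_filter_of_dominated_convergence
    (fun s => Real.exp (c * A) * (K * A ^ (-(3 / 4) : ℝ)) * (s * (1 - s)) ^ ((1 / 4 : ℝ) - 1))
    ?_ ?_ ((intervalIntegrable_mul_one_sub_rpow (by norm_num)).const_mul _) ?_
  · refine Eventually.of_forall fun T => Continuous.aestronglyMeasurable ?_
    refine Continuous.mul (by fun_prop) (Continuous.mul (by fun_prop) ?_)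
    refine intervalIntegral.continuous_parametric_intervalIntegral_of_continuous' ?_ _ _
    exact (hgc.comp continuous_snd).mul (by fun_prop)
  · filter_upwards [eventually_ge_atTop 0] with T hT
    filter_upwards [hae] with s hs hs'
    have ha : 0 < A * (s * (1 - s)) := mul_pos hA (hs hs')
    have h1 := hamp.norm_integral_le ha hT
    have h2 : ‖Complex.exp ((c * (A * (s * (1 - s))) : ℝ))‖ ≤ Real.exp (c * A) := by
      rw [← Complex.ofReal_exp, Complex.norm_real, Real.norm_of_nonneg (Real.exp_pos _).le,
        Real.exp_le_exp]
      have : s * (1 - s) ≤ 1 := by nlinarith [sq_nonneg s, sq_nonneg (1 - s)]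
      have : A * (s * (1 - s)) ≤ A := by nlinarith
      gcongr
    have h3 : ‖Complex.exp (Complex.I * (γ * (1 / 2 - s) : ℝ))‖ = 1 := by
      rw [mul_comm Complex.I, Complex.norm_exp_ofReal_mul_I]
    simp only [hI₀]
    rw [norm_mul, h3, one_mul, norm_mul]
    calc _ ≤ Real.exp (c * A) * (K * (A * (s * (1 - s))) ^ (-(3 / 4) : ℝ)) :=
          mul_le_mul h2 h1 (norm_nonneg _) (Real.exp_pos _).le
      _ = _ := by
          rw [Real.mul_rpow hA.le (hs hs').le]
          norm_num
          ring
  · filter_upwards [hae] with s hs hs'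
    have ha : 0 < A * (s * (1 - s)) := mul_pos hA (hs hs')
    have h1 := (hamp.tendsto_integral ha).const_mul
      (Complex.exp ((c * (A * (s * (1 - s))) : ℝ)))
    rw [(cexp_mul_integral_verticalAmpDeriv hc (by linarith) F ha).2] at h1
    exact h1.const_mul _

/-! ### Symmetric beta integrals -/

-- The value `B(σ, σ) = Γ(σ)²/Γ(2σ)`, simplified by Legendre's duplication formula.
open MeasureTheory in
theorem integral_mul_one_sub_rpow {σ : ℝ} (hσ : 0 < σ) :
    ∫ s in (0 : ℝ)..1, (s * (1 - s)) ^ (σ - 1) =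
      2 ^ (1 - 2 * σ) * Real.sqrt Real.pi * (Real.Gamma σ / Real.Gamma (σ + 1 / 2)) := by
  have h1 := Complex.Gamma_mul_Gamma_eq_betaIntegral (s := (σ : ℂ)) (t := (σ : ℂ)) (by simpa)
    (by simpa)
  have h2 : Complex.betaIntegral σ σ = ((∫ s in (0 : ℝ)..1, (s * (1 - s)) ^ (σ - 1) : ℝ) : ℂ) := by
    rw [Complex.betaIntegral, ← intervalIntegral.integral_ofReal]
    refine intervalIntegral.integral_congr fun s hs => ?_
    rw [Set.uIcc_of_le zero_le_one] at hs
    have hs1 : 0 ≤ 1 - s := by linarith [hs.2]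
    rw [Real.mul_rpow hs.1 hs1, Complex.ofReal_mul, Complex.ofReal_cpow hs.1,
      Complex.ofReal_cpow hs1]
    push_cast
    rfl
  have h3 := Real.Gamma_mul_Gamma_add_half σ
  rw [h2, ← Complex.ofReal_add, Complex.Gamma_ofReal, Complex.Gamma_ofReal, ← two_mul] at h1
  have h4 : Real.Gamma σ * Real.Gamma σ = Real.Gamma (2 * σ) *
      ∫ s in (0 : ℝ)..1, (s * (1 - s)) ^ (σ - 1) := by exact_mod_cast h1
  have p1 : Real.Gamma (2 * σ) ≠ 0 := (Real.Gamma_pos_of_pos (by linarith)).ne'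
  have p2 : Real.Gamma (σ + 1 / 2) ≠ 0 := (Real.Gamma_pos_of_pos (by linarith)).ne'
  refine mul_left_cancel₀ p1 ?_
  rw [← h4]
  generalize Real.Gamma (σ + 1 / 2) = y at p2 h3 ⊢
  field_simp
  linear_combination h3

theorem intervalIntegrable_centered_pow_mul (m : ℕ) {σ : ℝ} (hσ : 0 < σ) :
    IntervalIntegrable (fun s : ℝ => (1 / 2 - s) ^ m * (s * (1 - s)) ^ (σ - 1))
      MeasureTheory.volume 0 1 :=
  (intervalIntegrable_mul_one_sub_rpow hσ).continuousOn_mul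
    (by fun_prop : Continuous fun s : ℝ => (1 / 2 - s) ^ m).continuousOn

theorem rpow_sub_one_mul_self {x σ : ℝ} (hx : 0 ≤ x) (hσ : 0 < σ) :
    x ^ (σ - 1) * x = x ^ σ := by
  rcases hx.eq_or_lt with rfl | hx
  · rw [mul_zero, Real.zero_rpow hσ.ne']
  · rw [← Real.rpow_add_one hx.ne']; congr 1; ring

/-- Induction through `(1/2 - s)² = 1/4 - s(1-s)`: each step trades two powers of `1/2 - s` for a
step `σ ↦ σ + 1`, which is why `σ` is quantified inside the induction. -/
theorem integral_centered_even_pow (k : ℕ) : ∀ {σ : ℝ}, 0 < σ →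
    ∫ s in (0 : ℝ)..1, (1 / 2 - s) ^ (2 * k) * (s * (1 - s)) ^ (σ - 1) =
      2 ^ (1 - 2 * σ) * (1 / 4) ^ k * Real.Gamma (k + 1 / 2) *
        (Real.Gamma σ / Real.Gamma (k + σ + 1 / 2)) := by
  induction k with
  | zero =>
    intro σ hσ
    have := integral_mul_one_sub_rpow hσ
    simp only [mul_zero, pow_zero, one_mul, Nat.cast_zero, zero_add, mul_one]
    rw [this, Real.Gamma_one_half_eq]
  | succ k ih =>
    intro σ hσ
    have h1 : ∫ s in (0 : ℝ)..1, (1 / 2 - s) ^ (2 * (k + 1)) * (s * (1 - s)) ^ (σ - 1) =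
        ∫ s in (0 : ℝ)..1, ((1 / 4) * ((1 / 2 - s) ^ (2 * k) * (s * (1 - s)) ^ (σ - 1)) -
          (1 / 2 - s) ^ (2 * k) * (s * (1 - s)) ^ (σ + 1 - 1)) := by
      refine intervalIntegral.integral_congr fun s hs => ?_
      rw [Set.uIcc_of_le zero_le_one] at hs
      have hs1 : 0 ≤ s * (1 - s) := mul_nonneg hs.1 (by linarith [hs.2])
      have := rpow_sub_one_mul_self hs1 hσ
      simp only [add_sub_cancel_right]
      rw [← this]
      ring
    rw [h1, intervalIntegral.integral_sub ((intervalIntegrable_centered_pow_mul _ hσ).const_mul _)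
      (intervalIntegrable_centered_pow_mul _ (by linarith)), intervalIntegral.integral_const_mul,
      ih hσ, ih (by linarith : 0 < σ + 1)]
    have e1 : (2 : ℝ) ^ (1 - 2 * (σ + 1)) = 2 ^ (1 - 2 * σ) / 4 := by
      rw [show 1 - 2 * (σ + 1) = 1 - 2 * σ - (2 : ℕ) by push_cast; ring,
        Real.rpow_sub_natCast (by norm_num)]
      norm_num
    have e2 : Real.Gamma ((k + 1 : ℕ) + 1 / 2) = (k + 1 / 2) * Real.Gamma (k + 1 / 2) := by
      rw [← Real.Gamma_add_one (by positivity)]; congr 1; push_cast; ring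
    have e3 : Real.Gamma (k + (σ + 1) + 1 / 2) =
        (k + σ + 1 / 2) * Real.Gamma (k + σ + 1 / 2) := by
      rw [← Real.Gamma_add_one (by positivity)]; congr 1; ring
    have e4 : Real.Gamma ((k + 1 : ℕ) + σ + 1 / 2) =
        (k + σ + 1 / 2) * Real.Gamma (k + σ + 1 / 2) := by
      rw [← Real.Gamma_add_one (by positivity)]; congr 1; push_cast; ring
    rw [e1, e2, e3, e4, Real.Gamma_add_one hσ.ne', pow_succ]
    have p1 : Real.Gamma (k + σ + 1 / 2) ≠ 0 := (Real.Gamma_pos_of_pos (by positivity)).ne'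
    have p2 : (k : ℝ) + σ + 1 / 2 ≠ 0 := by positivity
    generalize Real.Gamma (k + σ + 1 / 2) = y at p1 ⊢
    generalize Real.Gamma (k + 1 / 2) = z
    generalize Real.Gamma σ = w
    generalize (2 : ℝ) ^ (1 - 2 * σ) = v
    field_simp
    ring

theorem integral_centered_odd_pow (k : ℕ) (σ : ℝ) :
    ∫ s in (0 : ℝ)..1, (1 / 2 - s) ^ (2 * k + 1) * (s * (1 - s)) ^ (σ - 1) = 0 := by
  have h := intervalIntegral.integral_comp_sub_left (a := 0) (b := 1)
    (fun s : ℝ => (1 / 2 - s) ^ (2 * k + 1) * (s * (1 - s)) ^ (σ - 1)) 1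
  simp only [sub_self, sub_zero] at h
  have h2 : ∀ s : ℝ, (1 / 2 - (1 - s)) ^ (2 * k + 1) * ((1 - s) * (1 - (1 - s))) ^ (σ - 1) =
      -((1 / 2 - s) ^ (2 * k + 1) * (s * (1 - s)) ^ (σ - 1)) := by
    intro s
    rw [show (1 : ℝ) / 2 - (1 - s) = -(1 / 2 - s) by ring, Odd.neg_pow ⟨k, rfl⟩,
      show (1 - s) * (1 - (1 - s)) = s * (1 - s) by ring]
    ring
  simp only [h2, intervalIntegral.integral_neg] at h
  linarith

theorem gamma_nat_add_half (k : ℕ) :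
    Real.Gamma (k + 1 / 2) / (2 * k).factorial = Real.sqrt Real.pi / (4 ^ k * k.factorial) := by
  induction k with
  | zero => simpa using Real.Gamma_one_half_eq
  | succ k ih =>
    have e2 : Real.Gamma ((k + 1 : ℕ) + 1 / 2) = (k + 1 / 2) * Real.Gamma (k + 1 / 2) := by
      rw [← Real.Gamma_add_one (by positivity)]; congr 1; push_cast; ring
    have p1 : ((2 * k).factorial : ℝ) ≠ 0 := by exact_mod_cast (2 * k).factorial_ne_zero
    have p2 : (k.factorial : ℝ) ≠ 0 := by exact_mod_cast k.factorial_ne_zero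
    have ih' := (div_eq_iff p1).mp ih
    rw [e2, ih', show 2 * (k + 1) = 2 * k + 1 + 1 by ring, Nat.factorial_succ, Nat.factorial_succ,
      Nat.factorial_succ]
    push_cast
    field_simp
    ring

theorem add_pow_div_factorial (x y : ℂ) (r : ℕ) :
    (x + y) ^ r / r.factorial = ∑ p ∈ Finset.HasAntidiagonal.antidiagonal r,
      x ^ p.1 / p.1.factorial * (y ^ p.2 / p.2.factorial) := by
  rw [(Commute.all x y).add_pow', Finset.sum_div]
  refine Finset.sum_congr rfl fun p hp => ?_
  have hp' := Finset.HasAntidiagonal.mem_antidiagonal.mp hp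
  have h := Nat.choose_mul_factorial_mul_factorial (n := r) (k := p.1) (by omega)
  rw [show r - p.1 = p.2 by omega] at h
  have h' : (r.choose p.1 : ℂ) * p.1.factorial * p.2.factorial = r.factorial := by exact_mod_cast h
  have p1 : (p.1.factorial : ℂ) ≠ 0 := by exact_mod_cast p.1.factorial_ne_zero
  have p2 : (p.2.factorial : ℂ) ≠ 0 := by exact_mod_cast p.2.factorial_ne_zero
  have p3 : (r.factorial : ℂ) ≠ 0 := by exact_mod_cast r.factorial_ne_zero
  rw [nsmul_eq_mul]
  field_simp
  linear_combination (x ^ p.1 * y ^ p.2) * h'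

/-- The general term of `∫₀¹ e^{iγ(1/2-s)} borelKernel β F (A s (1-s)) ds`. -/
theorem integral_centered_pow_mul_term {β : ℝ} (hβ : 0 < β) (F γ : ℝ) {A : ℝ} (hA : 0 < A)
    (j k : ℕ) :
    (((F ^ j / j.factorial * (A ^ (β + j - 1) / Real.Gamma (β + j)) : ℝ) : ℂ) *
        ((Complex.I * γ) ^ (2 * k) / (2 * k).factorial)) *
      ((∫ s in (0 : ℝ)..1, (1 / 2 - s) ^ (2 * k) * (s * (1 - s)) ^ (β + j - 1) : ℝ) : ℂ) =
    ((Real.sqrt Real.pi * 2 ^ (1 - 2 * β) * A ^ (β - 1) : ℝ) : ℂ) *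
      (((A * F / 4 : ℝ) : ℂ) ^ j / j.factorial * (((-(γ ^ 2 / 16) : ℝ) : ℂ) ^ k / k.factorial)) *
        ((1 / Real.Gamma (j + k + β + 1 / 2) : ℝ) : ℂ) := by
  have hI : (Complex.I * γ) ^ (2 * k) = (((-γ ^ 2) ^ k : ℝ) : ℂ) := by
    rw [pow_mul, mul_pow, Complex.I_sq]; push_cast; ring
  have hβj : 0 < β + j := by positivity
  have h1 := gamma_nat_add_half k
  have e1 : (2 : ℝ) ^ (1 - 2 * (β + j)) = 2 ^ (1 - 2 * β) * (1 / 4) ^ j := by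
    rw [show 1 - 2 * (β + j) = 1 - 2 * β - ((2 * j : ℕ) : ℝ) by push_cast; ring,
      Real.rpow_sub_natCast (by norm_num), pow_mul, one_div, inv_pow, div_eq_mul_inv]
    norm_num
  have e2 : A ^ (β + j - 1) = A ^ (β - 1) * A ^ j := by
    rw [← Real.rpow_add_natCast hA.ne']; congr 1; ring
  rw [integral_centered_even_pow k hβj, hI, e1, e2,
    show (k : ℝ) + (β + j) + 1 / 2 = j + k + β + 1 / 2 by ring]
  have p1 : ((2 * k).factorial : ℝ) ≠ 0 := by exact_mod_cast (2 * k).factorial_ne_zero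
  have h1' := (div_eq_iff p1).mp h1
  have p2 : Real.Gamma (β + j) ≠ 0 := (Real.Gamma_pos_of_pos hβj).ne'
  have p3 : Real.Gamma (j + k + β + 1 / 2) ≠ 0 := (Real.Gamma_pos_of_pos (by positivity)).ne'
  rw [h1']
  generalize Real.Gamma (β + j) = y at p2 ⊢
  generalize Real.Gamma (j + k + β + 1 / 2) = z at p3 ⊢
  generalize (2 : ℝ) ^ (1 - 2 * β) = v
  generalize A ^ (β - 1) = u
  generalize Real.sqrt Real.pi = w
  have hreal : F ^ j / j.factorial * (u * A ^ j / y) * ((-γ ^ 2) ^ k / (2 * k).factorial) *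
      (v * (1 / 4) ^ j * (1 / 4) ^ k * (w / (4 ^ k * k.factorial) * (2 * k).factorial) * (y / z)) =
      w * v * u * ((A * F / 4) ^ j / j.factorial * ((-(γ ^ 2 / 16)) ^ k / k.factorial)) *
        (1 / z) := by
    have e3 : (-(γ ^ 2 / 16)) ^ k = (-γ ^ 2) ^ k * (1 / 4) ^ k * (1 / 4) ^ k := by
      rw [← mul_pow, ← mul_pow]; congr 1; ring
    have e4 : (A * F / 4) ^ j = A ^ j * F ^ j * (1 / 4) ^ j := by
      rw [← mul_pow, ← mul_pow]; congr 1; ring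
    have e5 : (4 : ℝ) ^ k = ((1 / 4) ^ k)⁻¹ := by
      rw [one_div, inv_pow, inv_inv]
    rw [e3, e4, e5]
    have p4 : ((1 : ℝ) / 4) ^ k ≠ 0 := by positivity
    generalize ((1 : ℝ) / 4) ^ k = r at p4 ⊢
    field_simp
  exact_mod_cast hreal

-- Both the exponential and the Borel series are expanded, and the double series is integrated
-- termwise. The integrals of the norms are dominated by the product of the two summable coefficient
-- sequences times one beta integral.
open MeasureTheory in
theorem hasSum_integral_borelKernel {β : ℝ} (hβ : 0 < β) {F : ℝ} (hF : 0 ≤ F) (γ : ℝ) {A : ℝ}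
    (hA : 0 < A) :
    HasSum (fun p : ℕ × ℕ =>
      (((F ^ p.1 / p.1.factorial * (A ^ (β + p.1 - 1) / Real.Gamma (β + p.1)) : ℝ) : ℂ) *
        ((Complex.I * γ) ^ p.2 / p.2.factorial)) *
      ((∫ s in (0 : ℝ)..1, (1 / 2 - s) ^ p.2 * (s * (1 - s)) ^ (β + p.1 - 1) : ℝ) : ℂ))
    (∫ s in (0 : ℝ)..1, Complex.exp (Complex.I * (γ * (1 / 2 - s) : ℝ)) *
        (borelKernel β F (A * (s * (1 - s))) : ℂ)) := by
  set c : ℕ → ℝ := fun j => F ^ j / j.factorial * (A ^ (β + j - 1) / Real.Gamma (β + j)) with hc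
  have hΓ : ∀ j : ℕ, 0 < Real.Gamma (β + j) := fun j => Real.Gamma_pos_of_pos (by positivity)
  have hc0 : ∀ j, 0 ≤ c j := fun j => by
    have := hΓ j
    positivity
  have hsumK : ∀ a : ℝ, 0 < a → Summable fun j : ℕ =>
      F ^ j / j.factorial * (a ^ (β + j - 1) / Real.Gamma (β + j)) := fun a ha =>
    (summable_mul_left_iff (by positivity : (2 * Real.pi) ≠ 0)).mp
      (cexp_mul_integral_verticalAmpDeriv one_pos hβ F ha).1.summable
  have hcs : Summable c := hsumK A hA
  set G : ℕ × ℕ → ℝ → ℂ := fun p s => ((c p.1 : ℝ) : ℂ) *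
    ((Complex.I * γ) ^ p.2 / p.2.factorial) *
      (((1 / 2 - s) ^ p.2 * (s * (1 - s)) ^ (β + p.1 - 1) : ℝ) : ℂ) with hG
  have hGi : ∀ p, Integrable (G p) (volume.restrict (Set.Ioc 0 1)) := fun p => by
    have h := (intervalIntegrable_centered_pow_mul p.2 (σ := β + p.1) (by positivity)).1
    exact h.ofReal.const_mul _
  set D := ∫ s in Set.Ioc (0 : ℝ) 1, (s * (1 - s)) ^ (β - 1)
  have hD : Integrable (fun s : ℝ => (s * (1 - s)) ^ (β - 1)) (volume.restrict (Set.Ioc 0 1)) :=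
    (intervalIntegrable_mul_one_sub_rpow hβ).1
  have hGn : ∀ p, ∫ s in Set.Ioc (0 : ℝ) 1, ‖G p s‖ ≤
      c p.1 * (|γ| ^ p.2 / p.2.factorial) * D := by
    intro p
    rw [← integral_const_mul]
    refine setIntegral_mono_on (hGi p).norm (hD.const_mul _) measurableSet_Ioc fun s hs => ?_
    have hs1 : 0 ≤ 1 - s := by linarith [hs.2]
    have hu0 : 0 ≤ s * (1 - s) := mul_nonneg hs.1.le hs1
    have hu1 : s * (1 - s) ≤ 1 := by nlinarith [hs.1, hs.2]
    simp only [hG]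
    rw [norm_mul, norm_mul, Complex.norm_real, Real.norm_of_nonneg (hc0 _), norm_div, norm_pow,
      norm_mul, Complex.norm_I, one_mul, Complex.norm_real, Real.norm_eq_abs, Complex.norm_natCast,
      Complex.norm_real, norm_mul, norm_pow, Real.norm_of_nonneg (Real.rpow_nonneg hu0 _)]
    have hc1 := hc0 p.1
    refine mul_le_mul_of_nonneg_left ?_ (by positivity)
    have h1 : ‖1 / 2 - s‖ ^ p.2 ≤ 1 := by
      refine pow_le_one₀ (norm_nonneg _) ?_
      rw [Real.norm_eq_abs, abs_le]
      constructor <;> linarith [hs.1, hs.2]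
    have h2 : (s * (1 - s)) ^ (β + p.1 - 1) ≤ (s * (1 - s)) ^ (β - 1) := by
      -- At `s = 1` the base is `0`, where monotonicity in the exponent is not available and the
      -- value of `0 ^ x` must be inspected.
      rcases hu0.eq_or_lt with h0 | h0
      · rw [← h0]
        rcases Nat.eq_zero_or_pos p.1 with hp | hp
        · simp [hp]
        · have : (1 : ℝ) ≤ p.1 := by exact_mod_cast hp
          rw [Real.zero_rpow (by linarith)]
          exact Real.rpow_nonneg le_rfl _
      · exact Real.rpow_le_rpow_of_exponent_ge h0 hu1 (by
          have : (0 : ℝ) ≤ p.1 := p.1.cast_nonneg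
          linarith)
    calc _ ≤ 1 * (s * (1 - s)) ^ (β - 1) :=
          mul_le_mul h1 h2 (Real.rpow_nonneg hu0 _) zero_le_one
      _ = _ := one_mul _
  have hsumm : Summable fun p : ℕ × ℕ => c p.1 * (|γ| ^ p.2 / p.2.factorial) * D :=
    (hcs.mul_of_nonneg (Real.summable_pow_div_factorial |γ|) hc0
      (fun _ => by positivity)).mul_right D
  have hsum := hasSum_integral_of_summable_integral_norm hGi
    (Summable.of_nonneg_of_le (fun p => integral_nonneg fun s => norm_nonneg _) hGn hsumm)
  rw [intervalIntegral.integral_of_le zero_le_one]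
  have hval : ∫ s in Set.Ioc (0 : ℝ) 1, ∑' p, G p s =
      ∫ s in Set.Ioc (0 : ℝ) 1, Complex.exp (Complex.I * (γ * (1 / 2 - s) : ℝ)) *
        (borelKernel β F (A * (s * (1 - s))) : ℂ) := by
    have hne : ∀ᵐ s : ℝ, s ≠ 1 := by simp [ae_iff, measure_singleton]
    refine setIntegral_congr_ae measurableSet_Ioc ?_
    filter_upwards [hne] with s hs hs'
    have hu : 0 < s * (1 - s) := mul_pos hs'.1 (sub_pos.mpr (lt_of_le_of_ne hs'.2 hs))
    have h1 : HasSum (fun j : ℕ => ((F ^ j / j.factorial *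
        ((A * (s * (1 - s))) ^ (β + j - 1) / Real.Gamma (β + j)) : ℝ) : ℂ))
        (borelKernel β F (A * (s * (1 - s))) : ℂ) :=
      Complex.hasSum_ofReal.mpr (hsumK _ (mul_pos hA hu)).hasSum
    have h2 : HasSum (fun m : ℕ => (Complex.I * (γ * (1 / 2 - s) : ℝ)) ^ m / m.factorial)
        (Complex.exp (Complex.I * (γ * (1 / 2 - s) : ℝ))) := by
      rw [Complex.exp_eq_exp_ℂ]; exact NormedSpace.expSeries_div_hasSum_exp _
    have h3 := HasSum.mul_mul_of_norm h1 h2 h1.summable.norm h2.summable.norm 1 1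
    rw [one_mul, mul_one] at h3
    rw [mul_comm (Complex.exp _), ← h3.tsum_eq]
    refine tsum_congr fun p => ?_
    have e : Complex.I * ((γ * (1 / 2 - s) : ℝ) : ℂ) = Complex.I * γ * ((1 / 2 - s : ℝ) : ℂ) := by
      push_cast; ring
    simp only [hG, hc]
    rw [Real.mul_rpow hA.le hu.le, e, mul_pow _ ((1 / 2 - s : ℝ) : ℂ)]
    push_cast
    ring
  rw [← hval]
  refine (congrArg (HasSum · _) (funext fun p => ?_)).mpr hsum
  simp only [hG]
  rw [integral_const_mul, intervalIntegral.integral_of_le zero_le_one, integral_complex_ofReal]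

/-- The gamma factor depends only on the sum of the two indices, so the binomial theorem collapses
the double series to a single one in `x + y`. The factor `-4` compensates the `(-1/4)ʳ` in the
Bessel coefficients. -/
theorem besselReg_eq_tsum_pair {ν : ℝ} (hν : 0 ≤ ν) {x y S : ℂ} (c : ℂ)
    (h : HasSum (fun p : ℕ × ℕ => c * (x ^ p.1 / p.1.factorial * (y ^ p.2 / p.2.factorial)) *
      ((1 / Real.Gamma (p.1 + p.2 + ν + 1) : ℝ) : ℂ)) S) :
    S = c * ((2 ^ ν : ℝ) : ℂ) * besselReg ν (-4 * (x + y)) := by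
  have h1 := hasSum_antidiagonal h
  have h2 := hasSum_const_mul (hasSum_besselReg hν (-4 * (x + y))) (c * ((2 ^ ν : ℝ) : ℂ))
  refine h1.unique ((congrArg (HasSum · _) (funext fun r => ?_)).mpr h2)
  have h3 : ∀ p ∈ Finset.HasAntidiagonal.antidiagonal r,
      c * (x ^ p.1 / p.1.factorial * (y ^ p.2 / p.2.factorial)) *
        ((1 / Real.Gamma (p.1 + p.2 + ν + 1) : ℝ) : ℂ) =
      c * ((1 / Real.Gamma (r + ν + 1) : ℝ) : ℂ) *
        (x ^ p.1 / p.1.factorial * (y ^ p.2 / p.2.factorial)) := by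
    intro p hp
    rw [← Finset.HasAntidiagonal.mem_antidiagonal.mp hp]
    push_cast
    ring
  rw [Finset.sum_congr rfl h3, ← Finset.mul_sum, ← add_pow_div_factorial, besselCoeff,
    show (r : ℝ) + ν + 1 = ν + r + 1 by ring]
  have e1 : (1 / 2 : ℝ) ^ (ν + 2 * r) = (2 ^ ν)⁻¹ * (1 / 4) ^ r := by
    rw [Real.rpow_add (by norm_num), one_div, Real.inv_rpow (by norm_num)]
    congr 1
    rw [show (2 : ℝ) * r = ((2 * r : ℕ) : ℝ) by push_cast; ring, Real.rpow_natCast, pow_mul]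
    norm_num
  have p1 : (2 : ℝ) ^ ν ≠ 0 := by positivity
  rw [e1]
  generalize (2 : ℝ) ^ ν = v at p1 ⊢
  generalize Real.Gamma (ν + r + 1) = g
  have p2 : (v : ℂ) ≠ 0 := by exact_mod_cast p1
  have p3 : (r.factorial : ℂ) ≠ 0 := by exact_mod_cast r.factorial_ne_zero
  have e2 : (-4 * (x + y)) ^ r = (-1) ^ r * 4 ^ r * (x + y) ^ r := by
    rw [← mul_pow, ← mul_pow]; congr 1; ring
  have e3 : ((-1 : ℂ) ^ r) * (-1) ^ r = 1 := by rw [← mul_pow]; norm_num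
  have e4 : ((1 : ℂ) / 4) ^ r * 4 ^ r = 1 := by rw [← mul_pow]; norm_num
  rw [e2]
  push_cast
  generalize (x + y) ^ r = u
  calc _ = c * (1 / g) * (u / r.factorial) * (((-1 : ℂ) ^ r) * (-1) ^ r) *
        (((1 : ℂ) / 4) ^ r * 4 ^ r) := by rw [e3, e4]; ring
    _ = _ := by field_simp

theorem integral_cexp_mul_borelKernel {β : ℝ} (hβ : 1 / 2 ≤ β) {F : ℝ} (hF : 0 ≤ F) (γ : ℝ) {A : ℝ}
    (hA : 0 < A) :
    ∫ s in (0 : ℝ)..1, Complex.exp (Complex.I * (γ * (1 / 2 - s) : ℝ)) *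
        (borelKernel β F (A * (s * (1 - s))) : ℂ) =
      ((Real.sqrt Real.pi * 2 ^ (1 - 2 * β) * A ^ (β - 1) : ℝ) : ℂ) *
        ((2 ^ (β - 1 / 2) : ℝ) : ℂ) *
        besselReg (β - 1 / 2) ((γ ^ 2 / 4 - A * F : ℝ) : ℂ) := by
  have h := hasSum_integral_borelKernel (by linarith : 0 < β) hF γ hA
  have hinj : Function.Injective fun p : ℕ × ℕ => (p.1, 2 * p.2) := by
    rintro ⟨a, b⟩ ⟨a', b'⟩ h
    simp only [Prod.mk.injEq] at h ⊢
    omega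
  -- Only even powers of `1/2 - s` are kept; the odd ones integrate to zero by the reflection `s ↦ 1
  -- - s`.
  rw [← hinj.hasSum_iff] at h
  · have h2 : HasSum (fun p : ℕ × ℕ =>
        ((Real.sqrt Real.pi * 2 ^ (1 - 2 * β) * A ^ (β - 1) : ℝ) : ℂ) *
        (((A * F / 4 : ℝ) : ℂ) ^ p.1 / p.1.factorial *
          (((-(γ ^ 2 / 16) : ℝ) : ℂ) ^ p.2 / p.2.factorial)) *
        ((1 / Real.Gamma (p.1 + p.2 + (β - 1 / 2) + 1) : ℝ) : ℂ)) _ :=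
      (congrArg (HasSum · _) (funext fun p => ?_)).mpr h
    · rw [besselReg_eq_tsum_pair (by linarith) _ h2]
      congr 2
      push_cast
      ring
    · have := integral_centered_pow_mul_term (by linarith : 0 < β) F γ hA p.1 p.2
      simp only [Function.comp_apply]
      rw [this, show (p.1 : ℝ) + p.2 + (β - 1 / 2) + 1 = p.1 + p.2 + β + 1 / 2 by ring]
  · rintro ⟨j, m⟩ hm
    rcases Nat.even_or_odd' m with ⟨k, hk | hk⟩
    · exact absurd ⟨(j, k), by simp [hk]⟩ hm
    · simp only [hk]
      rw [integral_centered_odd_pow, Complex.ofReal_zero, mul_zero]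

/-! ### The generating function -/

theorem ofReal_div_cpow {a : ℝ} (ha : 0 < a) {l : ℂ} (hl : l ∈ Complex.slitPlane) (w : ℂ) :
    ((a : ℂ) / l) ^ w = (a : ℂ) ^ w * l ^ (-w) := by
  rw [div_eq_inv_mul, mul_ofReal_cpow ha (inv_ne_zero (Complex.slitPlane_ne_zero hl)),
    Complex.inv_cpow _ _ (Complex.slitPlane_arg_ne_pi hl), Complex.cpow_neg, mul_comm]

/-- The powers combine as `l⁻¹ · l² · l^{-d/2} = l^{-(d/2-1)}`, which fixes `β = d/2 - 1` and `F =
f²/4` in the inverse Laplace transform. -/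
theorem inv_mul_integral_heatKernel (ħ : ℝ) {c : ℝ} (hc : 0 < c) (f κ : E d) (τ : ℝ) :
    ((c : ℂ) + τ * Complex.I)⁻¹ * ∫ p, heatKernel ħ f κ ((c : ℂ) + τ * Complex.I) p =
      ((Real.pi ^ ((d : ℝ) / 2) : ℝ) : ℂ) * (verticalAmp c ((d : ℝ) / 2 - 1) (‖f‖ ^ 2 / 4) τ *
        ∫ s in (0 : ℝ)..1, Complex.exp (Complex.I * (ħ * inner ℝ κ f * (1 / 2 - s) : ℝ) +
          ((c : ℂ) + τ * Complex.I) * (ħ ^ 2 * ‖κ‖ ^ 2 * (s * (1 - s)) : ℝ))) := by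
  rw [integral_heatKernel ħ (by rw [re_add_mul_I]; exact hc), verticalAmp]
  have hl := vertical_mem_slitPlane hc τ
  have hl0 := add_mul_I_ne_zero hc τ
  set l := (c : ℂ) + τ * Complex.I
  have e1 : ((Real.pi : ℂ) / l) ^ ((d : ℂ) / 2) = ((Real.pi ^ ((d : ℝ) / 2) : ℝ) : ℂ) *
      l ^ (-((d : ℂ) / 2)) := by
    rw [ofReal_div_cpow Real.pi_pos hl, Complex.ofReal_cpow Real.pi_pos.le]; push_cast; rfl
  have e2 : l ^ (-(((d : ℝ) / 2 - 1 : ℝ) : ℂ)) = l ^ (-((d : ℂ) / 2)) * l := by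
    rw [show -(((d : ℝ) / 2 - 1 : ℝ) : ℂ) = -((d : ℂ) / 2) + 1 by push_cast; ring,
      Complex.cpow_add _ _ hl0, Complex.cpow_one]
  have e3 : ((‖f‖ ^ 2 : ℝ) : ℂ) / (4 * l) = ((‖f‖ ^ 2 / 4 : ℝ) : ℂ) / l := by
    push_cast; field_simp
  have e4 : ∀ s : ℝ, loopExponent ħ f κ l s = Complex.I * (ħ * inner ℝ κ f * (1 / 2 - s) : ℝ) +
      l * (ħ ^ 2 * ‖κ‖ ^ 2 * (s * (1 - s)) : ℝ) := by
    intro s; rw [loopExponent]; push_cast; ring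
  simp only [e4]
  rw [e1, e2, e3]
  generalize l ^ (-((d : ℂ) / 2)) = u
  generalize (∫ s in (0 : ℝ)..1, Complex.exp (Complex.I * (ħ * inner ℝ κ f * (1 / 2 - s) : ℝ) +
      l * (ħ ^ 2 * ‖κ‖ ^ 2 * (s * (1 - s)) : ℝ))) = J
  field_simp

theorem loop_constant (d : ℕ) {ħ κ : ℝ} (hħ : 0 < ħ) (hκ : 0 < κ) :
    (1 / 2) * (1 / (2 * Real.pi * ħ) ^ d) * Real.pi ^ ((d : ℝ) / 2) *
      (Real.sqrt Real.pi * 2 ^ (1 - 2 * ((d : ℝ) / 2 - 1)) *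
        (ħ ^ 2 * κ ^ 2) ^ ((d : ℝ) / 2 - 1 - 1) * 2 ^ ((d : ℝ) / 2 - 1 - 1 / 2)) =
      kappa d ħ * (ħ / 2) ^ ((d : ℝ) - 4) * (κ ^ 2) ^ ((d : ℝ) / 2 - 2) := by
  have hπ := Real.pi_pos
  have two : (0 : ℝ) < 2 := two_pos
  have a1 : (ħ ^ 2 * κ ^ 2) ^ ((d : ℝ) / 2 - 1 - 1) =
      ħ ^ ((d : ℝ) - 4) * (κ ^ 2) ^ ((d : ℝ) / 2 - 2) := by
    rw [Real.mul_rpow (by positivity) (by positivity), ← Real.rpow_natCast ħ 2,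
      ← Real.rpow_mul hħ.le, show (d : ℝ) / 2 - 1 - 1 = d / 2 - 2 by ring]
    congr 2
    push_cast
    ring
  have a2 : Real.pi ^ ((1 - (d : ℝ)) / 2) =
      (Real.pi ^ d)⁻¹ * Real.pi ^ ((d : ℝ) / 2) * Real.sqrt Real.pi := by
    rw [Real.sqrt_eq_rpow, ← Real.rpow_natCast, ← Real.rpow_neg hπ.le, ← Real.rpow_add hπ,
      ← Real.rpow_add hπ]
    congr 1
    ring
  have a3 : (2 : ℝ) ^ (-((d : ℝ) + 7) / 2) = (1 / 2) * ((2 : ℝ) ^ d)⁻¹ *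
      (2 ^ (1 - 2 * ((d : ℝ) / 2 - 1)) * 2 ^ ((d : ℝ) / 2 - 1 - 1 / 2)) * 2 ^ ((d : ℝ) - 4) := by
    rw [show (1 : ℝ) / 2 = 2 ^ (-1 : ℝ) by rw [Real.rpow_neg_one]; norm_num,
      ← Real.rpow_natCast 2 d, ← Real.rpow_neg two.le, ← Real.rpow_add two, ← Real.rpow_add two,
      ← Real.rpow_add two, ← Real.rpow_add two]
    congr 1
    rw [Real.rpow_neg_one]
    ring
  rw [kappa, a1, a2, a3, Real.rpow_neg hħ.le, Real.rpow_natCast, Real.div_rpow hħ.le two.le,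
    mul_pow, mul_pow]
  have p1 : (2 : ℝ) ^ ((d : ℝ) - 4) ≠ 0 := by positivity
  field_simp

-- The inverse Laplace transform is used with `β = d/2 - 1`, `F = f²/4`, `γ = ħ κ·f`, `A = ħ²κ²`.
-- Then `γ²/4 - AF = -(ħ²/4) ρ²(f)` is the Bessel argument, and `κ ≠ 0` is needed for `A > 0`.
open MeasureTheory in
theorem isGenFun_genFun (hd : 2 < d) {ħ : ℝ} (hħ : 0 < ħ) (q q' : E d) {κ : E d} (hκ : κ ≠ 0) :
    IsGenFun ħ q q' κ (genFun ħ q q' κ) := by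
  intro x
  have hκ' : 0 < ‖κ‖ := norm_pos_iff.mpr hκ
  have hd' : (3 : ℝ) ≤ d := by exact_mod_cast hd
  refine ⟨heatKernel ħ (q + q') κ, fun l _ p => hasSum_heatKernel ħ q q' κ x p l,
    fun l hl => integrable_heatKernel ħ hl _ _, fun c hc => ?_⟩
  have hA : 0 < ħ ^ 2 * ‖κ‖ ^ 2 := by positivity
  have hF : 0 ≤ ‖q + q'‖ ^ 2 / 4 := by positivity
  refine ⟨fun T => ?_, ?_⟩
  · simp only [inv_mul_integral_heatKernel ħ hc]
    refine Continuous.intervalIntegrable (continuous_const.mul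
      ((continuous_verticalAmp hc _ _).mul ?_)) _ _
    refine intervalIntegral.continuous_parametric_intervalIntegral_of_continuous' ?_ _ _
    fun_prop
  · have h := (tendsto_inverseLaplace hc (β := (d : ℝ) / 2 - 1) (by linarith) hF
      (ħ * inner ℝ κ (q + q')) hA).const_mul ((1 / (2 * (Real.pi : ℂ))) *
        ((1 / 2) * (1 / (2 * (Real.pi : ℂ) * ħ) ^ d)) * ((Real.pi ^ ((d : ℝ) / 2) : ℝ) : ℂ))
    have hfun : ∀ τ : ℝ, ((c : ℂ) + τ * Complex.I)⁻¹ * ((1 / 2) * (1 / (2 * (Real.pi : ℂ) * ħ) ^ d) *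
        ∫ p, heatKernel ħ (q + q') κ ((c : ℂ) + τ * Complex.I) p) =
        ((1 / 2) * (1 / (2 * (Real.pi : ℂ) * ħ) ^ d) * ((Real.pi ^ ((d : ℝ) / 2) : ℝ) : ℂ)) *
        (verticalAmp c ((d : ℝ) / 2 - 1) (‖q + q'‖ ^ 2 / 4) τ *
        ∫ s in (0 : ℝ)..1, Complex.exp (Complex.I * (ħ * inner ℝ κ (q + q') * (1 / 2 - s) : ℝ) +
          ((c : ℂ) + τ * Complex.I) * (ħ ^ 2 * ‖κ‖ ^ 2 * (s * (1 - s)) : ℝ))) := by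
      intro τ
      rw [mul_left_comm, inv_mul_integral_heatKernel ħ hc]
      simp only [mul_assoc]
    simp only [hfun, intervalIntegral.integral_const_mul]
    refine (h.congr fun T => ?_).trans (le_of_eq ?_)
    · simp only [mul_assoc]
    · congr 1
      have e1 : ∀ s : ℝ, Complex.exp (Complex.I * (ħ * inner ℝ κ (q + q') * (1 / 2 - s) : ℝ)) *
          ((2 * Real.pi * borelKernel ((d : ℝ) / 2 - 1) (‖q + q'‖ ^ 2 / 4)
            (ħ ^ 2 * ‖κ‖ ^ 2 * (s * (1 - s))) : ℝ) : ℂ) = (2 * (Real.pi : ℂ)) *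
          (Complex.exp (Complex.I * (ħ * inner ℝ κ (q + q') * (1 / 2 - s) : ℝ)) *
          (borelKernel ((d : ℝ) / 2 - 1) (‖q + q'‖ ^ 2 / 4)
            (ħ ^ 2 * ‖κ‖ ^ 2 * (s * (1 - s))) : ℂ)) := by
        intro s; push_cast; ring
      simp only [e1, intervalIntegral.integral_const_mul]
      rw [integral_cexp_mul_borelKernel (by linarith) hF _ hA, genFun_eq hħ,
        ← loop_constant d hħ hκ',
        show (ħ * inner ℝ κ (q + q')) ^ 2 / 4 - ħ ^ 2 * ‖κ‖ ^ 2 * (‖q + q'‖ ^ 2 / 4) =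
          -(ħ ^ 2 / 4) * rhoVal (q + q') κ by rw [rhoVal, real_inner_comm]; ring,
        show (d : ℝ) / 2 - 1 - 1 / 2 = ((d : ℝ) - 3) / 2 by ring]
      have hπ : (Real.pi : ℂ) ≠ 0 := by exact_mod_cast Real.pi_ne_zero
      generalize besselReg (((d : ℝ) - 3) / 2) _ = B
      push_cast
      generalize 2 * (Real.pi : ℂ) * ħ = u
      field_simp

/-- The series determines `K` for `Re l > 0`, and the limit along a single contour, here `c = 1`,
determines the value. -/
theorem IsQuadraticLagrangian.unique {ħ : ℝ} {h₁ h₂ : Symb d} {x : E d} {L L' : ℂ}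
    (h : IsQuadraticLagrangian ħ h₁ h₂ x L) (h' : IsQuadraticLagrangian ħ h₁ h₂ x L') : L = L' := by
  obtain ⟨K, hK, -, hL⟩ := h
  obtain ⟨K', hK', -, hL'⟩ := h'
  have hKK : ∀ l : ℂ, 0 < l.re → K l = K' l := fun l hl =>
    funext fun p => (hK l hl p).unique (hK' l hl p)
  have hKK' : ∀ τ : ℝ, K (((1 : ℝ) : ℂ) + τ * Complex.I) = K' (((1 : ℝ) : ℂ) + τ * Complex.I) :=
    fun τ => hKK _ (by rw [re_add_mul_I]; exact one_pos)
  have h1 := (hL 1 one_pos).2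
  simp only [hKK'] at h1
  exact tendsto_nhds_unique h1 (hL' 1 one_pos).2

theorem IsGenFun.eq_genFun (hd : 2 < d) {ħ : ℝ} (hħ : 0 < ħ) {q q' κ : E d} (hκ : κ ≠ 0) {P : ℂ}
    (h : IsGenFun ħ q q' κ P) : P = genFun ħ q q' κ :=
  (h 0).unique (isGenFun_genFun hd hħ q q' hκ 0)

/-! ### Absolutely convergent sums of polynomials -/

section l1

variable {σ : Type*}

/-- The sum of the absolute values of the coefficients. -/
def coeffNorm (p : MvPolynomial σ ℂ) : ℝ := ∑ a ∈ p.support, ‖p.coeff a‖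

theorem coeffNorm_eq_sum_of_subset {p : MvPolynomial σ ℂ} {S : Finset (σ →₀ ℕ)}
    (h : p.support ⊆ S) : coeffNorm p = ∑ a ∈ S, ‖p.coeff a‖ :=
  Finset.sum_subset h fun a _ ha => by rw [MvPolynomial.notMem_support_iff.mp ha, norm_zero]

theorem coeffNorm_nonneg (p : MvPolynomial σ ℂ) : 0 ≤ coeffNorm p :=
  Finset.sum_nonneg fun _ _ => norm_nonneg _

theorem coeffNorm_add_le (p q : MvPolynomial σ ℂ) :
    coeffNorm (p + q) ≤ coeffNorm p + coeffNorm q := by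
  classical
  rw [coeffNorm_eq_sum_of_subset MvPolynomial.support_add,
    coeffNorm_eq_sum_of_subset (p := p) Finset.subset_union_left,
    coeffNorm_eq_sum_of_subset (p := q) Finset.subset_union_right, ← Finset.sum_add_distrib]
  exact Finset.sum_le_sum fun a _ => by rw [MvPolynomial.coeff_add]; exact norm_add_le _ _

theorem coeffNorm_sum_le {ι : Type*} (s : Finset ι) (f : ι → MvPolynomial σ ℂ) :
    coeffNorm (∑ i ∈ s, f i) ≤ ∑ i ∈ s, coeffNorm (f i) := by
  classical
  induction s using Finset.induction_on with
  | empty => simp [coeffNorm]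
  | insert i s hi ih =>
    rw [Finset.sum_insert hi, Finset.sum_insert hi]
    exact (coeffNorm_add_le _ _).trans (by linarith)

theorem coeffNorm_monomial (a : σ →₀ ℕ) (c : ℂ) :
    coeffNorm (MvPolynomial.monomial a c) = ‖c‖ := by
  classical
  rw [coeffNorm_eq_sum_of_subset MvPolynomial.support_monomial_subset, Finset.sum_singleton,
    MvPolynomial.coeff_monomial, if_pos rfl]

/-- Submultiplicativity reduces absolute convergence over all monomials of `∑ cⱼ qʲ` to convergence
of the scalar series `∑ |cⱼ| ‖q‖ʲ`. -/
theorem coeffNorm_mul_le (p q : MvPolynomial σ ℂ) :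
    coeffNorm (p * q) ≤ coeffNorm p * coeffNorm q := by
  have h : p * q = ∑ a ∈ p.support, ∑ b ∈ q.support,
      MvPolynomial.monomial (a + b) (p.coeff a * q.coeff b) := by
    conv_lhs => rw [p.as_sum, q.as_sum]
    rw [Finset.sum_mul_sum]
    simp only [MvPolynomial.monomial_mul]
  have h2 : coeffNorm p * coeffNorm q =
      ∑ a ∈ p.support, ∑ b ∈ q.support, ‖p.coeff a‖ * ‖q.coeff b‖ := Finset.sum_mul_sum _ _ _ _
  rw [h, h2]
  refine (coeffNorm_sum_le _ _).trans (Finset.sum_le_sum fun a _ => ?_)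
  refine (coeffNorm_sum_le _ _).trans (Finset.sum_le_sum fun b _ => ?_)
  rw [coeffNorm_monomial, norm_mul]

theorem coeffNorm_C_mul_pow_le (c : ℂ) (p : MvPolynomial σ ℂ) (k : ℕ) :
    coeffNorm (MvPolynomial.C c * p ^ k) ≤ ‖c‖ * coeffNorm p ^ k := by
  induction k with
  | zero =>
    rw [pow_zero, mul_one, pow_zero, mul_one]
    exact (coeffNorm_monomial 0 c).le
  | succ k ih =>
    rw [pow_succ, ← mul_assoc, pow_succ, ← mul_assoc]
    exact (coeffNorm_mul_le _ _).trans (by gcongr; exact coeffNorm_nonneg _)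

theorem hasSum_norm_coeff (p : MvPolynomial σ ℂ) :
    HasSum (fun a => ‖p.coeff a‖) (coeffNorm p) :=
  hasSum_sum_of_ne_finset_zero fun a ha => by
    rw [MvPolynomial.notMem_support_iff.mp ha, norm_zero]

theorem hasSum_coeff (p : MvPolynomial σ ℂ) :
    HasSum (fun a => p.coeff a) (MvPolynomial.eval (fun _ => 1) p) := by
  rw [MvPolynomial.eval_eq]
  simp only [one_pow, Finset.prod_const_one, mul_one]
  exact hasSum_sum_of_ne_finset_zero fun a ha => MvPolynomial.notMem_support_iff.mp ha

/-- Summing a sequence of polynomials with disjoint supports, coefficientwise. -/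
theorem hasSum_coeff_of_grading {p : ℕ → MvPolynomial σ ℂ} {c : ℕ → ℂ} {q : MvPolynomial σ ℂ}
    (hp : ∀ j, p j = MvPolynomial.C (c j) * q ^ j)
    (hc : Summable fun j => ‖c j‖ * coeffNorm q ^ j) (deg : (σ →₀ ℕ) → ℕ)
    (hdeg : ∀ j a, (p j).coeff a ≠ 0 → deg a = j) {S : ℂ}
    (hS : HasSum (fun j => MvPolynomial.eval (fun _ => 1) (p j)) S) :
    HasSum (fun a => (p (deg a)).coeff a) S := by
  have hsum : Summable fun x : ℕ × (σ →₀ ℕ) => ‖(p x.1).coeff x.2‖ := by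
    refine (summable_prod_of_nonneg fun _ => norm_nonneg _).mpr
      ⟨fun j => (hasSum_norm_coeff (p j)).summable, ?_⟩
    refine Summable.of_nonneg_of_le (fun j => tsum_nonneg fun _ => norm_nonneg _) (fun j => ?_) hc
    rw [(hasSum_norm_coeff (p j)).tsum_eq, hp]
    exact coeffNorm_C_mul_pow_le _ _ _
  have h1 := hsum.of_norm.hasSum
  have h2 := h1.prod_fiberwise fun j => hasSum_coeff (p j)
  rw [h2.unique hS] at h1
  have hinj : Function.Injective fun a : σ →₀ ℕ => (deg a, a) := fun a b h => (Prod.mk.inj h).2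
  refine (hinj.hasSum_iff ?_).mpr h1
  rintro ⟨j, a⟩ hja
  by_contra h
  exact hja ⟨a, by simp [hdeg j a h]⟩

end l1

/-! ### The wave operator -/

/-- The substitution of numbers for `∂`, and rescaling of `q`, `q'`. -/
def scaleHom (q q' κ : E d) : GenPoly d →+* MvPolynomial (Fin d ⊕ Fin d) ℂ :=
  MvPolynomial.eval₂Hom
    ((MvPolynomial.C).comp (MvPolynomial.eval fun i => (κ i : ℂ)))
    fun i => MvPolynomial.C (Sum.elim (fun i => (q' i : ℂ)) (fun i => (q i : ℂ)) i) *
      MvPolynomial.X i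

/-- With the numbers `q`, `q'` absorbed into the coefficients, each coefficient is the value of one
monomial. Thus `coeffNorm` controls the sum of the absolute values of the monomials at the given
point. -/
theorem coeff_scaleHom (q q' κ : E d) (G : GenPoly d) (a : Fin d ⊕ Fin d →₀ ℕ) :
    (scaleHom q q' κ G).coeff a = MvPolynomial.eval (fun i => (κ i : ℂ)) (G.coeff a) *
      ∏ i, Sum.elim (fun i => (q' i : ℂ)) (fun i => (q i : ℂ)) i ^ a i := by
  classical
  induction G using MvPolynomial.induction_on' with
  | monomial b c =>
    have h : scaleHom q q' κ (MvPolynomial.monomial b c) = MvPolynomial.monomial b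
        (MvPolynomial.eval (fun i => (κ i : ℂ)) c *
          ∏ i, Sum.elim (fun i => (q' i : ℂ)) (fun i => (q i : ℂ)) i ^ b i) := by
      rw [scaleHom, MvPolynomial.coe_eval₂Hom, MvPolynomial.eval₂_monomial,
        Finsupp.prod_fintype _ _ (fun _ => pow_zero _)]
      simp only [mul_pow, Finset.prod_mul_distrib, ← map_pow, ← map_prod]
      rw [MvPolynomial.monomial_eq, Finsupp.prod_fintype _ _ (fun _ => pow_zero _)]
      simp only [RingHom.comp_apply, map_mul]
      ring
    rw [h, MvPolynomial.coeff_monomial, MvPolynomial.coeff_monomial]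
    split_ifs with hab
    · rw [hab]
    · simp
  | add p q hp hq => rw [map_add, MvPolynomial.coeff_add, hp, hq, MvPolynomial.coeff_add, map_add,
      add_mul]

theorem eval_one_scaleHom (q q' κ : E d) (G : GenPoly d) :
    MvPolynomial.eval (fun _ => 1) (scaleHom q q' κ G) = evalGen G q q' κ := by
  rw [scaleHom, evalGen]
  have h := MvPolynomial.hom_eval₂ G
    ((MvPolynomial.C).comp (MvPolynomial.eval fun i => (κ i : ℂ)))
    (MvPolynomial.eval (fun _ : Fin d ⊕ Fin d => (1 : ℂ)))
    (fun i => MvPolynomial.C (Sum.elim (fun i => (q' i : ℂ)) (fun i => (q i : ℂ)) i) *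
      MvPolynomial.X i)
  rw [MvPolynomial.coe_eval₂Hom, h]
  congr 1
  · ext x
    · simp
    · simp
  · funext i
    simp

/-- `(q' + q)² □ - ((q' + q) ∂)²`. -/
def loopPoly : GenPoly d := rhoSq + rhoSq' + 2 * tauPoly

theorem evalGen_genConst_mul_loopPoly_pow (c : ℝ) (j : ℕ) (q q' κ : E d) :
    evalGen (genConst c * loopPoly ^ j) q q' κ = ((c * rhoVal (q + q') κ ^ j : ℝ) : ℂ) := by
  obtain ⟨φ, hφ⟩ : ∃ φ : GenPoly d →+* ℂ, φ = MvPolynomial.eval₂Hom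
      (MvPolynomial.eval fun i => (κ i : ℂ))
      (Sum.elim (fun i => (q' i : ℂ)) fun i => (q i : ℂ)) := ⟨_, rfl⟩
  have hev : ∀ G, evalGen G q q' κ = φ G := fun G => by rw [hφ]; rfl
  have hq : ∀ i, φ (qv i) = (q i : ℂ) := fun i => by rw [hφ]; simp [qv]
  have hq' : ∀ i, φ (qv' i) = (q' i : ℂ) := fun i => by rw [hφ]; simp [qv']
  have hd : ∀ i, φ (dv i) = (κ i : ℂ) := fun i => by rw [hφ]; simp [dv]
  have hc : φ (genConst c) = c := by rw [hφ, genConst_apply]; simp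
  have hbox : φ boxPoly = ((‖κ‖ ^ 2 : ℝ) : ℂ) := by
    rw [boxPoly, map_sum, EuclideanSpace.real_norm_sq_eq, Complex.ofReal_sum]
    exact Finset.sum_congr rfl fun i _ => by rw [map_mul, hd]; push_cast; ring
  have hinner : ∀ (f g : Fin d → GenPoly d) (x y : E d), (∀ i, φ (f i) = (x i : ℂ)) →
      (∀ i, φ (g i) = (y i : ℂ)) → φ (∑ i, f i * g i) = ((inner ℝ x y : ℝ) : ℂ) := by
    intro f g x y hf hg
    rw [map_sum, PiLp.inner_apply, Complex.ofReal_sum]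
    exact Finset.sum_congr rfl fun i _ => by
      rw [map_mul, hf, hg, real_inner_eq_re_inner]; simp; ring
  have hloop : φ loopPoly = ((rhoVal (q + q') κ : ℝ) : ℂ) := by
    rw [rhoVal_add, loopPoly, rhoSq, rhoSq', tauPoly, rhoVal, rhoVal, tauVal]
    simp only [map_add, map_sub, map_mul, map_pow, hbox, hinner _ _ q q hq hq,
      hinner _ _ q κ hq hd, hinner _ _ q' q' hq' hq', hinner _ _ q' κ hq' hd,
      hinner _ _ q q' hq hq', real_inner_self_eq_norm_sq, map_ofNat]
    push_cast
    ring
  rw [hev, map_mul, map_pow, hc, hloop]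
  push_cast
  rfl

/-- The coefficient of `ρ²ʲ` in the generating function of the wave operator. -/
def loopCoeff (d : ℕ) (ħ : ℝ) (j : ℕ) : ℝ :=
  kappa d ħ * (ħ / 2) ^ ((d : ℝ) - 4) * (besselCoeff (((d : ℝ) - 3) / 2) j * (-(ħ ^ 2 / 4)) ^ j)

/-- The part of order `2j` of the generating function of the wave operator. -/
def loopGen (ħ : ℝ) (j : ℕ) : GenPoly d := genConst (loopCoeff d ħ j) * loopPoly ^ j

/-- The wave operator of the quadratic action, without `□^{d/2-2}`. -/
def loopOperator (ħ : ℝ) : WaveOp d := fun α γ =>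
  components (loopGen ħ (((∑ i, α i) + ∑ i, γ i) / 2)) α γ

theorem hasOrder_loopPoly : HasOrder 2 (loopPoly : GenPoly d) := by
  rw [loopPoly]
  exact (hasOrder_rhoSq.add hasOrder_rhoSq').add (by simpa using hasOrder_two.mul hasOrder_tauPoly)

theorem hasOrder_loopGen (ħ : ℝ) (j : ℕ) : HasOrder (2 * j) (loopGen ħ j : GenPoly d) := by
  rw [loopGen]
  simpa using (hasOrder_genConst _).mul (hasOrder_loopPoly.pow j)

theorem isWeightedHomogeneous_loopGen (ħ : ℝ) (j : ℕ) :
    MvPolynomial.IsWeightedHomogeneous (sideWeight 1 1) (loopGen ħ j : GenPoly d) (2 * j) := by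
  have h : MvPolynomial.IsWeightedHomogeneous (sideWeight 1 1) (loopPoly : GenPoly d) 2 :=
    ((isWeightedHomogeneous_rhoSq 1 1).add (isWeightedHomogeneous_rhoSq' 1 1)).add
      (isWeightedHomogeneous_two_mul_tauPoly 1 1)
  have := (isWeightedHomogeneous_genConst 1 1 (loopCoeff d ħ j)).mul (h.pow j)
  rw [loopGen]
  convert this using 1
  simp [mul_comm]

theorem coeff_loopGen_eq_zero (ħ : ℝ) {j : ℕ} {a : Fin d ⊕ Fin d →₀ ℕ}
    (h : (∑ i, a (Sum.inl i)) + ∑ i, a (Sum.inr i) ≠ 2 * j) : (loopGen ħ j).coeff a = 0 :=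
  (isWeightedHomogeneous_loopGen ħ j).coeff_eq_zero a (by
    rw [weight_sideWeight, mul_one, mul_one]; exact h)

theorem isHomogeneous_loopOperator (ħ : ℝ) (α γ : Fin d →₀ ℕ) :
    (loopOperator ħ α γ).IsHomogeneous ((∑ i, α i) + ∑ i, γ i) := by
  rw [loopOperator, components]
  set N := (∑ i, α i) + ∑ i, γ i with hN
  rcases Nat.even_or_odd' N with ⟨j, hj | hj⟩
  · have h : N / 2 = j := by omega
    rw [h, hj, nsmul_eq_mul]
    have h1 := hasOrder_loopGen (d := d) ħ j (Finsupp.sumElim α γ)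
    have h2 := (MvPolynomial.isHomogeneous_C (Fin d)
      ((multiFactorial α * multiFactorial γ : ℕ) : ℂ)).mul h1
    simpa using h2
  -- For odd `N` the quotient `N / 2` rounds down, and the coefficient vanishes because `loopGen`
  -- has even total degree.
  · rw [coeff_loopGen_eq_zero, smul_zero]
    · exact MvPolynomial.isHomogeneous_zero _ _ _
    · simp only [Finsupp.sumElim_inl, Finsupp.sumElim_inr]
      omega

theorem prod_sumElim_pow (q q' : E d) (a : Fin d ⊕ Fin d →₀ ℕ) :
    ∏ i, Sum.elim (fun i => (q' i : ℂ)) (fun i => (q i : ℂ)) i ^ a i =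
      (((∏ i, q' i ^ a (Sum.inl i)) * ∏ i, q i ^ a (Sum.inr i) : ℝ) : ℂ) := by
  rw [Fintype.prod_sum_type]
  simp

/-- The `j`-th term of the Bessel series is homogeneous of degree `2j` in `(q, q')`, so each
monomial belongs to at most one `j`. The power series in `ρ²` can therefore be rearranged into a
series over monomials. -/
theorem hasSum_loopGen (hd : 2 < d) {ħ : ℝ} (hħ : 0 < ħ) (q q' κ : E d) :
    HasSum (fun a : Fin d ⊕ Fin d →₀ ℕ => (((‖κ‖ ^ 2) ^ ((d : ℝ) / 2 - 2) : ℝ) : ℂ) *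
      (MvPolynomial.eval (fun i => (κ i : ℂ))
        ((loopGen ħ (((∑ i, a (Sum.inl i)) + ∑ i, a (Sum.inr i)) / 2)).coeff a) *
        (((∏ i, q' i ^ a (Sum.inl i)) * ∏ i, q i ^ a (Sum.inr i) : ℝ) : ℂ)))
      (genFun ħ q q' κ) := by
  have hν : 0 ≤ ((d : ℝ) - 3) / 2 := by
    have : (3 : ℝ) ≤ d := by exact_mod_cast hd
    linarith
  set S : ℂ := ((kappa d ħ * (ħ / 2) ^ ((d : ℝ) - 4) : ℝ) : ℂ) *
    besselReg (((d : ℝ) - 3) / 2) ((-(ħ ^ 2 / 4) * rhoVal (q + q') κ : ℝ) : ℂ) with hS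
  have hgen : genFun ħ q q' κ = (((‖κ‖ ^ 2) ^ ((d : ℝ) / 2 - 2) : ℝ) : ℂ) * S := by
    rw [genFun_eq hħ, hS]; push_cast; ring
  rw [hgen]
  refine hasSum_const_mul ?_ _
  have hp : ∀ j, scaleHom q q' κ (loopGen ħ j) =
      MvPolynomial.C ((loopCoeff d ħ j : ℝ) : ℂ) * scaleHom q q' κ loopPoly ^ j := by
    intro j
    rw [loopGen, map_mul, map_pow, genConst_apply]
    congr 1
    simp [scaleHom]
  set M := coeffNorm (scaleHom q q' κ loopPoly)
  have hsum : Summable fun j => ‖((loopCoeff d ħ j : ℝ) : ℂ)‖ * M ^ j := by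
    have h := (summable_norm_besselReg hν ((-(ħ ^ 2 / 4) * M : ℝ) : ℂ)).mul_left
      |kappa d ħ * (ħ / 2) ^ ((d : ℝ) - 4)|
    refine h.congr fun j => ?_
    have hM : 0 ≤ M := coeffNorm_nonneg _
    rw [loopCoeff, Complex.norm_real, Real.norm_eq_abs, abs_mul _ (_ * _), mul_assoc, norm_mul,
      norm_pow, Complex.norm_real, Complex.norm_real, Real.norm_eq_abs, Real.norm_eq_abs,
      abs_mul _ M, abs_of_nonneg hM, mul_pow, abs_mul (besselCoeff _ _), abs_pow, mul_assoc]
  have hval : HasSum (fun j => MvPolynomial.eval (fun _ => 1) (scaleHom q q' κ (loopGen ħ j))) S := by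
    have h := hasSum_const_mul (hasSum_besselReg hν
      ((-(ħ ^ 2 / 4) * rhoVal (q + q') κ : ℝ) : ℂ)) ((kappa d ħ * (ħ / 2) ^ ((d : ℝ) - 4) : ℝ) : ℂ)
    refine (congrArg (HasSum · S) (funext fun j => ?_)).mpr h
    rw [eval_one_scaleHom, loopGen, evalGen_genConst_mul_loopPoly_pow, loopCoeff]
    push_cast
    rw [mul_pow]
    ring
  have hmain := hasSum_coeff_of_grading hp hsum
    (fun a => ((∑ i, a (Sum.inl i)) + ∑ i, a (Sum.inr i)) / 2) (fun j a ha => ?_) hval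
  · refine (congrArg (HasSum · S) (funext fun a => ?_)).mpr hmain
    rw [coeff_scaleHom, prod_sumElim_pow]
  · rw [coeff_scaleHom] at ha
    have h1 : (loopGen ħ j).coeff a ≠ 0 := fun h => ha (by rw [h, map_zero, zero_mul])
    have h2 : (∑ i, a (Sum.inl i)) + ∑ i, a (Sum.inr i) = 2 * j := by
      by_contra h
      exact h1 (coeff_loopGen_eq_zero ħ h)
    simp only [h2]
    omega

theorem multiFactorial_ne_zero (α : Fin d →₀ ℕ) : (multiFactorial α : ℂ) ≠ 0 := by
  rw [multiFactorial]
  exact_mod_cast Finset.prod_ne_zero_iff.mpr fun i _ => (α i).factorial_ne_zero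

theorem isWaveOperator_loopOperator (hd : 2 < d) {ħ : ℝ} (hħ : 0 < ħ) :
    IsWaveOperator ħ (loopOperator ħ : WaveOp d) := by
  intro q q' κ hκ
  refine ⟨_, isGenFun_genFun hd hħ q q' hκ, ?_⟩
  have h := hasSum_loopGen hd hħ q q' κ
  rw [← (Finsupp.sumFinsuppEquivProdFinsupp (α := Fin d) (β := Fin d) (γ := ℕ)).symm.hasSum_iff] at h
  refine (congrArg (HasSum · _) (funext fun ab => ?_)).mpr h
  obtain ⟨α, γ⟩ := ab
  have e : (Finsupp.sumFinsuppEquivProdFinsupp (α := Fin d) (β := Fin d) (γ := ℕ)).symm (α, γ) =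
      Finsupp.sumElim α γ := rfl
  simp only [Function.comp_apply, e, Finsupp.sumElim_inl, Finsupp.sumElim_inr, loopOperator,
    components]
  have h1 := multiFactorial_ne_zero α
  have h2 := multiFactorial_ne_zero γ
  rw [nsmul_eq_mul, map_mul, map_natCast]
  push_cast
  field_simp

/-! ### Uniqueness of the wave operator -/

theorem eq_zero_of_hasSum_pow_mul {c : ℕ → ℂ}
    (h : ∀ t : ℝ, HasSum (fun n : ℕ => (t : ℂ) ^ n * c n) 0) : c = 0 := by
  set p : FormalMultilinearSeries ℝ ℝ ℂ := fun n => ContinuousMultilinearMap.mkPiRing ℝ (Fin n) (c n)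
  have hc : ∀ n, p.coeff n = c n := fun n => by
    simp [p, FormalMultilinearSeries.coeff]
  have hp : HasFPowerSeriesAt (0 : ℝ → ℂ) p 0 := by
    refine hasFPowerSeriesAt_iff.mpr (Filter.Eventually.of_forall fun t => ?_)
    refine (congrArg (HasSum · _) (funext fun n => ?_)).mpr (h t)
    rw [hc, Complex.real_smul]
    push_cast
    rfl
  funext n
  rw [← hc n, hp.eq_zero]
  simp [FormalMultilinearSeries.coeff]

/-- Restricting to the rays `t ↦ t x` separates the homogeneous parts, by uniqueness of one-variable
power series. Each part is a polynomial vanishing at all real points, hence zero. -/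
theorem eq_zero_of_hasSum_monomial {σ : Type*} [Fintype σ] {D : (σ →₀ ℕ) → ℂ}
    (h : ∀ x : σ → ℝ, HasSum (fun a => D a * ((∏ i, x i ^ a i : ℝ) : ℂ)) 0) : D = 0 := by
  classical
  set P : ℕ → MvPolynomial σ ℂ := fun n => ∑ a ∈ (Finset.univ : Finset σ).finsuppAntidiag n,
    MvPolynomial.monomial a (D a) with hP
  have heval : ∀ (x : σ → ℝ) n, MvPolynomial.eval (fun i => (x i : ℂ)) (P n) =
      ∑ a ∈ (Finset.univ : Finset σ).finsuppAntidiag n, D a * ((∏ i, x i ^ a i : ℝ) : ℂ) := by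
    intro x n
    rw [hP, map_sum]
    refine Finset.sum_congr rfl fun a _ => ?_
    rw [MvPolynomial.eval_monomial, Finsupp.prod_fintype _ _ (fun _ => pow_zero _)]
    push_cast
    rfl
  have hray : ∀ (x : σ → ℝ), (fun n => MvPolynomial.eval (fun i => (x i : ℂ)) (P n)) = 0 := by
    intro x
    refine eq_zero_of_hasSum_pow_mul fun t => ?_
    have h1 := h fun i => t * x i
    have h2 := ((Equiv.sigmaFiberEquiv fun a : σ →₀ ℕ => ∑ i, a i).hasSum_iff).mpr h1
    refine h2.sigma fun n => ?_
    have h3 := Finset.hasSum ((Finset.univ : Finset σ).finsuppAntidiag n)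
      (fun a => D a * ((∏ i, (t * x i) ^ a i : ℝ) : ℂ))
    have e : MvPolynomial.eval (fun i => (x i : ℂ)) (P n) * (t : ℂ) ^ n =
        ∑ a ∈ (Finset.univ : Finset σ).finsuppAntidiag n, D a * ((∏ i, (t * x i) ^ a i : ℝ) : ℂ) := by
      rw [heval, Finset.sum_mul]
      refine Finset.sum_congr rfl fun a ha => ?_
      have ha' : ∑ i, a i = n := by simpa [Finset.mem_finsuppAntidiag] using ha
      simp only [mul_pow, Finset.prod_mul_distrib, Finset.prod_pow_eq_pow_sum, ha']
      push_cast
      ring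
    rw [mul_comm, e]
    let eqv : {a : σ →₀ ℕ // ∑ i, a i = n} ≃ ((Finset.univ : Finset σ).finsuppAntidiag n) :=
      Equiv.subtypeEquivRight fun a => by simp [Finset.mem_finsuppAntidiag]
    exact (eqv.hasSum_iff).mpr h3
  have hzero : ∀ n, P n = 0 := by
    intro n
    refine MvPolynomial.funext_set (fun _ => Set.range ((↑) : ℝ → ℂ))
      (fun _ => Set.infinite_range_of_injective Complex.ofReal_injective) fun y hy => ?_
    choose x hx using fun i => hy i (Set.mem_univ i)
    rw [← funext hx, map_zero]
    exact congrFun (hray x) n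
  funext a
  have h1 := congrArg (MvPolynomial.coeff a) (hzero (∑ i, a i))
  rw [hP, MvPolynomial.coeff_sum, Finset.sum_eq_single a] at h1
  · simpa using h1
  · intro b _ hb
    rw [MvPolynomial.coeff_monomial, if_neg hb]
  · intro ha
    exact absurd (by simp [Finset.mem_finsuppAntidiag]) ha

/-- For fixed `κ ≠ 0` the generating function is determined, hence so are its coefficients in `q`,
`q'`. This fixes the values of the polynomials `V α γ` at all nonzero real `κ`. -/
theorem IsWaveOperator.unique (hd : 2 < d) {ħ : ℝ} (hħ : 0 < ħ) {V V' : WaveOp d}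
    (h : IsWaveOperator ħ V) (h' : IsWaveOperator ħ V') : V = V' := by
  have hpos : ∀ κ : E d, κ ≠ 0 → ∀ α γ, MvPolynomial.eval (fun i => (κ i : ℂ)) (V α γ) =
      MvPolynomial.eval (fun i => (κ i : ℂ)) (V' α γ) := by
    intro κ hκ
    set B : ℂ := (((‖κ‖ ^ 2) ^ ((d : ℝ) / 2 - 2) : ℝ) : ℂ) with hB
    have hB0 : B ≠ 0 := by
      have : 0 < ‖κ‖ := norm_pos_iff.mpr hκ
      rw [hB]
      exact_mod_cast (by positivity : (0 : ℝ) < (‖κ‖ ^ 2) ^ ((d : ℝ) / 2 - 2)).ne'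
    let D : (Fin d ⊕ Fin d →₀ ℕ) → ℂ := fun a =>
      B * (1 / (multiFactorial (Finsupp.sumFinsuppEquivProdFinsupp a).1 *
        multiFactorial (Finsupp.sumFinsuppEquivProdFinsupp a).2)) *
      (MvPolynomial.eval (fun i => (κ i : ℂ)) (V (Finsupp.sumFinsuppEquivProdFinsupp a).1
          (Finsupp.sumFinsuppEquivProdFinsupp a).2) -
        MvPolynomial.eval (fun i => (κ i : ℂ)) (V' (Finsupp.sumFinsuppEquivProdFinsupp a).1
          (Finsupp.sumFinsuppEquivProdFinsupp a).2))
    have hD : D = 0 := by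
      refine eq_zero_of_hasSum_monomial fun x => ?_
      obtain ⟨P, hP, hs⟩ := h (WithLp.toLp 2 fun i => x (Sum.inr i))
        (WithLp.toLp 2 fun i => x (Sum.inl i)) κ hκ
      obtain ⟨P', hP', hs'⟩ := h' (WithLp.toLp 2 fun i => x (Sum.inr i))
        (WithLp.toLp 2 fun i => x (Sum.inl i)) κ hκ
      have hs2 := hs.sub hs'
      rw [hP.eq_genFun hd hħ hκ, hP'.eq_genFun hd hħ hκ, sub_self,
        ← (Finsupp.sumFinsuppEquivProdFinsupp (α := Fin d) (β := Fin d) (γ := ℕ)).hasSum_iff] at hs2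
      refine (congrArg (HasSum · _) (funext fun a => ?_)).mpr hs2
      simp only [D, Function.comp_apply, Fintype.prod_sum_type, hB]
      push_cast
      simp only [Finsupp.sumFinsuppEquivProdFinsupp]
      simp
      ring
    intro α γ
    have h1 := congrFun hD (Finsupp.sumElim α γ)
    have e : Finsupp.sumFinsuppEquivProdFinsupp (Finsupp.sumElim α γ) = (α, γ) :=
      (Finsupp.sumFinsuppEquivProdFinsupp (α := Fin d) (β := Fin d) (γ := ℕ)).apply_symm_apply (α, γ)
    simp only [D, e, Pi.zero_apply] at h1
    have hne : B * (1 / ((multiFactorial α : ℂ) * multiFactorial γ)) ≠ 0 :=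
      mul_ne_zero hB0 (one_div_ne_zero
        (mul_ne_zero (multiFactorial_ne_zero α) (multiFactorial_ne_zero γ)))
    exact sub_eq_zero.mp ((mul_eq_zero.mp h1).resolve_left hne)
  funext α γ
  -- Points with all coordinates positive avoid `κ = 0` and still form a product of infinite sets,
  -- which suffices to determine a polynomial.
  refine MvPolynomial.funext_set (fun _ => ((↑) : ℝ → ℂ) '' Set.Ioi 0)
    (fun _ => (Set.Ioi_infinite 0).image Complex.ofReal_injective.injOn) fun y hy => ?_
  choose x hx hxy using fun i => hy i (Set.mem_univ i)
  have hne : (WithLp.toLp 2 x : E d) ≠ 0 := by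
    intro h0
    have := congrArg (fun v : E d => v ⟨0, by omega⟩) h0
    exact (hx ⟨0, by omega⟩).ne' (by simpa using this)
  have := hpos _ hne α γ
  rw [← funext hxy]
  exact this

/-! ### The pairings `∫ A □^{d/2-2} B` -/

theorem opD_apply (i : Fin d) (f : 𝓢(E d, ℂ)) :
    opD i f = LineDeriv.lineDerivOp (EuclideanSpace.single i (1 : ℝ) : E d) f := rfl

theorem opD_comm (i j : Fin d) : Commute (opD i) (opD j) := by
  refine LinearMap.ext fun f => ?_
  ext x
  have key : ∀ a b : Fin d, (opD a * opD b) f x =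
      iteratedFDeriv ℝ 2 f x ![EuclideanSpace.single a 1, EuclideanSpace.single b 1] := by
    intro a b
    rw [← SchwartzMap.iteratedLineDerivOp_eq_iteratedFDeriv, LineDeriv.iteratedLineDerivOp_succ_left,
      LineDeriv.iteratedLineDerivOp_one]
    rfl
  rw [key, key]
  have h := (f.smooth 2).contDiffAt.isSymmSndFDerivAt (x := x)
    (by rw [minSmoothness_of_isRCLikeNormedField]; norm_cast)
  rw [iteratedFDeriv_two_apply, iteratedFDeriv_two_apply]
  exact h.eq _ _

/-- Bilinear forms for which the derivatives are antisymmetric. -/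
structure IsSkewPairing (b : 𝓢(E d, ℂ) → 𝓢(E d, ℂ) → ℂ) : Prop where
  add_left : ∀ A A' B, b (A + A') B = b A B + b A' B
  add_right : ∀ A B B', b A (B + B') = b A B + b A B'
  smul_left : ∀ (c : ℂ) A B, b (c • A) B = c * b A B
  smul_right : ∀ (c : ℂ) A B, b A (c • B) = c * b A B
  opD_left : ∀ i A B, b (opD i A) B = -b A (opD i B)

theorem laplacian_eq_sum_opD (f : 𝓢(E d, ℂ)) :
    Δ f = (∑ i, opD i * opD i : Module.End ℂ 𝓢(E d, ℂ)) f := by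
  rw [SchwartzMap.laplacian_eq_sum (EuclideanSpace.basisFun (Fin d) ℝ), LinearMap.sum_apply]
  simp only [EuclideanSpace.basisFun_apply]
  rfl

theorem iterate_laplacian (n : ℕ) (f : 𝓢(E d, ℂ)) :
    (fun C : 𝓢(E d, ℂ) => Δ C)^[n] f = ((∑ i, opD i * opD i) ^ n : Module.End ℂ 𝓢(E d, ℂ)) f := by
  rw [Module.End.pow_apply]
  congr 1
  funext C
  exact laplacian_eq_sum_opD C

theorem integrable_schwartz_mul (A B : 𝓢(E d, ℂ)) : MeasureTheory.Integrable fun x => A x * B x :=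
  (SchwartzMap.pairing (ContinuousLinearMap.mul ℂ ℂ) A B).integrable

/-- Integration by parts, together with the fact that powers of the Laplacian commute with each
`∂ᵢ`. -/
theorem isSkewPairing_localPairing :
    IsSkewPairing (localPairing : 𝓢(E d, ℂ) → 𝓢(E d, ℂ) → ℂ) := by
  set L : Module.End ℂ 𝓢(E d, ℂ) := (∑ i, opD i * opD i) ^ (d / 2 - 2) with hL
  have hb : ∀ A B : 𝓢(E d, ℂ), localPairing A B = ∫ x, A x * L B x := fun A B => by
    rw [localPairing, iterate_laplacian]
  have hcomm : ∀ i, Commute L (opD i) := fun i =>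
    (Commute.sum_left _ _ _ fun j _ => (opD_comm j i).mul_left (opD_comm j i)).pow_left _
  refine ⟨fun A A' B => ?_, fun A B B' => ?_, fun c A B => ?_, fun c A B => ?_, fun i A B => ?_⟩
  · simp only [hb, add_apply, add_mul]
    exact MeasureTheory.integral_add (integrable_schwartz_mul _ _) (integrable_schwartz_mul _ _)
  · simp only [hb, map_add, add_apply, mul_add]
    exact MeasureTheory.integral_add (integrable_schwartz_mul _ _) (integrable_schwartz_mul _ _)
  · simp only [hb, smul_apply, smul_eq_mul, mul_assoc]
    exact MeasureTheory.integral_const_mul _ _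
  · simp only [hb, map_smul, smul_apply, smul_eq_mul, mul_left_comm _ c]
    exact MeasureTheory.integral_const_mul _ _
  · have h1 : L (opD i B) = opD i (L B) := LinearMap.congr_fun (hcomm i) B
    rw [hb, hb, h1, opD_apply, opD_apply, SchwartzMap.integral_mul_lineDerivOp_right_eq_neg_left,
      neg_neg]

theorem fourier_opD (i : Fin d) (A : 𝓢(E d, ℂ)) (k : E d) :
    (𝓕 (opD i A)) k = 2 * Real.pi * Complex.I * (k i : ℂ) * (𝓕 A) k := by
  rw [opD_apply, SchwartzMap.fourier_lineDerivOp_eq]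
  have : (fun k : E d => inner ℝ k (EuclideanSpace.single i (1 : ℝ) : E d)).HasTemperateGrowth := by
    fun_prop
  rw [smul_apply, SchwartzMap.smulLeftCLM_apply_apply this]
  simp [EuclideanSpace.inner_single_right]
  ring

theorem fourierPairing_eq (r : E d → ℂ) (A B : 𝓢(E d, ℂ)) :
    fourierPairing r A B = ∫ k, (𝓕 A) (-k) * r k * (𝓕 B) k := by
  rw [fourierPairing]
  rfl

/-- Whatever signs are chosen for the square root, its modulus is fixed, and integrability depends
on the modulus only. -/
theorem IsOddBoxRoot.norm_eq {r : E d → ℂ} (hr : IsOddBoxRoot r) :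
    ∀ᵐ k : E d, ‖r k‖ = (2 * Real.pi * ‖k‖) ^ ((d : ℤ) - 4) := by
  filter_upwards [hr.2.2] with k hk
  have h := congrArg norm hk
  rw [norm_pow, norm_zpow, norm_neg, norm_mul, norm_mul, norm_pow, Complex.norm_real,
    Complex.norm_real, Real.norm_of_nonneg Real.pi_pos.le, Real.norm_of_nonneg (by positivity)] at h
  refine (sq_eq_sq₀ (norm_nonneg _) (by positivity)).mp ?_
  rw [h, sq (_ ^ _), ← mul_zpow]
  congr 1
  norm_num
  ring

/-- In polar coordinates the radial power is `(d-1) + (d-4) = 2d - 5 ≥ 1`, so the singularity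
`|k|⁻¹` for `d = 3` is harmless. The decay `-2d` leaves `(1 + y)^{-5}`. -/
theorem integrable_zpow_norm_mul_one_add_norm (hd : 2 < d) :
    MeasureTheory.Integrable fun k : E d => ‖k‖ ^ ((d : ℤ) - 4) * (1 + ‖k‖) ^ (-(2 * d : ℝ)) := by
  have : Nontrivial (E d) := by
    refine ⟨0, EuclideanSpace.single ⟨0, by omega⟩ 1, fun h => ?_⟩
    have := congrArg (fun v : E d => v ⟨0, by omega⟩) h
    simp at this
  have h := (MeasureTheory.integrable_fun_norm_addHaar (E := E d) MeasureTheory.volume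
    (f := fun y : ℝ => y ^ ((d : ℤ) - 4) * (1 + y) ^ (-(2 * d : ℝ)))).mpr ?_
  · exact h
  · rw [finrank_euclideanSpace_fin]
    have h1 := (integrable_one_add_norm (E := ℝ) (μ := MeasureTheory.volume) (r := 5)
      (by simp)).integrableOn (s := Set.Ioi 0)
    refine h1.mono' ?_ ((MeasureTheory.ae_restrict_iff' measurableSet_Ioi).mpr
      (Filter.Eventually.of_forall fun y hy => ?_))
    · exact Measurable.aestronglyMeasurable (by fun_prop)
    · have hy0 : 0 < y := hy
      have e1 : y ^ (d - 1) * (y ^ ((d : ℤ) - 4) * (1 + y) ^ (-(2 * d : ℝ))) =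
          y ^ (2 * d - 5) * (1 + y) ^ (-(2 * d : ℝ)) := by
        rw [← mul_assoc, ← zpow_natCast, ← zpow_natCast, ← zpow_add₀ hy0.ne']
        congr 2
        omega
      rw [smul_eq_mul, e1, Real.norm_of_nonneg (by positivity), Real.norm_of_nonneg hy0.le]
      calc y ^ (2 * d - 5) * (1 + y) ^ (-(2 * d : ℝ))
          ≤ (1 + y) ^ (2 * d - 5) * (1 + y) ^ (-(2 * d : ℝ)) := by
            gcongr
            linarith
        _ = (1 + y) ^ (-5 : ℝ) := by
            rw [← Real.rpow_natCast, ← Real.rpow_add (by positivity)]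
            congr 1
            rw [Nat.cast_sub (by omega)]
            push_cast
            ring

theorem exists_schwartz_decay (A : 𝓢(E d, ℂ)) (N : ℕ) :
    ∃ C : ℝ, 0 ≤ C ∧ ∀ k, ‖A k‖ ≤ C * (1 + ‖k‖) ^ (-(N : ℝ)) := by
  have h := A.one_add_le_sup_seminorm_apply (𝕜 := ℂ) (m := (N, 0)) (k := N) (n := 0) le_rfl le_rfl
  refine ⟨_, (by positivity : (0 : ℝ) ≤ _).trans (h 0), fun k => ?_⟩
  · have hk := h k
    rw [norm_iteratedFDeriv_zero] at hk
    have hp : (0 : ℝ) < (1 + ‖k‖) ^ N := by positivity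
    rw [Real.rpow_neg (by positivity), Real.rpow_natCast, ← div_eq_mul_inv, le_div_iff₀ hp, mul_comm]
    exact hk

theorem integrable_fourierPairing (hd : 2 < d) {r : E d → ℂ} (hr : IsOddBoxRoot r)
    (A B : 𝓢(E d, ℂ)) : MeasureTheory.Integrable fun k => A (-k) * r k * B k := by
  obtain ⟨C, hC, hA⟩ := exists_schwartz_decay A 0
  obtain ⟨C', hC', hB⟩ := exists_schwartz_decay B (2 * d)
  refine ((integrable_zpow_norm_mul_one_add_norm hd).const_mul
    (C * (2 * Real.pi) ^ ((d : ℤ) - 4) * C')).mono' ?_ ?_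
  · exact ((A.continuous.comp continuous_neg).measurable.mul hr.1).mul B.continuous.measurable
      |>.aestronglyMeasurable
  · filter_upwards [hr.norm_eq] with k hk
    have h1 := hA (-k)
    have h2 := hB k
    rw [Nat.cast_zero, neg_zero, Real.rpow_zero, mul_one] at h1
    rw [norm_mul, norm_mul, hk, mul_zpow]
    push_cast at h2
    calc _ ≤ C * ((2 * Real.pi) ^ ((d : ℤ) - 4) * ‖k‖ ^ ((d : ℤ) - 4)) *
          (C' * (1 + ‖k‖) ^ (-(2 * d : ℝ))) := by gcongr
      _ = _ := by ring

theorem isSkewPairing_fourierPairing (hd : 2 < d) {r : E d → ℂ} (hr : IsOddBoxRoot r) :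
    IsSkewPairing (fourierPairing r) := by
  have hi := fun A B : 𝓢(E d, ℂ) => integrable_fourierPairing hd hr (𝓕 A) (𝓕 B)
  refine ⟨fun A A' B => ?_, fun A B B' => ?_, fun c A B => ?_, fun c A B => ?_, fun i A B => ?_⟩
  · simp only [fourierPairing_eq]
    rw [← MeasureTheory.integral_add (hi _ _) (hi _ _)]
    refine MeasureTheory.integral_congr_ae (Filter.Eventually.of_forall fun k => ?_)
    simp only [FourierTransform.fourier_add, add_apply]
    ring
  · simp only [fourierPairing_eq]
    rw [← MeasureTheory.integral_add (hi _ _) (hi _ _)]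
    refine MeasureTheory.integral_congr_ae (Filter.Eventually.of_forall fun k => ?_)
    simp only [FourierTransform.fourier_add, add_apply]
    ring
  · simp only [fourierPairing_eq]
    rw [← MeasureTheory.integral_const_mul]
    refine MeasureTheory.integral_congr_ae (Filter.Eventually.of_forall fun k => ?_)
    simp only [FourierTransform.fourier_smul, smul_apply, smul_eq_mul]
    ring
  · simp only [fourierPairing_eq]
    rw [← MeasureTheory.integral_const_mul]
    refine MeasureTheory.integral_congr_ae (Filter.Eventually.of_forall fun k => ?_)
    simp only [FourierTransform.fourier_smul, smul_apply, smul_eq_mul]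
    ring
  · simp only [fourierPairing_eq]
    rw [← MeasureTheory.integral_neg]
    refine MeasureTheory.integral_congr_ae (Filter.Eventually.of_forall fun k => ?_)
    simp only [fourier_opD, PiLp.neg_apply, Complex.ofReal_neg]
    ring

/-- The substitution `k ↦ -k` exchanges the two transforms and reverses the sign of the odd symbol.
-/
theorem fourierPairing_antisymm {r : E d → ℂ} (hr : IsOddBoxRoot r) (A B : 𝓢(E d, ℂ)) :
    fourierPairing r A B = -fourierPairing r B A := by
  rw [fourierPairing_eq, fourierPairing_eq, ← MeasureTheory.integral_neg,
    ← MeasureTheory.integral_neg_eq_self]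
  refine MeasureTheory.integral_congr_ae (Filter.Eventually.of_forall fun k => ?_)
  simp only [neg_neg, hr.2.1 k]
  ring

theorem IsBoxPairing.isSkewPairing (hd : 2 < d) {b : 𝓢(E d, ℂ) → 𝓢(E d, ℂ) → ℂ}
    (hb : IsBoxPairing b) : IsSkewPairing b := by
  rcases hb with ⟨-, rfl⟩ | ⟨-, r, hr, rfl⟩
  · exact isSkewPairing_localPairing
  · exact isSkewPairing_fourierPairing hd hr

/-! ### Differential operators with constant coefficients -/

/-- `∂^a`. -/
def monoOp (a : Fin d →₀ ℕ) : Module.End ℂ 𝓢(E d, ℂ) :=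
  ((List.finRange d).map fun i => opD i ^ a i).prod

theorem commute_opD_pow_list_prod (i : Fin d) (n : ℕ) (a : Fin d → ℕ) (l : List (Fin d)) :
    Commute (opD i ^ n) ((l.map fun j => opD j ^ a j).prod) := by
  refine Commute.list_prod_right _ _ fun x hx => ?_
  obtain ⟨j, -, rfl⟩ := List.mem_map.mp hx
  exact (opD_comm i j).pow_pow _ _

/-- The operators live in a noncommutative ring, so `∂^a` is an ordered product; it is
multiplicative in `a` because partial derivatives commute. -/
theorem monoOp_add (a b : Fin d →₀ ℕ) : monoOp (a + b) = monoOp a * monoOp b := by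
  rw [monoOp, monoOp, monoOp]
  induction List.finRange d with
  | nil => simp
  | cons i l ih =>
    simp only [List.map_cons, List.prod_cons, Finsupp.add_apply, pow_add] at ih ⊢
    rw [ih, mul_assoc, mul_assoc, ← mul_assoc (opD i ^ b i),
      (commute_opD_pow_list_prod i (b i) a l).eq, mul_assoc]

theorem monoOp_single (i : Fin d) (n : ℕ) : monoOp (Finsupp.single i n) = opD i ^ n := by
  have h : ∀ l : List (Fin d), l.Nodup →
      (l.map fun j => opD j ^ (Finsupp.single i n) j).prod = if i ∈ l then opD i ^ n else 1 := by
    intro l hl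
    induction l with
    | nil => simp
    | cons j l ih =>
      obtain ⟨h1, h2⟩ := List.nodup_cons.mp hl
      rw [List.map_cons, List.prod_cons, ih h2]
      by_cases hij : i = j
      · subst hij
        simp [h1]
      · simp [hij]
  rw [monoOp, h _ (List.nodup_finRange d), if_pos (List.mem_finRange i)]

theorem monoOp_comm (a b : Fin d →₀ ℕ) : Commute (monoOp a) (monoOp b) := by
  rw [Commute, SemiconjBy, ← monoOp_add, ← monoOp_add, add_comm]

theorem diffOp_eq_sum {W : MvPolynomial (Fin d) ℂ} {S : Finset (Fin d →₀ ℕ)}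
    (h : W.support ⊆ S) : diffOp W = ∑ a ∈ S, W.coeff a • monoOp a :=
  Finset.sum_subset h fun a _ ha => by rw [MvPolynomial.notMem_support_iff.mp ha, zero_smul]

theorem diffOp_zero : diffOp (0 : MvPolynomial (Fin d) ℂ) = 0 := by
  simp [diffOp]

theorem diffOp_add (W W' : MvPolynomial (Fin d) ℂ) : diffOp (W + W') = diffOp W + diffOp W' := by
  classical
  rw [diffOp_eq_sum MvPolynomial.support_add, diffOp_eq_sum (W := W) Finset.subset_union_left,
    diffOp_eq_sum (W := W') Finset.subset_union_right, ← Finset.sum_add_distrib]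
  exact Finset.sum_congr rfl fun a _ => by rw [MvPolynomial.coeff_add, add_smul]

theorem diffOp_monomial (a : Fin d →₀ ℕ) (c : ℂ) :
    diffOp (MvPolynomial.monomial a c) = c • monoOp a := by
  classical
  rw [diffOp_eq_sum MvPolynomial.support_monomial_subset, Finset.sum_singleton,
    MvPolynomial.coeff_monomial, if_pos rfl]

theorem diffOp_X_mul (i : Fin d) (W : MvPolynomial (Fin d) ℂ) :
    diffOp (MvPolynomial.X i * W) = diffOp W * opD i := by
  induction W using MvPolynomial.induction_on' with
  | monomial a c =>
    have : (MvPolynomial.X i : MvPolynomial (Fin d) ℂ) * MvPolynomial.monomial a c =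
        MvPolynomial.monomial (a + Finsupp.single i 1) c := by
      rw [MvPolynomial.X, MvPolynomial.monomial_mul, one_mul, add_comm]
    rw [this, diffOp_monomial, diffOp_monomial, monoOp_add, monoOp_single, pow_one, smul_mul_assoc]
  | add p q hp hq => rw [mul_add, diffOp_add, hp, hq, diffOp_add, add_mul]

theorem diffOp_C_mul (c : ℂ) (W : MvPolynomial (Fin d) ℂ) :
    diffOp (MvPolynomial.C c * W) = c • diffOp W := by
  induction W using MvPolynomial.induction_on' with
  | monomial a c' => rw [MvPolynomial.C_mul_monomial, diffOp_monomial, diffOp_monomial, mul_smul]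
  | add p q hp hq => rw [mul_add, diffOp_add, hp, hq, diffOp_add, smul_add]

theorem diffOp_comm_opD (i : Fin d) (W : MvPolynomial (Fin d) ℂ) :
    Commute (opD i) (diffOp W) := by
  refine Commute.sum_right _ _ _ fun a _ => Commute.smul_right ?_ _
  have h := monoOp_comm (Finsupp.single i 1) a
  rwa [monoOp_single, pow_one] at h

namespace IsSkewPairing

variable {b : 𝓢(E d, ℂ) → 𝓢(E d, ℂ) → ℂ}

theorem zero_left (hb : IsSkewPairing b) (B : 𝓢(E d, ℂ)) : b 0 B = 0 := by
  simpa using hb.smul_left 0 0 B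

theorem zero_right (hb : IsSkewPairing b) (A : 𝓢(E d, ℂ)) : b A 0 = 0 := by
  simpa using hb.smul_right 0 A 0

theorem sum_left (hb : IsSkewPairing b) {ι : Type*} (s : Finset ι) (f : ι → 𝓢(E d, ℂ))
    (B : 𝓢(E d, ℂ)) : b (∑ i ∈ s, f i) B = ∑ i ∈ s, b (f i) B :=
  map_sum (AddMonoidHom.mk' (fun A => b A B) fun A A' => hb.add_left A A' B) f s

theorem sum_right (hb : IsSkewPairing b) {ι : Type*} (s : Finset ι) (f : ι → 𝓢(E d, ℂ))
    (A : 𝓢(E d, ℂ)) : b A (∑ i ∈ s, f i) = ∑ i ∈ s, b A (f i) :=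
  map_sum (AddMonoidHom.mk' (fun B => b A B) fun B B' => hb.add_right A B B') f s

theorem opD_pow_left (hb : IsSkewPairing b) (i : Fin d) (n : ℕ) :
    ∀ A B, b ((opD i ^ n) A) B = (-1) ^ n * b A ((opD i ^ n) B) := by
  induction n with
  | zero => intro A B; simp
  | succ n ih =>
    intro A B
    have h1 : (opD i ^ (n + 1)) A = (opD i ^ n) (opD i A) := by rw [pow_succ]; rfl
    have h2 : (opD i ^ (n + 1)) B = opD i ((opD i ^ n) B) := by rw [pow_succ']; rfl
    rw [h1, h2, ih, hb.opD_left]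
    ring

theorem monoOp_left (hb : IsSkewPairing b) (a : Fin d →₀ ℕ) :
    ∀ A B, b (monoOp a A) B = (-1) ^ (∑ i, a i) * b A (monoOp a B) := by
  induction a using Finsupp.induction_linear with
  | zero => intro A B; simp [monoOp]
  | add a a' h h' =>
    intro A B
    have h1 : monoOp (a + a') A = monoOp a (monoOp a' A) := by rw [monoOp_add]; rfl
    have h2 : monoOp (a + a') B = monoOp a' (monoOp a B) := by
      rw [add_comm, monoOp_add]; rfl
    rw [h1, h2, h, h']
    simp only [Finsupp.add_apply, Finset.sum_add_distrib, pow_add]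
    ring
  | single i n =>
    intro A B
    rw [monoOp_single, hb.opD_pow_left]
    simp [Finsupp.single_apply]

/-- Each derivative changes sign when it is moved to the other slot, and the number of derivatives
is even. -/
theorem diffOp_left (hb : IsSkewPairing b) {W : MvPolynomial (Fin d) ℂ} {j : ℕ}
    (hW : W.IsHomogeneous (2 * j)) (A B : 𝓢(E d, ℂ)) : b (diffOp W A) B = b A (diffOp W B) := by
  rw [diffOp, LinearMap.sum_apply, LinearMap.sum_apply, hb.sum_left, hb.sum_right]
  refine Finset.sum_congr rfl fun a ha => ?_
  have h := hW (MvPolynomial.mem_support_iff.mp ha)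
  rw [Finsupp.weight_apply, Finsupp.sum_fintype _ _ (by simp)] at h
  simp only [Pi.one_apply, smul_eq_mul, mul_one] at h
  have h2 := hb.monoOp_left a A B
  rw [h, pow_mul, neg_one_sq, one_pow, one_mul] at h2
  rw [LinearMap.smul_apply, LinearMap.smul_apply, hb.smul_left, hb.smul_right]
  exact congrArg (MvPolynomial.coeff a W * ·) h2

end IsSkewPairing

/-! ### Bilinear forms with a given generating polynomial -/

/-- `∑_{α, γ} b(φ_α, P_{α γ}(∂) χ_γ)`, where `G = ∑_{α, γ} q'^α q^γ / (α! γ!) P_{α γ}`. -/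
def genForm (b : 𝓢(E d, ℂ) → 𝓢(E d, ℂ) → ℂ) (G : GenPoly d) (φ χ : Fields d) : ℂ :=
  ∑ a ∈ G.support, ((multiFactorial (Finsupp.sumFinsuppEquivProdFinsupp a).1 *
    multiFactorial (Finsupp.sumFinsuppEquivProdFinsupp a).2 : ℕ) : ℂ) *
      b (φ (Finsupp.sumFinsuppEquivProdFinsupp a).1)
        (diffOp (G.coeff a) (χ (Finsupp.sumFinsuppEquivProdFinsupp a).2))

variable {b : 𝓢(E d, ℂ) → 𝓢(E d, ℂ) → ℂ}

theorem genForm_eq_sum (hb : IsSkewPairing b) {G : GenPoly d} {S : Finset (Fin d ⊕ Fin d →₀ ℕ)}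
    (h : G.support ⊆ S) (φ χ : Fields d) : genForm b G φ χ =
    ∑ a ∈ S, ((multiFactorial (Finsupp.sumFinsuppEquivProdFinsupp a).1 *
      multiFactorial (Finsupp.sumFinsuppEquivProdFinsupp a).2 : ℕ) : ℂ) *
        b (φ (Finsupp.sumFinsuppEquivProdFinsupp a).1)
          (diffOp (G.coeff a) (χ (Finsupp.sumFinsuppEquivProdFinsupp a).2)) :=
  Finset.sum_subset h fun a _ ha => by
    rw [MvPolynomial.notMem_support_iff.mp ha, diffOp_zero, LinearMap.zero_apply, hb.zero_right,
      mul_zero]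

theorem genForm_add (hb : IsSkewPairing b) (G G' : GenPoly d) (φ χ : Fields d) :
    genForm b (G + G') φ χ = genForm b G φ χ + genForm b G' φ χ := by
  classical
  rw [genForm_eq_sum hb MvPolynomial.support_add,
    genForm_eq_sum (G := G) hb Finset.subset_union_left,
    genForm_eq_sum (G := G') hb Finset.subset_union_right, ← Finset.sum_add_distrib]
  exact Finset.sum_congr rfl fun a _ => by
    rw [MvPolynomial.coeff_add, diffOp_add, LinearMap.add_apply, hb.add_right, mul_add]

theorem genForm_sum (hb : IsSkewPairing b) {ι : Type*} (s : Finset ι) (G : ι → GenPoly d)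
    (φ χ : Fields d) : genForm b (∑ i ∈ s, G i) φ χ = ∑ i ∈ s, genForm b (G i) φ χ :=
  map_sum (AddMonoidHom.mk' (fun G => genForm b G φ χ) fun G G' => genForm_add hb G G' φ χ) G s

theorem genForm_neg (hb : IsSkewPairing b) (G : GenPoly d) (φ χ : Fields d) :
    genForm b (-G) φ χ = -genForm b G φ χ :=
  map_neg (AddMonoidHom.mk' (fun G => genForm b G φ χ) fun G G' => genForm_add hb G G' φ χ) G

theorem genForm_sub (hb : IsSkewPairing b) (G G' : GenPoly d) (φ χ : Fields d) :
    genForm b (G - G') φ χ = genForm b G φ χ - genForm b G' φ χ := by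
  rw [sub_eq_add_neg, genForm_add hb, genForm_neg hb, ← sub_eq_add_neg]

theorem genForm_monomial (hb : IsSkewPairing b) (a : Fin d ⊕ Fin d →₀ ℕ)
    (c : MvPolynomial (Fin d) ℂ) (φ χ : Fields d) :
    genForm b (MvPolynomial.monomial a c) φ χ =
      ((multiFactorial (Finsupp.sumFinsuppEquivProdFinsupp a).1 *
        multiFactorial (Finsupp.sumFinsuppEquivProdFinsupp a).2 : ℕ) : ℂ) *
          b (φ (Finsupp.sumFinsuppEquivProdFinsupp a).1)
            (diffOp c (χ (Finsupp.sumFinsuppEquivProdFinsupp a).2)) := by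
  classical
  rw [genForm_eq_sum hb MvPolynomial.support_monomial_subset, Finset.sum_singleton,
    MvPolynomial.coeff_monomial, if_pos rfl]

theorem genForm_add_right (hb : IsSkewPairing b) (G : GenPoly d) (φ χ χ' : Fields d) :
    genForm b G φ (χ + χ') = genForm b G φ χ + genForm b G φ χ' := by
  rw [genForm, genForm, genForm, ← Finset.sum_add_distrib]
  exact Finset.sum_congr rfl fun a _ => by rw [Pi.add_apply, map_add, hb.add_right, mul_add]

theorem genForm_add_left (hb : IsSkewPairing b) (G : GenPoly d) (φ φ' χ : Fields d) :
    genForm b G (φ + φ') χ = genForm b G φ χ + genForm b G φ' χ := by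
  rw [genForm, genForm, genForm, ← Finset.sum_add_distrib]
  exact Finset.sum_congr rfl fun a _ => by rw [Pi.add_apply, hb.add_left, mul_add]

theorem genForm_sum_right (hb : IsSkewPairing b) {ι : Type*} (s : Finset ι) (G : GenPoly d)
    (φ : Fields d) (χ : ι → Fields d) :
    genForm b G φ (∑ i ∈ s, χ i) = ∑ i ∈ s, genForm b G φ (χ i) :=
  map_sum (AddMonoidHom.mk' (fun χ => genForm b G φ χ) fun χ χ' => genForm_add_right hb G φ χ χ') χ s

theorem genForm_sum_left (hb : IsSkewPairing b) {ι : Type*} (s : Finset ι) (G : GenPoly d)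
    (φ : ι → Fields d) (χ : Fields d) :
    genForm b G (∑ i ∈ s, φ i) χ = ∑ i ∈ s, genForm b G (φ i) χ :=
  map_sum (AddMonoidHom.mk' (fun φ => genForm b G φ χ) fun φ φ' => genForm_add_left hb G φ φ' χ) φ s

theorem genForm_sub_right (hb : IsSkewPairing b) (G : GenPoly d) (φ χ χ' : Fields d) :
    genForm b G φ (χ - χ') = genForm b G φ χ - genForm b G φ χ' :=
  map_sub (AddMonoidHom.mk' (fun χ => genForm b G φ χ) fun χ χ' => genForm_add_right hb G φ χ χ') χ χ'

theorem genForm_sub_left (hb : IsSkewPairing b) (G : GenPoly d) (φ φ' χ : Fields d) :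
    genForm b G (φ - φ') χ = genForm b G φ χ - genForm b G φ' χ :=
  map_sub (AddMonoidHom.mk' (fun φ => genForm b G φ χ) fun φ φ' => genForm_add_left hb G φ φ' χ) φ φ'

theorem genForm_genConst_mul (hb : IsSkewPairing b) (c : ℝ) (G : GenPoly d) (φ χ : Fields d) :
    genForm b (genConst c * G) φ χ = c * genForm b G φ χ := by
  induction G using MvPolynomial.induction_on' with
  | monomial a W =>
    rw [genConst_apply, MvPolynomial.C_mul_monomial, genForm_monomial hb, genForm_monomial hb,
      diffOp_C_mul, LinearMap.smul_apply, hb.smul_right]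
    ring
  | add p q hp hq => rw [mul_add, genForm_add hb, hp, hq, genForm_add hb, mul_add]

/-- Part of the dictionary between generating polynomials and operators on fields. A factor `∂ᵢ` can
act on either field, with a minus sign on the left one. -/
theorem genForm_dv_mul (hb : IsSkewPairing b) (i : Fin d) (G : GenPoly d) (φ χ : Fields d) :
    genForm b (dv i * G) φ χ = genForm b G φ (xD i χ) := by
  induction G using MvPolynomial.induction_on' with
  | monomial a W =>
    rw [dv, MvPolynomial.C_mul_monomial, genForm_monomial hb, genForm_monomial hb, diffOp_X_mul]
    rfl
  | add p q hp hq => rw [mul_add, genForm_add hb, hp, hq, genForm_add hb]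

theorem genForm_dv_mul_left (hb : IsSkewPairing b) (i : Fin d) (G : GenPoly d) (φ χ : Fields d) :
    genForm b (dv i * G) φ χ = -genForm b G (xD i φ) χ := by
  induction G using MvPolynomial.induction_on' with
  | monomial a W =>
    rw [dv, MvPolynomial.C_mul_monomial, genForm_monomial hb, genForm_monomial hb, diffOp_X_mul,
      ← (diffOp_comm_opD i W).eq, xD, hb.opD_left, mul_neg, neg_neg]
    rfl
  | add p q hp hq => rw [mul_add, genForm_add hb, hp, hq, genForm_add hb, neg_add]

theorem multiFactorial_add_single (α : Fin d →₀ ℕ) (i : Fin d) :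
    multiFactorial (α + Finsupp.single i 1) = multiFactorial α * (α i + 1) := by
  classical
  rw [multiFactorial, multiFactorial, ← Finset.mul_prod_erase _ _ (Finset.mem_univ i),
    ← Finset.mul_prod_erase Finset.univ (fun j => (α j).factorial) (Finset.mem_univ i)]
  have h : ∀ j ∈ Finset.univ.erase i, ((α + Finsupp.single i 1 : Fin d →₀ ℕ) j).factorial = (α j).factorial := by
    intro j hj
    rw [Finsupp.add_apply, Finsupp.single_eq_of_ne (Finset.ne_of_mem_erase hj), add_zero]
  rw [Finset.prod_congr rfl h, Finsupp.add_apply, Finsupp.single_eq_same, Nat.factorial_succ]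
  ring

/-- The factor `γᵢ + 1` by which the factorial weight grows is exactly the one produced by `∂/∂pᵢ`
on the coefficients of a power series in `p`. -/
theorem genForm_qv_mul (hb : IsSkewPairing b) (i : Fin d) (G : GenPoly d) (φ χ : Fields d) :
    genForm b (qv i * G) φ χ = genForm b G φ (pD i χ) := by
  induction G using MvPolynomial.induction_on' with
  | monomial a W =>
    have h : qv i * MvPolynomial.monomial a W =
        MvPolynomial.monomial (a + Finsupp.single (Sum.inr i) 1) W := by
      rw [qv, MvPolynomial.X, MvPolynomial.monomial_mul, one_mul, add_comm]
    have h1 : (Finsupp.sumFinsuppEquivProdFinsupp (a + Finsupp.single (Sum.inr i) 1)).1 =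
        (Finsupp.sumFinsuppEquivProdFinsupp a).1 := by
      ext j; simp [Finsupp.sumFinsuppEquivProdFinsupp]
    have h2 : (Finsupp.sumFinsuppEquivProdFinsupp (a + Finsupp.single (Sum.inr i) 1)).2 =
        (Finsupp.sumFinsuppEquivProdFinsupp a).2 + Finsupp.single i 1 := by
      ext j; simp [Finsupp.sumFinsuppEquivProdFinsupp, Finsupp.single_apply]
    rw [h, genForm_monomial hb, genForm_monomial hb, h1, h2, multiFactorial_add_single, pD,
      ← Nat.cast_smul_eq_nsmul ℂ, map_smul, hb.smul_right]
    push_cast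
    ring
  | add p q hp hq => rw [mul_add, genForm_add hb, hp, hq, genForm_add hb]

theorem genForm_qv'_mul (hb : IsSkewPairing b) (i : Fin d) (G : GenPoly d) (φ χ : Fields d) :
    genForm b (qv' i * G) φ χ = genForm b G (pD i φ) χ := by
  induction G using MvPolynomial.induction_on' with
  | monomial a W =>
    have h : qv' i * MvPolynomial.monomial a W =
        MvPolynomial.monomial (a + Finsupp.single (Sum.inl i) 1) W := by
      rw [qv', MvPolynomial.X, MvPolynomial.monomial_mul, one_mul, add_comm]
    have h1 : (Finsupp.sumFinsuppEquivProdFinsupp (a + Finsupp.single (Sum.inl i) 1)).2 =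
        (Finsupp.sumFinsuppEquivProdFinsupp a).2 := by
      ext j; simp [Finsupp.sumFinsuppEquivProdFinsupp]
    have h2 : (Finsupp.sumFinsuppEquivProdFinsupp (a + Finsupp.single (Sum.inl i) 1)).1 =
        (Finsupp.sumFinsuppEquivProdFinsupp a).1 + Finsupp.single i 1 := by
      ext j; simp [Finsupp.sumFinsuppEquivProdFinsupp, Finsupp.single_apply]
    rw [h, genForm_monomial hb, genForm_monomial hb, h1, h2, multiFactorial_add_single, pD,
      ← Nat.cast_smul_eq_nsmul ℂ, hb.smul_left]
    push_cast
    ring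
  | add p q hp hq => rw [mul_add, genForm_add hb, hp, hq, genForm_add hb]

theorem box_sub_sq_mul {R ι : Type*} [CommRing R] [Fintype ι] (q p : ι → R) (G : R) :
    ((∑ i, p i * p i) * (∑ i, q i * q i) - (∑ i, q i * p i) ^ 2) * G =
      (∑ i, ∑ j, q j * (q j * (p i * (p i * G)))) - ∑ i, ∑ j, q j * (p j * (q i * (p i * G))) := by
  rw [sub_mul, sq, Finset.sum_mul_sum, Finset.sum_mul_sum]
  simp only [Finset.sum_mul]
  congr 1 <;> exact Finset.sum_congr rfl fun i _ => Finset.sum_congr rfl fun j _ => by ring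

theorem genForm_rhoSq_mul (hb : IsSkewPairing b) (G : GenPoly d) (φ χ : Fields d) :
    genForm b (rhoSq * G) φ χ = genForm b G φ (rhoSqOp χ) := by
  have h : rhoSq * G = (∑ i, ∑ j, qv j * (qv j * (dv i * (dv i * G)))) -
      ∑ i, ∑ j, qv j * (dv j * (qv i * (dv i * G))) := by
    rw [rhoSq, boxPoly, box_sub_sq_mul]
  rw [h, genForm_sub hb, rhoSqOp, genForm_sub_right hb]
  simp only [genForm_sum hb, genForm_sum_right hb, genForm_qv_mul hb, genForm_dv_mul hb]

/-- Every term of `ρ'²` contains two derivatives, so the signs from moving them to the left field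
cancel and the same operator `rhoSqOp` appears in both slots. -/
theorem genForm_rhoSq'_mul (hb : IsSkewPairing b) (G : GenPoly d) (φ χ : Fields d) :
    genForm b (rhoSq' * G) φ χ = genForm b G (rhoSqOp φ) χ := by
  have h : rhoSq' * G = (∑ i, ∑ j, qv' j * (qv' j * (dv i * (dv i * G)))) -
      ∑ i, ∑ j, qv' j * (dv j * (qv' i * (dv i * G))) := by
    rw [rhoSq', boxPoly, box_sub_sq_mul]
  rw [h, genForm_sub hb, rhoSqOp, genForm_sub_left hb]
  simp only [genForm_sum hb, genForm_sum_left hb, genForm_qv'_mul hb, genForm_dv_mul_left hb,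
    neg_neg]

theorem genForm_rhoSq_pow_mul (hb : IsSkewPairing b) (n : ℕ) (G : GenPoly d) :
    ∀ φ χ : Fields d, genForm b (rhoSq ^ n * G) φ χ = genForm b G φ (rhoSqOp^[n] χ) := by
  induction n with
  | zero => intro φ χ; rw [pow_zero, one_mul, Function.iterate_zero_apply]
  | succ n ih =>
    intro φ χ
    rw [pow_succ', mul_assoc, genForm_rhoSq_mul hb, ih, Function.iterate_succ_apply]

theorem genForm_rhoSq'_pow_mul (hb : IsSkewPairing b) (n : ℕ) (G : GenPoly d) :
    ∀ φ χ : Fields d, genForm b (rhoSq' ^ n * G) φ χ = genForm b G (rhoSqOp^[n] φ) χ := by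
  induction n with
  | zero => intro φ χ; rw [pow_zero, one_mul, Function.iterate_zero_apply]
  | succ n ih =>
    intro φ χ
    rw [pow_succ', mul_assoc, genForm_rhoSq'_mul hb, ih, Function.iterate_succ_apply]

/-! ### Decomposition of the quadratic action -/

variable {b : 𝓢(E d, ℂ) → 𝓢(E d, ℂ) → ℂ}

theorem mem_multi {k : ℕ} {α : Fin d →₀ ℕ} : α ∈ multi d k ↔ ∑ i, α i = k := by
  simp [multi, Finset.mem_finsuppAntidiag]

theorem genForm_eq_sum_components (hb : IsSkewPairing b) {G : GenPoly d}
    {P : Finset ((Fin d →₀ ℕ) × (Fin d →₀ ℕ))}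
    (h : ∀ a ∈ G.support, Finsupp.sumFinsuppEquivProdFinsupp a ∈ P) (φ χ : Fields d) :
    genForm b G φ χ = ∑ p ∈ P, b (φ p.1) (diffOp (components G p.1 p.2) (χ p.2)) := by
  rw [genForm_eq_sum hb (S := P.map Finsupp.sumFinsuppEquivProdFinsupp.symm.toEmbedding)
    fun a ha => by
      rw [Finset.mem_map_equiv]
      exact h a ha, Finset.sum_map]
  refine Finset.sum_congr rfl fun p _ => ?_
  rw [Equiv.coe_toEmbedding, Equiv.apply_symm_apply, components, nsmul_eq_mul,
    ← map_natCast (MvPolynomial.C : ℂ →+* MvPolynomial (Fin d) ℂ), diffOp_C_mul,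
    LinearMap.smul_apply, hb.smul_right]
  rfl

theorem spinForm_eq_genForm (hb : IsSkewPairing b) (s : ℕ) (φ χ : Fields d) :
    spinForm b s φ χ = genForm b (spinPoly s) φ χ := by
  rw [genForm_eq_sum_components hb (P := multi d s ×ˢ multi d s), spinForm, Finset.sum_product]
  intro a ha
  obtain ⟨h1, h2⟩ := spinPoly_rank ha
  exact Finset.mem_product.mpr ⟨mem_multi.mpr h1, mem_multi.mpr h2⟩

theorem components_loopGen (ħ : ℝ) {j : ℕ} {α γ : Fin d →₀ ℕ}
    (h : (∑ i, α i) + ∑ i, γ i = 2 * j) :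
    components (loopGen ħ j) α γ = loopOperator ħ α γ := by
  rw [loopOperator, h, Nat.mul_div_cancel_left j two_pos]

/-- At total degree `2j` all components of the wave operator come from the single polynomial
`loopGen ħ j`, whose support lies entirely in that degree. -/
theorem actionOrder_loopOperator_eq_genForm (hb : IsSkewPairing b) (ħ : ℝ) (j : ℕ) (h : Fields d) :
    actionOrder b (loopOperator ħ) (2 * j) h = genForm b (loopGen ħ j) h h := by
  classical
  rw [genForm_eq_sum_components hb (P := (Finset.HasAntidiagonal.antidiagonal (2 * j)).biUnion
    fun p => multi d p.1 ×ˢ multi d p.2), Finset.sum_biUnion, actionOrder]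
  · refine Finset.sum_congr rfl fun p hp => ?_
    rw [Finset.sum_product]
    refine Finset.sum_congr rfl fun α hα => Finset.sum_congr rfl fun γ hγ => ?_
    rw [components_loopGen]
    rw [mem_multi.mp hα, mem_multi.mp hγ, Finset.HasAntidiagonal.mem_antidiagonal.mp hp]
  · intro p _ p' _ hne
    refine Finset.disjoint_left.mpr fun x hx hx' => hne ?_
    rw [Finset.mem_product, mem_multi, mem_multi] at hx hx'
    exact Prod.ext (hx.1.symm.trans hx'.1) (hx.2.symm.trans hx'.2)
  · intro a ha
    have h1 := not_imp_comm.mp (coeff_loopGen_eq_zero ħ) (MvPolynomial.mem_support_iff.mp ha)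
    exact Finset.mem_biUnion.mpr ⟨(∑ i, a (Sum.inl i), ∑ i, a (Sum.inr i)),
      Finset.HasAntidiagonal.mem_antidiagonal.mpr h1,
      Finset.mem_product.mpr ⟨mem_multi.mpr rfl, mem_multi.mpr rfl⟩⟩

theorem actionOrder_loopOperator_odd (hb : IsSkewPairing b) (ħ : ℝ) (j : ℕ) (h : Fields d) :
    actionOrder b (loopOperator ħ) (2 * j + 1) h = 0 := by
  refine Finset.sum_eq_zero fun p hp => Finset.sum_eq_zero fun α hα =>
    Finset.sum_eq_zero fun γ hγ => ?_
  have hN := Finset.HasAntidiagonal.mem_antidiagonal.mp hp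
  rw [mem_multi] at hα hγ
  have h0 : loopOperator ħ α γ = 0 := by
    rw [loopOperator, components, coeff_loopGen_eq_zero, smul_zero]
    simp only [Finsupp.sumElim_inl, Finsupp.sumElim_inr]
    omega
  rw [h0, diffOp_zero, LinearMap.zero_apply, hb.zero_right]

theorem specCoeff_eq (ħ : ℝ) (s : ℕ) : specCoeff d ħ s =
    kappa d ħ * (ħ / 2) ^ ((d : ℝ) - 4) *
      (2 ^ (((d : ℝ) - 3) / 2) * Real.Gamma (s + ((d : ℝ) - 3) / 2 + 1)) := by
  rw [specCoeff, show (s : ℝ) + ((d : ℝ) - 1) / 2 = s + ((d : ℝ) - 3) / 2 + 1 by ring]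
  ring

/-- The coefficient of `ρ^{2r}` in `U_{s+ν}(mρ)`, `m² = -ħ²/4`. -/
def undressCoeff (d : ℕ) (ħ : ℝ) (s r : ℕ) : ℝ :=
  besselCoeff (s + ((d : ℝ) - 3) / 2) r * (-(ħ ^ 2 / 4)) ^ r

/-- The degree-`j` part of the addition theorem in the ring of generating polynomials, with `x =
ρ'²`, `y = ρ²`, `t = τ`; its inner Gegenbauer sum is `spinPoly`. -/
theorem loopGen_eq_sum (hd : 2 < d) (ħ : ℝ) (j : ℕ) : (loopGen ħ j : GenPoly d) =
    ∑ x ∈ Finset.HasAntidiagonal.antidiagonal j, ∑ y ∈ Finset.HasAntidiagonal.antidiagonal x.2,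
      genConst (specCoeff d ħ x.1 * (ħ ^ 2 / 4) ^ x.1 *
        (undressCoeff d ħ x.1 y.1 * undressCoeff d ħ x.1 y.2)) *
      (rhoSq' ^ y.1 * (rhoSq ^ y.2 * spinPoly x.1)) := by
  have hν : (0 : ℝ) ≤ ((d : ℝ) - 3) / 2 := by
    have : (3 : ℝ) ≤ d := by exact_mod_cast hd
    linarith
  have h := bessel_addition (genConst (d := d)) hν rhoSq' rhoSq tauPoly j
  rw [loopGen, loopCoeff, loopPoly, add_comm rhoSq,
    show kappa d ħ * (ħ / 2) ^ ((d : ℝ) - 4) *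
      (besselCoeff (((d : ℝ) - 3) / 2) j * (-(ħ ^ 2 / 4)) ^ j) =
      kappa d ħ * (ħ / 2) ^ ((d : ℝ) - 4) * (-(ħ ^ 2 / 4)) ^ j *
        besselCoeff (((d : ℝ) - 3) / 2) j by ring, map_mul, mul_assoc, h, Finset.mul_sum]
  refine Finset.sum_congr rfl fun x hx => ?_
  rw [Finset.mul_sum]
  refine Finset.sum_congr rfl fun y hy => ?_
  have hx' := Finset.HasAntidiagonal.mem_antidiagonal.mp hx
  have hy' := Finset.HasAntidiagonal.mem_antidiagonal.mp hy
  have hs : ∑ k ∈ Finset.range (x.1 / 2 + 1), genConst (gegCoeff (((d : ℝ) - 3) / 2) x.1 k) *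
      (2 * tauPoly) ^ (x.1 - 2 * k) * (rhoSq' * rhoSq) ^ k = (spinPoly x.1 : GenPoly d) := by
    rw [spinPoly_eq]
    exact Finset.sum_congr rfl fun k _ => by rw [mul_comm rhoSq', mul_assoc]
  rw [hs, ← mul_assoc, ← mul_assoc, ← map_mul, mul_assoc (genConst _), mul_assoc (rhoSq' ^ y.1)]
  congr 2
  rw [specCoeff_eq, undressCoeff, undressCoeff, ← hx', ← hy', pow_add, pow_add,
    neg_pow (ħ ^ 2 / 4) x.1]
  -- The sign `(-1)ˢ` of the addition theorem cancels the sign in `m^{2s} = (-ħ²/4)ˢ`, which is why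
  -- all spins enter with positive coefficients.
  have h1 : ((-1 : ℝ) ^ x.1) * (-1) ^ x.1 = 1 := by rw [← mul_pow]; simp
  linear_combination (kappa d ħ * (ħ / 2) ^ ((d : ℝ) - 4) * (ħ ^ 2 / 4) ^ x.1 *
    (-(ħ ^ 2 / 4)) ^ y.1 * (-(ħ ^ 2 / 4)) ^ y.2 * 2 ^ (((d : ℝ) - 3) / 2) *
    Real.Gamma (x.1 + ((d : ℝ) - 3) / 2 + 1) * besselCoeff (x.1 + ((d : ℝ) - 3) / 2) y.1 *
    besselCoeff (x.1 + ((d : ℝ) - 3) / 2) y.2) * h1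

theorem spinForm_undressOrder (hb : IsSkewPairing b) (ħ : ℝ) (s r r' : ℕ) (h h' : Fields d) :
    spinForm b s (undressOrder ħ s r h) (undressOrder ħ s r' h') =
      ((undressCoeff d ħ s r * undressCoeff d ħ s r' : ℝ) : ℂ) *
        spinForm b s (rhoSqOp^[r] h) (rhoSqOp^[r'] h') := by
  rw [spinForm, spinForm, Finset.mul_sum]
  refine Finset.sum_congr rfl fun α hα => ?_
  rw [Finset.mul_sum]
  refine Finset.sum_congr rfl fun γ hγ => ?_
  rw [undressOrder, if_pos hα, undressOrder, if_pos hγ, map_smul, hb.smul_left, hb.smul_right,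
    ← undressCoeff, ← undressCoeff]
  push_cast
  ring

/-- The powers of `ρ'²` and `ρ²` in `loopGen_eq_sum` pass to the left and right field, and with
their Bessel coefficients they form terms of the two undressed fields. -/
theorem actionOrder_loopOperator_even (hd : 2 < d) (hb : IsSkewPairing b) (ħ : ℝ) (j : ℕ)
    (h : Fields d) : actionOrder b (loopOperator ħ) (2 * j) h =
      ∑ x ∈ Finset.HasAntidiagonal.antidiagonal j, ∑ y ∈ Finset.HasAntidiagonal.antidiagonal x.2,
        ((specCoeff d ħ x.1 * (ħ ^ 2 / 4) ^ x.1 : ℝ) : ℂ) *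
          spinForm b x.1 (undressOrder ħ x.1 y.1 h) (undressOrder ħ x.1 y.2 h) := by
  rw [actionOrder_loopOperator_eq_genForm hb, loopGen_eq_sum hd, genForm_sum hb]
  refine Finset.sum_congr rfl fun x _ => ?_
  rw [genForm_sum hb]
  refine Finset.sum_congr rfl fun y _ => ?_
  rw [genForm_genConst_mul hb, genForm_rhoSq'_pow_mul hb, genForm_rhoSq_pow_mul hb,
    spinForm_undressOrder hb, spinForm_eq_genForm hb, Complex.ofReal_mul, mul_assoc]

theorem specCoeff_mul_pow_pos (hd : 2 < d) {ħ : ℝ} (hħ : 0 < ħ) (s : ℕ) :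
    0 < specCoeff d ħ s * (ħ ^ 2 / 4) ^ s := by
  have hd' : (2 : ℝ) < d := by exact_mod_cast hd
  have hG : 0 < Real.Gamma (s + ((d : ℝ) - 1) / 2) :=
    Real.Gamma_pos_of_pos (by have : (0 : ℝ) ≤ s := s.cast_nonneg; linarith)
  rw [specCoeff, kappa]
  have := Real.pi_pos
  positivity

/-! ### Fields polynomial in `p` -/

theorem degree_add_single (β : Fin d →₀ ℕ) (i : Fin d) :
    ∑ j, (β + Finsupp.single i 1 : Fin d →₀ ℕ) j = (∑ j, β j) + 1 := by
  simp [Finset.sum_add_distrib, Finsupp.single_apply]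

/-- The operator `ρ²` lowers the degree in `p` by two; `k` records how far the degree has already
been lowered below `M`. For a polynomial field the undressing series therefore terminates. -/
theorem rhoSqOp_eq_zero {M k : ℕ} {h : Fields d} (hh : ∀ β, M < (∑ i, β i) + k → h β = 0)
    (β : Fin d →₀ ℕ) (hβ : M < (∑ i, β i) + (k + 2)) : rhoSqOp h β = 0 := by
  have hx : ∀ (k : ℕ) (g : Fields d), (∀ β, M < (∑ i, β i) + k → g β = 0) → ∀ i,
      ∀ β, M < (∑ i, β i) + k → xD i g β = 0 := fun k g hg i β hβ => by
    rw [xD, hg β hβ, map_zero]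
  have hp : ∀ (k : ℕ) (g : Fields d), (∀ β, M < (∑ i, β i) + k → g β = 0) → ∀ i,
      ∀ β, M < (∑ i, β i) + (k + 1) → pD i g β = 0 := fun k g hg i β hβ => by
    rw [pD, hg _ (by rw [degree_add_single]; omega), smul_zero]
  rw [rhoSqOp, Pi.sub_apply, Finset.sum_apply, Finset.sum_apply, Finset.sum_eq_zero,
    Finset.sum_eq_zero, sub_zero]
  · intro i _
    rw [Finset.sum_apply]
    exact Finset.sum_eq_zero fun j _ =>
      hx _ _ (hp _ _ (hx _ _ (hp _ _ hh j) j) i) i β hβ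
  · intro i _
    rw [Finset.sum_apply]
    exact Finset.sum_eq_zero fun j _ =>
      hx _ _ (hx _ _ (hp _ _ (hp _ _ hh j) j) i) i β hβ

theorem iterate_rhoSqOp_eq_zero {M : ℕ} {h : Fields d} (hh : ∀ β, M < ∑ i, β i → h β = 0) (r : ℕ) :
    ∀ β : Fin d →₀ ℕ, M < (∑ i, β i) + 2 * r → (rhoSqOp^[r] h) β = 0 := by
  induction r with
  | zero => exact hh
  | succ r ih =>
    rw [Function.iterate_succ_apply']
    exact rhoSqOp_eq_zero ih

theorem undressOrder_eq_zero {M : ℕ} {h : Fields d} (hh : ∀ β, M < ∑ i, β i → h β = 0) (ħ : ℝ)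
    {s r : ℕ} (hr : M < s + 2 * r) : undressOrder ħ s r h = 0 := by
  funext α
  rw [undressOrder]
  split_ifs with hα
  · rw [iterate_rhoSqOp_eq_zero hh r α (by rwa [mem_multi.mp hα]), smul_zero, Pi.zero_apply]
  · rfl

theorem undress_eq_sum {M : ℕ} {h : Fields d} (hh : ∀ β, M < ∑ i, β i → h β = 0) (ħ : ℝ) (s : ℕ) :
    undress ħ s h = ∑ r ∈ Finset.range (M + 1), undressOrder ħ s r h := by
  funext α
  rw [undress, Finset.sum_apply]
  refine finsum_eq_sum_of_support_subset _ fun r hr => ?_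
  by_contra hr'
  refine hr ?_
  rw [Finset.coe_range, Set.mem_Iio] at hr'
  show undressOrder ħ s r h α = 0
  rw [undressOrder_eq_zero hh ħ (by omega), Pi.zero_apply]

/-- For a field of degree at most `M` in `p`, only finitely many triples (spin, left order, right
order) contribute. The sum grouped by order can then be regrouped by spin. -/
theorem finsum_actionOrder_loopOperator (hd : 2 < d) (hb : IsSkewPairing b) (ħ : ℝ) {h : Fields d}
    (hfin : (Function.support h).Finite) :
    ∑ᶠ N : ℕ, actionOrder b (loopOperator ħ) N h =
      ∑ᶠ s : ℕ, ((specCoeff d ħ s * (ħ ^ 2 / 4) ^ s : ℝ) : ℂ) *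
        spinForm b s (undress ħ s h) (undress ħ s h) := by
  obtain ⟨M, hh⟩ : ∃ M : ℕ, ∀ β, M < ∑ i, β i → h β = 0 := by
    refine ⟨hfin.toFinset.sup fun β => ∑ i, β i, fun β hβ => ?_⟩
    by_contra h0
    exact absurd (Finset.le_sup (f := fun β : Fin d →₀ ℕ => ∑ i, β i)
      (hfin.mem_toFinset.mpr h0)) (not_le.mpr hβ)
  set F : ℕ × ℕ × ℕ → ℂ := fun x => ((specCoeff d ħ x.1 * (ħ ^ 2 / 4) ^ x.1 : ℝ) : ℂ) *
    spinForm b x.1 (undressOrder ħ x.1 x.2.1 h) (undressOrder ħ x.1 x.2.2 h) with hF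
  have hl : ∀ (s r r' : ℕ), M < s + 2 * r → F (s, r, r') = 0 := fun s r r' hr => by
    simp only [hF, undressOrder_eq_zero hh ħ hr, spinForm, Pi.zero_apply, hb.zero_left,
      Finset.sum_const_zero, mul_zero]
  have hr : ∀ (s r r' : ℕ), M < s + 2 * r' → F (s, r, r') = 0 := fun s r r' hr => by
    simp only [hF, undressOrder_eq_zero hh ħ hr, spinForm, Pi.zero_apply, map_zero, hb.zero_right,
      Finset.sum_const_zero, mul_zero]
  have hsum : ∀ s, ((specCoeff d ħ s * (ħ ^ 2 / 4) ^ s : ℝ) : ℂ) *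
      spinForm b s (undress ħ s h) (undress ħ s h) =
      ∑ x ∈ Finset.range (M + 1) ×ˢ Finset.range (M + 1), F (s, x) := fun s => by
    rw [undress_eq_sum hh, spinForm_eq_genForm hb, genForm_sum_left hb, Finset.sum_product,
      Finset.mul_sum]
    refine Finset.sum_congr rfl fun r _ => ?_
    rw [genForm_sum_right hb, Finset.mul_sum]
    exact Finset.sum_congr rfl fun r' _ => by simp only [hF, spinForm_eq_genForm hb]
  have hS : HasSum F (∑ x ∈ Finset.range (M + 1) ×ˢ (Finset.range (M + 1) ×ˢ Finset.range (M + 1)),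
      F x) := by
    refine hasSum_sum_of_ne_finset_zero fun x hx => ?_
    simp only [Finset.mem_product, Finset.mem_range] at hx
    by_cases h1 : M < x.1 + 2 * x.2.1
    · exact hl _ _ _ h1
    · exact hr x.1 x.2.1 x.2.2 (by omega)
  have hE : HasSum (fun N => actionOrder b (loopOperator ħ) N h)
      (∑ x ∈ Finset.range (M + 1) ×ˢ (Finset.range (M + 1) ×ˢ Finset.range (M + 1)), F x) := by
    have hinj : Function.Injective fun j : ℕ => 2 * j := fun i j hij => by
      simpa using hij
    refine (hinj.hasSum_iff fun N hN => ?_).mp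
      ((congrArg (HasSum · _) (funext fun j => ?_)).mpr (hasSum_antidiagonal_antidiagonal hS))
    · rcases Nat.even_or_odd' N with ⟨j, rfl | rfl⟩
      · exact absurd ⟨j, rfl⟩ hN
      · exact actionOrder_loopOperator_odd hb ħ j h
    · exact actionOrder_loopOperator_even hd hb ħ j h
  -- A `finsum` over an infinite support is `0` by convention, so finiteness is checked first: if
  -- `|α| + |γ| > 2M`, one of the two fields vanishes.
  have hsupp : (Function.support fun N => actionOrder b (loopOperator ħ) N h).Finite := by
    refine (Set.finite_Iic (2 * M)).subset fun N hN => ?_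
    by_contra hN'
    refine hN (Finset.sum_eq_zero fun p hp => Finset.sum_eq_zero fun α hα =>
      Finset.sum_eq_zero fun γ hγ => ?_)
    have hp' := Finset.HasAntidiagonal.mem_antidiagonal.mp hp
    rw [mem_multi] at hα hγ
    rw [Set.mem_Iic] at hN'
    by_cases h1 : M < ∑ i, α i
    · rw [hh α h1, hb.zero_left]
    · rw [hh γ (by omega), map_zero, hb.zero_right]
  rw [← tsum_eq_finsum (L := SummationFilter.unconditional ℕ) hsupp, hE.tsum_eq, finsum_eq_sum_of_support_subset _
    (s := Finset.range (M + 1)), Finset.sum_product]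
  · exact Finset.sum_congr rfl fun s _ => (hsum s).symm
  · intro s hs
    by_contra hs'
    refine hs ?_
    rw [Finset.coe_range, Set.mem_Iio] at hs'
    exact (hsum s).trans <| Finset.sum_eq_zero fun x _ => hl _ _ _ (by omega)

/-! ### Odd dimensions -/

theorem rename_swap_loopGen (ħ : ℝ) (j : ℕ) :
    MvPolynomial.rename Sum.swap (loopGen ħ j : GenPoly d) = loopGen ħ j := by
  simp only [loopGen, loopPoly, map_mul, map_add, map_pow, rename_swap_tauPoly, rename_swap_rhoSq,
    rename_swap_rhoSq', genConst_apply, MvPolynomial.rename_C, map_ofNat, add_comm rhoSq']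

theorem loopOperator_symm (ħ : ℝ) (α γ : Fin d →₀ ℕ) :
    loopOperator ħ γ α = loopOperator ħ α γ := by
  have hc : ∀ j, (loopGen ħ j).coeff (Finsupp.sumElim γ α) =
      (loopGen ħ j).coeff (Finsupp.sumElim α γ) := fun j => by
    have h := MvPolynomial.coeff_rename_mapDomain Sum.swap Sum.swap_leftInverse.injective
      (loopGen ħ j : GenPoly d) (Finsupp.sumElim α γ)
    rw [rename_swap_loopGen] at h
    rw [← h]
    congr 1
    ext i
    have := Finsupp.mapDomain_apply (M := ℕ) (f := Sum.swap)
      (Sum.swap_leftInverse (α := Fin d) (β := Fin d)).injective (Finsupp.sumElim α γ) i.swap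
    rw [Sum.swap_swap] at this
    rw [this]
    rcases i with i | i <;> rfl
  rw [loopOperator, loopOperator, components, components, add_comm (∑ i, γ i), hc,
    mul_comm (multiFactorial γ)]

/-- Exchanging the two fields costs no sign from the wave operator, which is symmetric and of even
order, and one sign from the pairing. The action is thus equal to its negative. -/
theorem actionOrder_loopOperator_of_antisymm (hb : IsSkewPairing b)
    (hanti : ∀ A B, b A B = -b B A) (ħ : ℝ) (h : Fields d) (N : ℕ) :
    actionOrder b (loopOperator ħ) N h = 0 := by
  rcases Nat.even_or_odd' N with ⟨j, rfl | rfl⟩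
  · have key : actionOrder b (loopOperator ħ) (2 * j) h =
        -actionOrder b (loopOperator ħ) (2 * j) h := by
      conv_lhs => rw [actionOrder, ← Finset.Nat.sum_antidiagonal_swap]
      rw [actionOrder, ← Finset.sum_neg_distrib]
      refine Finset.sum_congr rfl fun p hp => ?_
      rw [Finset.sum_comm, ← Finset.sum_neg_distrib]
      refine Finset.sum_congr rfl fun α hα => ?_
      rw [← Finset.sum_neg_distrib]
      refine Finset.sum_congr rfl fun γ hγ => ?_
      have hN : (∑ i, γ i) + ∑ i, α i = 2 * j := by
        have := Finset.HasAntidiagonal.mem_antidiagonal.mp hp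
        rw [mem_multi] at hα hγ
        omega
      have hV := isHomogeneous_loopOperator ħ γ α
      rw [hN] at hV
      rw [← hb.diffOp_left hV, hanti, loopOperator_symm]
    exact self_eq_neg.mp key
  · exact actionOrder_loopOperator_odd hb ħ j h

theorem IsBoxPairing.antisymm (hb : IsBoxPairing b) (hd : Odd d) (A B : 𝓢(E d, ℂ)) :
    b A B = -b B A := by
  rcases hb with ⟨he, -⟩ | ⟨-, r, hr, rfl⟩
  · exact absurd hd (Nat.not_odd_iff_even.mpr he)
  · exact fourierPairing_antisymm hr A B

end ConfHS

end

/-! ### Assembly of the theorem, with `loopOperator` as the wave operator. -/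

open ConfHS in
theorem mainTheorem1 (d : ℕ) (hd : 2 < d) (ħ : ℝ) (hħ : 0 < ħ) :
    -- the generating function of the quadratic term
    (∀ q q' κ : E d, κ ≠ 0 → IsGenFun ħ q q' κ (genFun ħ q q' κ)) ∧
    -- its decomposition into deformed spin-`s` theories with `μ/√□ = m = ± iħ/2`
    (∀ q q' κ : E d, κ ≠ 0 → ∀ m : ℂ,
      (m = Complex.I * ħ / 2 ∨ m = -(Complex.I * ħ / 2)) →
        HasSum (fun s : ℕ => (m ^ (d - 3))⁻¹ * ((-1) ^ s * (specCoeff d ħ s : ℂ)) *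
          deformedGen m s q q' κ) (genFun ħ q q' κ)) ∧
    -- the conformal spin-`s` wave operators, of order `d - 4 + 2 s`
    (∀ s : ℕ, IsConformalSpin s (spinPoly s : GenPoly d)) ∧
    (∀ (s : ℕ) (q q' κ : E d) (t : ℝ), κ ≠ 0 → 0 < t →
      confGen s q q' (t • κ) = ((t ^ ((d : ℝ) - 4 + 2 * s) : ℝ) : ℂ) * confGen s q q' κ) ∧
    -- the quadratic action as a sum of conformal spin-`s` actions of the undressed fields
    ∃ V : WaveOp d, IsWaveOperator ħ V ∧ (∀ V' : WaveOp d, IsWaveOperator ħ V' → V' = V) ∧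
      (∀ α γ, (V α γ).IsHomogeneous ((∑ i, α i) + ∑ i, γ i)) ∧
      (∀ s : ℕ, 0 < specCoeff d ħ s * (ħ ^ 2 / 4) ^ s) ∧
      ∀ b : 𝓢(E d, ℂ) → 𝓢(E d, ℂ) → ℂ, IsBoxPairing b →
        (∀ (h : Fields d) (j : ℕ),
          actionOrder b V (2 * j + 1) h = 0 ∧
          actionOrder b V (2 * j) h =
            ∑ x ∈ Finset.HasAntidiagonal.antidiagonal j, ∑ y ∈ Finset.HasAntidiagonal.antidiagonal x.2,
              ((specCoeff d ħ x.1 * (ħ ^ 2 / 4) ^ x.1 : ℝ) : ℂ) *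
                spinForm b x.1 (undressOrder ħ x.1 y.1 h) (undressOrder ħ x.1 y.2 h)) ∧
        (∀ h : Fields d, (Function.support h).Finite →
          ∑ᶠ N : ℕ, actionOrder b V N h =
            ∑ᶠ s : ℕ, ((specCoeff d ħ s * (ħ ^ 2 / 4) ^ s : ℝ) : ℂ) *
              spinForm b s (undress ħ s h) (undress ħ s h)) ∧
        (Odd d → ∀ (h : Fields d) (N : ℕ), actionOrder b V N h = 0) := by
  exact ⟨fun q q' κ hκ => isGenFun_genFun hd hħ q q' hκ,
    fun q q' κ _ m hm => hasSum_deformedGen hd hħ q q' κ hm,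
    isConformalSpin_spinPoly hd, fun s q q' κ t hκ ht => confGen_smul s q q' κ hκ ht,
    loopOperator ħ, isWaveOperator_loopOperator hd hħ,
    fun V' hV' => hV'.unique hd hħ (isWaveOperator_loopOperator hd hħ),
    isHomogeneous_loopOperator ħ, specCoeff_mul_pow_pos hd hħ, fun b hb =>
      have hb' := hb.isSkewPairing hd
      ⟨fun h j => ⟨actionOrder_loopOperator_odd hb' ħ j h,
        actionOrder_loopOperator_even hd hb' ħ j h⟩,
      fun h hfin => finsum_actionOrder_loopOperator hd hb' ħ hfin,
      fun hodd h N => actionOrder_loopOperator_of_antisymm hb' (hb.antisymm hodd) ħ h N⟩⟩
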